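/- Let $\kappa_\infty>0$ and let $\kappa:\mathbb R\to\mathbb R$ be a domain wall function: $\kappa\in C^1(\mathbb R)$, $\kappa$ is odd, $\kappa(x)=-\kappa_\infty$ for $x\le -1$ and $\kappa(x)=\kappa_\infty$ for $x\ge 1$. On $\mathcal H=L^2(\mathbb R;\mathbb C^2)$, and for a bounded measurable real function $m$, let $\mathcal D_m=i\sigma_3\partial_x+m(x)\sigma_1$ with domain $\mathcal H^1=H^1(\mathbb R;\mathbb C^2)$, where $\sigma_1=\begin{pmatrix}0&1\\1&0\end{pmatrix}$, $\sigma_3=\begin{pmatrix}1&0\\0&-1\end{pmatrix}$. Let $$\alpha_\star(x)=\gamma\begin{pmatrix}1\\ i\end{pmatrix}e^{-\int_0^x\kappa(y)\,dy},\qquad \gamma=\frac{1}{\sqrt2\,\|e^{-\int_0^x\kappa(y)\,dy}\|_{L^2}},$$ and assume the spectral gap condition: $\|\mathcal D_\kappa f\|_{\mathcal H}\ge\kappa_\infty\|f\|_{\mathcal H}$ for all $f\in\mathcal H^1$ with $\langle\alpha_\star,f\rangle_{\mathcal H}=0$. For $\delta>1$ let $$\kappa^\delta(x)=\begin{cases}\kappa(x+2\delta)&x\le-\delta,\\-\kappa(x)&-\delta\le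 x\le\delta,\\ \kappa(x-2\delta)&x\ge\delta,\end{cases}$$ and let $\alpha_\star^R(x)=\alpha_\star(x-2\delta)$, $\alpha_\star^0(x)=\overline{\alpha_\star(x)}$, $\alpha_\star^L(x)=\alpha_\star(x+2\delta)$. Theorem (three domain walls). Let $0<K<\kappa_\infty$. There are constants $\delta_0\ge2$ and $C$, depending only on $\kappa$ and $K$, such that for every $\delta>\delta_0$: (i) The function $\alpha_\star^\delta(x)=\gamma^\delta\begin{pmatrix}1\\ i\end{pmatrix}e^{-\int_0^x\kappa^\delta(y)\,dy}$, with $\gamma^\delta=\big(\sqrt2\,\|e^{-\int_0^x\kappa^\delta(y)\,dy}\|_{L^2}\big)^{-1}$, belongs to $\mathcal H$, has norm $1$, and spans the kernel of $\mathcal D_{\kappa^\delta}$. (ii) $\mathcal D_{\kappa^\delta}$ has exactly three eigenvalues in $[-K,K]$, namely $E_-<0<E_+$ and $0$, and all three are simple. Moreover $$\Big|E_\pm\mp2\sqrt2\,\gamma^2e^{-2\int_0^\delta\kappa(y)\,dy}\Big|\le C\,e^{-4\kappa_\infty\delta}.$$ (iii) There are normalized eigenfunctions $\alpha_\pm$ of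 $\mathcal D_{\kappa^\delta}$ with eigenvalues $E_\pm$ such that $$\Big\|\alpha_\pm-\tfrac12\big(\alpha_\star^R\pm\sqrt2\,i\,\alpha_\star^0-\alpha_\star^L\big)\Big\|_{\mathcal H}\le C\,e^{-2\kappa_\infty\delta}.$$ -/

import Mathlib

open MeasureTheory Complex
open scoped ENNReal ContDiff

noncomputable section

namespace DomainWallDirac

/-- The fibre `ℂ²` with its Hermitian inner product (conjugate linear in the first slot). -/
abbrev C2 : Type := EuclideanSpace ℂ (Fin 2)

/-- The Hilbert space `L²(ℝ; ℂ²)`. -/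
abbrev H : Type := Lp C2 2 (volume : Measure ℝ)

/-- The Pauli matrix `σ₁`. -/
def sigma1 : Matrix (Fin 2) (Fin 2) ℂ := !![0, 1; 1, 0]

/-- The Pauli matrix `σ₃`. -/
def sigma3 : Matrix (Fin 2) (Fin 2) ℂ := !![1, 0; 0, -1]

/-- Action of a `2 × 2` matrix on `ℂ²`. -/
abbrev act (A : Matrix (Fin 2) (Fin 2) ℂ) : C2 →L[ℂ] C2 := Matrix.toEuclideanCLM (𝕜 := ℂ) A

/-- `f' ∈ L²` is the weak derivative of `f ∈ L²`: integration by parts holds against all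
smooth compactly supported test functions. -/
def HasWeakDeriv (f f' : H) : Prop :=
  ∀ φ : ℝ → ℝ, ContDiff ℝ ∞ φ → HasCompactSupport φ →
    ∫ x, deriv φ x • f x = - ∫ x, φ x • f' x

lemma integrable_test_smul (f : H) {φ : ℝ → ℝ} (hφ : Continuous φ) (hc : HasCompactSupport φ) :
    Integrable (fun x => φ x • f x) :=
  ((Lp.memLp f).locallyIntegrable (by norm_num)).integrable_smul_left_of_hasCompactSupport hφ hc

lemma HasWeakDeriv.add {f f' g g' : H} (hf : HasWeakDeriv f f') (hg : HasWeakDeriv g g') :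
    HasWeakDeriv (f + g) (f' + g') := by
  intro φ hφ hc
  have hd : Continuous (deriv φ) := hφ.continuous_deriv (by simp)
  have e1 : ∫ x, deriv φ x • (f + g : H) x = ∫ x, (deriv φ x • f x + deriv φ x • g x) := by
    refine integral_congr_ae ?_
    filter_upwards [Lp.coeFn_add f g] with x hx
    rw [hx, Pi.add_apply, smul_add]
  have e2 : ∫ x, φ x • (f' + g' : H) x = ∫ x, (φ x • f' x + φ x • g' x) := by
    refine integral_congr_ae ?_
    filter_upwards [Lp.coeFn_add f' g'] with x hx
    rw [hx, Pi.add_apply, smul_add]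
  rw [e1, e2, integral_add (integrable_test_smul f hd hc.deriv) (integrable_test_smul g hd hc.deriv),
    integral_add (integrable_test_smul f' hφ.continuous hc)
      (integrable_test_smul g' hφ.continuous hc), hf φ hφ hc, hg φ hφ hc]
  abel

lemma HasWeakDeriv.const_smul {f f' : H} (c : ℂ) (hf : HasWeakDeriv f f') :
    HasWeakDeriv (c • f) (c • f') := by
  intro φ hφ hc
  have e1 : ∫ x, deriv φ x • (c • f : H) x = ∫ x, c • (deriv φ x • f x) := by
    refine integral_congr_ae ?_
    filter_upwards [Lp.coeFn_smul c f] with x hx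
    rw [hx, Pi.smul_apply, smul_comm]
  have e2 : ∫ x, φ x • (c • f' : H) x = ∫ x, c • (φ x • f' x) := by
    refine integral_congr_ae ?_
    filter_upwards [Lp.coeFn_smul c f'] with x hx
    rw [hx, Pi.smul_apply, smul_comm]
  rw [e1, e2, integral_smul, integral_smul, hf φ hφ hc, smul_neg]

lemma hasWeakDeriv_zero : HasWeakDeriv 0 0 := by
  intro φ _ _
  have e : ∀ ψ : ℝ → ℝ, ∫ x, ψ x • (0 : H) x = 0 := by
    intro ψ
    rw [← integral_zero ℝ C2]
    refine integral_congr_ae ?_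
    filter_upwards [Lp.coeFn_zero C2 2 (volume : Measure ℝ)] with x hx
    rw [hx, Pi.zero_apply, smul_zero]
  rw [e, e, neg_zero]

/-- The weak derivative of the zero function vanishes, so weak derivatives are unique. -/
lemma HasWeakDeriv.eq_zero {f' : H} (h : HasWeakDeriv 0 f') : f' = 0 := by
  rw [Lp.eq_zero_iff_ae_eq_zero]
  refine ae_eq_zero_of_integral_contDiff_smul_eq_zero
    ((Lp.memLp f').locallyIntegrable (by norm_num)) ?_
  intro φ hφ hc
  have h1 := h φ hφ hc
  have e : ∫ x, deriv φ x • (0 : H) x = 0 := by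
    rw [← integral_zero ℝ C2]
    refine integral_congr_ae ?_
    filter_upwards [Lp.coeFn_zero C2 2 (volume : Measure ℝ)] with x hx
    rw [hx, Pi.zero_apply, smul_zero]
  rw [e] at h1
  exact neg_eq_zero.mp h1.symm

/-- The Sobolev space `H¹(ℝ; ℂ²)`, as a subspace of `L²(ℝ; ℂ²)`. -/
def H1 : Submodule ℂ H where
  carrier := {f | ∃ f' : H, HasWeakDeriv f f'}
  zero_mem' := ⟨0, hasWeakDeriv_zero⟩
  add_mem' := fun ⟨f', hf⟩ ⟨g', hg⟩ => ⟨f' + g', hf.add hg⟩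
  smul_mem' := fun c _ ⟨f', hf⟩ => ⟨c • f', hf.const_smul c⟩

/-- The graph of the Dirac operator `i σ₃ ∂ₓ + κ(x) σ₁`: the pairs `(f, h)` in `L² × L²`
such that `f` has a weak derivative `f' ∈ L²` and `h = i σ₃ f' + κ σ₁ f` almost everywhere. -/
def diracGraph (κ : ℝ → ℝ) : Submodule ℂ (H × H) where
  carrier := {p | ∃ f' : H, HasWeakDeriv p.1 f' ∧
    ∀ᵐ x : ℝ, p.2 x = I • act sigma3 (f' x) + (κ x : ℂ) • act sigma1 (p.1 x)}
  zero_mem' := by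
    refine ⟨0, hasWeakDeriv_zero, ?_⟩
    filter_upwards [Lp.coeFn_zero C2 2 (volume : Measure ℝ)] with x hx
    simp only [Prod.fst_zero, Prod.snd_zero, hx, Pi.zero_apply, map_zero, smul_zero, add_zero]
  add_mem' := by
    rintro ⟨f, h⟩ ⟨g, k⟩ ⟨f', hf, hfe⟩ ⟨g', hg, hge⟩
    refine ⟨f' + g', hf.add hg, ?_⟩
    filter_upwards [hfe, hge, Lp.coeFn_add f g, Lp.coeFn_add h k, Lp.coeFn_add f' g'] with
      x h1 h2 h3 h4 h5
    simp only [Prod.mk_add_mk, h3, h4, h5, Pi.add_apply, map_add, smul_add] at h1 h2 ⊢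
    rw [h1, h2]
    abel
  smul_mem' := by
    rintro c ⟨f, h⟩ ⟨f', hf, hfe⟩
    refine ⟨c • f', hf.const_smul c, ?_⟩
    filter_upwards [hfe, Lp.coeFn_smul c f, Lp.coeFn_smul c h, Lp.coeFn_smul c f'] with
      x h1 h2 h3 h4
    simp only [Prod.smul_mk, h2, h3, h4, Pi.smul_apply, map_smul] at h1 ⊢
    rw [h1, smul_add, smul_comm c I, smul_comm c (κ x : ℂ)]

/-- The Dirac operator `D_κ = i σ₃ ∂ₓ + κ(x) σ₁`, as an unbounded operator on `L²(ℝ; ℂ²)`.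
Its domain is `H¹(ℝ; ℂ²)` whenever `κ` is bounded and measurable (`diracOp_domain`). -/
def diracOp (κ : ℝ → ℝ) : H →ₗ.[ℂ] H := (diracGraph κ).toLinearPMap

lemma diracGraph_functional (κ : ℝ → ℝ) :
    ∀ p ∈ diracGraph κ, p.1 = 0 → p.2 = 0 := by
  rintro ⟨f, h⟩ ⟨f', hf, hfe⟩ h0
  simp only at h0 hf hfe ⊢
  subst h0
  have hf0 := hf.eq_zero
  subst hf0
  rw [Lp.eq_zero_iff_ae_eq_zero]
  filter_upwards [hfe, Lp.coeFn_zero C2 2 (volume : Measure ℝ)] with x h1 h2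
  rw [h1, h2]
  simp

/-- The graph of `diracOp κ` is the one it was built from. -/
lemma diracOp_graph (κ : ℝ → ℝ) : (diracOp κ).graph = diracGraph κ :=
  Submodule.toLinearPMap_graph_eq _ (diracGraph_functional κ)

/-- For bounded measurable `κ` the domain of the Dirac operator is `H¹`. -/
lemma diracOp_domain {κ : ℝ → ℝ} (hm : Measurable κ) {C : ℝ} (hC : ∀ x, |κ x| ≤ C) :
    (diracOp κ).domain = H1 := by
  ext f
  constructor
  · intro hf
    obtain ⟨f', hf', -⟩ : ((f, (diracOp κ) ⟨f, hf⟩) : H × H) ∈ diracGraph κ := by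
      rw [← diracOp_graph]
      exact (diracOp κ).mem_graph ⟨f, hf⟩
    exact ⟨f', hf'⟩
  · rintro ⟨f', hf'⟩
    have m1 : MemLp (fun x => I • act sigma3 (f' x)) 2 (volume : Measure ℝ) :=
      ((act sigma3).comp_memLp' (Lp.memLp f')).const_smul I
    have m2 : MemLp (fun x => (κ x : ℂ) • act sigma1 (f x)) 2 (volume : Measure ℝ) := by
      have m3 : MemLp (fun x => act sigma1 (f x)) 2 (volume : Measure ℝ) :=
        (act sigma1).comp_memLp' (Lp.memLp f)
      refine m3.of_le_mul (c := C) ?_ ?_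
      · exact (Complex.measurable_ofReal.comp hm).aestronglyMeasurable.smul
          m3.aestronglyMeasurable
      · refine Filter.Eventually.of_forall fun x => ?_
        rw [norm_smul, Complex.norm_real, Real.norm_eq_abs]
        exact mul_le_mul_of_nonneg_right (hC x) (norm_nonneg _)
    have hmem : ((f, (m1.add m2).toLp _) : H × H) ∈ diracGraph κ := by
      refine ⟨f', hf', ?_⟩
      filter_upwards [(m1.add m2).coeFn_toLp] with x hx
      exact hx
    rw [← diracOp_graph] at hmem
    exact LinearPMap.mem_domain_of_mem_graph hmem

/-- The eigenspace `{f ∈ dom D_κ : D_κ f = E f}`. -/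
def eigenspace (κ : ℝ → ℝ) (E : ℂ) : Submodule ℂ H where
  carrier := {f | ∃ hf : f ∈ (diracOp κ).domain, diracOp κ ⟨f, hf⟩ = E • f}
  zero_mem' := ⟨Submodule.zero_mem _, by
    rw [smul_zero]; exact (diracOp κ).map_zero⟩
  add_mem' := by
    rintro f g ⟨hf, hfe⟩ ⟨hg, hge⟩
    refine ⟨Submodule.add_mem _ hf hg, ?_⟩
    rw [smul_add, ← hfe, ← hge]
    exact (diracOp κ).map_add ⟨f, hf⟩ ⟨g, hg⟩
  smul_mem' := by
    rintro c f ⟨hf, hfe⟩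
    refine ⟨Submodule.smul_mem _ c hf, ?_⟩
    rw [smul_comm, ← hfe]
    exact (diracOp κ).map_smul c ⟨f, hf⟩

/-- `E` is an eigenvalue of `D_κ`. -/
def IsEigenvalue (κ : ℝ → ℝ) (E : ℂ) : Prop := eigenspace κ E ≠ ⊥

/-- `E` is a simple eigenvalue of `D_κ`: its eigenspace is one-dimensional. -/
def IsSimpleEigenvalue (κ : ℝ → ℝ) (E : ℂ) : Prop := Module.finrank ℂ (eigenspace κ E) = 1

/-- Domain wall functions: `C¹`, odd, equal to `-κ∞` on `(-∞, -1]` and to `κ∞` on `[1, ∞)`. -/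
structure IsDomainWall (kinf : ℝ) (κ : ℝ → ℝ) : Prop where
  contDiff : ContDiff ℝ 1 κ
  odd : ∀ x, κ (-x) = -κ x
  left : ∀ x, x ≤ -1 → κ x = -kinf
  right : ∀ x, 1 ≤ x → κ x = kinf

/-- The scalar profile `exp (-∫₀ˣ κ)`. -/
def profile (κ : ℝ → ℝ) (x : ℝ) : ℝ := Real.exp (-∫ y in (0 : ℝ)..x, κ y)

/-- The normalization constant `γ = 1 / (√2 ‖exp (-∫₀ˣ κ)‖_{L²})`. -/
def gam (κ : ℝ → ℝ) : ℝ := 1 / (Real.sqrt 2 * Real.sqrt (∫ x, profile κ x ^ 2))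

/-- The zero mode `γ (1, i)ᵀ exp (-∫₀ˣ κ)`. -/
def zeroMode (κ : ℝ → ℝ) (x : ℝ) : C2 := ((gam κ * profile κ x : ℝ) : ℂ) • !₂[(1 : ℂ), I]

/-- The spectral gap assumption: `‖D_κ f‖ ≥ κ∞ ‖f‖` for every `f` in the domain `H¹` of `D_κ`
that is orthogonal to the zero mode. -/
def SpectralGap (kinf : ℝ) (κ : ℝ → ℝ) : Prop :=
  ∀ f : (diracOp κ).domain, ∫ x, inner ℂ (zeroMode κ x) ((f : H) x) = 0 →
    kinf * ‖(f : H)‖ ≤ ‖diracOp κ f‖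

/-- The three-domain-wall mass function, with walls at `-2δ`, `0`, `2δ`. -/
def threeWall (κ : ℝ → ℝ) (δ x : ℝ) : ℝ :=
  if x ≤ -δ then κ (x + 2 * δ) else if x ≤ δ then -κ x else κ (x - 2 * δ)

/-- Entrywise complex conjugation on `ℂ²`. -/
def conj2 (v : C2) : C2 := !₂[(starRingEnd ℂ) (v 0), (starRingEnd ℂ) (v 1)]

/-- The right shifted zero mode `α⋆(x - 2δ)`. -/
def alphaR (κ : ℝ → ℝ) (δ x : ℝ) : C2 := zeroMode κ (x - 2 * δ)

/-- The central zero mode, the complex conjugate of `α⋆(x)`. -/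
def alphaZero (κ : ℝ → ℝ) (x : ℝ) : C2 := conj2 (zeroMode κ x)

/-- The left shifted zero mode `α⋆(x + 2δ)`. -/
def alphaL (κ : ℝ → ℝ) (δ x : ℝ) : C2 := zeroMode κ (x + 2 * δ)

/-- The approximate mode `½ (α⋆ᴿ + s √2 i α⋆⁰ - α⋆ᴸ)`, to be used with `s = ±1`. -/
def approxMode (κ : ℝ → ℝ) (δ s : ℝ) (x : ℝ) : C2 :=
  (1 / 2 : ℂ) • (alphaR κ δ x + ((s * Real.sqrt 2 : ℝ) * I : ℂ) • alphaZero κ x - alphaL κ δ x)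

/-- The leading-order splitting `2 √2 γ² exp (-2 ∫₀^δ κ)`. -/
def splitting (κ : ℝ → ℝ) (δ : ℝ) : ℝ :=
  2 * Real.sqrt 2 * gam κ ^ 2 * Real.exp (-2 * ∫ y in (0 : ℝ)..δ, κ y)

/-- A domain wall function is bounded. -/
lemma IsDomainWall.exists_bound {kinf : ℝ} {κ : ℝ → ℝ} (h : IsDomainWall kinf κ) :
    ∃ C, ∀ x, |κ x| ≤ C := by
  obtain ⟨B, hB⟩ := (isCompact_Icc (a := (-1 : ℝ)) (b := 1)).exists_bound_of_continuousOn
    h.contDiff.continuous.continuousOn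
  refine ⟨max B |kinf|, fun x => ?_⟩
  rcases le_total x (-1) with h1 | h1
  · rw [h.left x h1, abs_neg]; exact le_max_right _ _
  rcases le_total 1 x with h2 | h2
  · rw [h.right x h2]; exact le_max_right _ _
  · exact (hB x ⟨h1, h2⟩).trans (le_max_left _ _)

/-- The one-wall Dirac operator has domain `H¹`. -/
lemma IsDomainWall.diracOp_domain {kinf : ℝ} {κ : ℝ → ℝ} (h : IsDomainWall kinf κ) :
    (diracOp κ).domain = H1 := by
  obtain ⟨C, hC⟩ := h.exists_bound
  exact DomainWallDirac.diracOp_domain h.contDiff.continuous.measurable hC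

/-- The three-wall Dirac operator has domain `H¹`. -/
lemma IsDomainWall.diracOp_threeWall_domain {kinf : ℝ} {κ : ℝ → ℝ} (h : IsDomainWall kinf κ)
    (δ : ℝ) : (diracOp (threeWall κ δ)).domain = H1 := by
  obtain ⟨C, hC⟩ := h.exists_bound
  have hm : Measurable κ := h.contDiff.continuous.measurable
  refine DomainWallDirac.diracOp_domain (C := C) ?_ fun x => ?_
  · exact Measurable.ite measurableSet_Iic (hm.comp (measurable_id.add_const _))
      (Measurable.ite measurableSet_Iic hm.neg (hm.comp (measurable_id.sub_const _)))
  · unfold threeWall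
    split_ifs
    · exact hC _
    · rw [abs_neg]; exact hC _
    · exact hC _

end DomainWallDirac

end

/-! In the chiral coordinates `p = a - i b`, `q = a + i b` of a spinor `(a, b)` the Dirac operator
with mass `m` is off-diagonal: the equation for eigenvalue `E` reads `p' + m p = -iE q`, `q' - m q =
-iE p`. Since `∂ + m` and `-(∂ - m)` are formal adjoints, a nonzero real eigenvalue `E` means that
`q` is a critical vector of the Rayleigh quotient `‖q' - m q‖² / ‖q‖²` with value `E²`, and each
positive critical value `e²` gives the two eigenvalues `±e`. At `E = 0` the system decouples. The
profile `u = exp (-∫₀ˣ m)` of three walls is square integrable and solves the `p`-equation; the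
`q`-equation has only multiples of `1/u`, which are then not square integrable. Hence the kernel is
the line through the zero mode (`eigenspace_zero`).

It remains to show that the quotient has exactly one critical value below a threshold `k²` with `K <
k < κ∞`. At most one: an IMS localization to the three walls transfers the one-wall gap. The outer
walls carry no zero mode in the `q`-component, the central one carries a single zero mode, so `‖q' -
m q‖ ≥ k ‖q‖` on a subspace of codimension one once `δ` is large (`exists_gap_threeWall`), and two
critical vectors below `k²` are proportional (`IsCritical.unique`). At least one: a quotient below
`k²` for one trial element forces the infimum to be attained (`exists_isCritical`), by a
parallelogram argument on the closed graph.

The asymptotics come from an explicit quasimode (`exists_quasimodes`). Let `U = exp (2 ∫₀^δ κ)`,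
comparable to `e^{2κ∞δ}`, and `n = ‖exp (-∫₀ˣ κ)‖`. Take `Y = (κ/κ∞) u`, which is close to `U` times
the difference of the right and left profiles, and let `G` be the decaying solution of `G' - m G =
-Y`, which is close to `U² n²` times the central profile. The residual `Z = Y' + m Y = (κ'/κ∞) u`
lives on `[-1, 1]`, where `u` is bounded, so `‖Z‖ = O(1)` while `‖Y‖ ≈ √2 n U` and `‖G‖ ≈ U² n³`.
Projecting onto the critical vector moves `G` and `Y` by only `O(1)` (`IsCritical.exists_near`).
Therefore `e = √2 / (n² U) + O(U⁻²)`, and the normalized components agree with the normalized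
profiles up to `O(U⁻¹)` (`exists_critical_asymptotics`); since `γ = 1 / (√2 n)`, this is the stated
splitting. -/

noncomputable section

namespace DomainWallDirac

open Filter Topology Set

/-! ### Primitives of locally integrable functions and first order weak equations -/

/-- `F` is a primitive of the locally integrable function `f`. -/
def IsPrim (F f : ℝ → ℂ) : Prop :=
  LocallyIntegrable f ∧ ∀ x, F x = F 0 + ∫ t in (0 : ℝ)..x, f t

lemma intervalIntegrable_of_locallyIntegrable {E : Type*} [NormedAddCommGroup E] {f : ℝ → E}
    (hf : LocallyIntegrable f) (a b : ℝ) : IntervalIntegrable f volume a b :=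
  intervalIntegrable_iff.mpr <|
    (hf.integrableOn_isCompact isCompact_uIcc).mono_set uIoc_subset_uIcc

namespace IsPrim

variable {F f G g : ℝ → ℂ}

lemma sub_eq (h : IsPrim F f) (a b : ℝ) : F b - F a = ∫ t in a..b, f t := by
  have i := intervalIntegrable_of_locallyIntegrable h.1
  rw [h.2 a, h.2 b, ← intervalIntegral.integral_interval_sub_left (i 0 b) (i 0 a)]
  ring

/-- The increments of `F` are dominated by those of the primitive of `‖f‖`, a function already known
to be absolutely continuous. -/
lemma absolutelyContinuous (h : IsPrim F f) (a b : ℝ) :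
    AbsolutelyContinuousOnInterval F a b := by
  have hn : LocallyIntegrable (fun x => ‖f x‖) := fun x => by
    obtain ⟨s, hs, hi⟩ := h.1 x
    exact ⟨s, hs, hi.norm⟩
  have key := (intervalIntegrable_of_locallyIntegrable
    hn a b).absolutelyContinuousOnInterval_intervalIntegral (c := a) (by simp)
  unfold AbsolutelyContinuousOnInterval at key ⊢
  refine squeeze_zero' ?_ ?_ key
  · exact Filter.Eventually.of_forall <| fun _ ↦ Finset.sum_nonneg (fun i hi ↦ dist_nonneg)
  · refine Filter.Eventually.of_forall fun n => Finset.sum_le_sum fun i _ => ?_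
    have ii := intervalIntegrable_of_locallyIntegrable hn
    rw [Real.dist_eq, intervalIntegral.integral_interval_sub_left (ii _ _) (ii _ _), dist_eq_norm,
      h.sub_eq]
    exact intervalIntegral.norm_integral_le_abs_integral_norm

lemma ae_hasDerivAt (h : IsPrim F f) : ∀ᵐ x, HasDerivAt F (f x) x := by
  filter_upwards [LocallyIntegrable.ae_hasDerivAt_integral h.1] with x hx
  have e : F = fun y => F 0 + ∫ t in (0 : ℝ)..y, f t := funext h.2
  rw [e]
  exact (hx 0).const_add _

/-- Subtracting the integral of `f` leaves an absolutely continuous function with derivative zero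
almost everywhere, hence a constant. Absolute continuity is essential: an almost everywhere
derivative alone does not determine increments. -/
lemma of_ae_hasDerivAt (hf : LocallyIntegrable f)
    (hF : ∀ a b, AbsolutelyContinuousOnInterval F a b) (hd : ∀ᵐ x, HasDerivAt F (f x) x) :
    IsPrim F f := by
  refine ⟨hf, fun x => ?_⟩
  have hp : IsPrim (fun y => ∫ t in (0 : ℝ)..y, f t) f := ⟨hf, fun y => by simp⟩
  obtain ⟨C, hC⟩ := ((hF 0 x).sub
    (hp.absolutelyContinuous 0 x)).const_of_ae_hasDerivAt_zero (by
      filter_upwards [hd, hp.ae_hasDerivAt] with y h1 h2 _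
      simpa using h1.sub h2)
  have h0 := hC 0 (by simp)
  have hx := hC x (by simp)
  simp only [Pi.sub_apply, intervalIntegral.integral_same, sub_zero] at h0 hx
  rw [h0, ← hx]; ring

lemma continuous (h : IsPrim F f) : Continuous F := by
  have e : F = fun y => F 0 + ∫ t in (0 : ℝ)..y, f t := funext h.2
  rw [e]
  exact continuous_const.add
    (intervalIntegral.continuous_primitive (intervalIntegrable_of_locallyIntegrable h.1) 0)

lemma of_hasDerivAt (hd : ∀ x, HasDerivAt F (f x) x) (hf : Continuous f) : IsPrim F f := by
  refine ⟨hf.locallyIntegrable, fun x => ?_⟩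
  rw [intervalIntegral.integral_eq_sub_of_hasDerivAt (fun y _ => hd y) (hf.intervalIntegrable _ _)]
  ring

lemma congr (h : IsPrim F f) (e : f =ᵐ[volume] g) : IsPrim F g := by
  refine ⟨h.1.congr e, fun x => ?_⟩
  rw [h.2 x, intervalIntegral.integral_congr_ae' (g := g)]
  · filter_upwards [e] with y hy _ using hy
  · filter_upwards [e] with y hy _ using hy

/-- This product rule is the source of every integration by parts and integrating factor below. -/
lemma mul (hF : IsPrim F f) (hG : IsPrim G g) :
    IsPrim (fun x => F x * G x) (fun x => f x * G x + F x * g x) := by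
  refine of_ae_hasDerivAt ?_ (fun a b => ?_) ?_
  · refine LocallyIntegrable.add ?_ ?_
    · have := hF.1.continuous_smul hG.continuous
      simpa [smul_eq_mul, mul_comm] using this
    · simpa [smul_eq_mul] using hG.1.continuous_smul hF.continuous
  · exact (hF.absolutelyContinuous a b).smul (hG.absolutelyContinuous a b)
  · filter_upwards [hF.ae_hasDerivAt, hG.ae_hasDerivAt] with x h1 h2 using h1.mul h2

lemma conj (hF : IsPrim F f) :
    IsPrim (fun x => starRingEnd ℂ (F x)) (fun x => starRingEnd ℂ (f x)) := by
  refine ⟨?_, fun x => ?_⟩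
  · intro x
    obtain ⟨s, hs, hi⟩ := hF.1 x
    exact ⟨s, hs, Complex.conjLIE.integrable_comp_iff.mpr hi⟩
  · simp only
    rw [hF.2 x, map_add, intervalIntegral.intervalIntegral_conj]

lemma comp_add (hF : IsPrim F f) (c : ℝ) :
    IsPrim (fun x => F (x + c)) (fun x => f (x + c)) := by
  refine ⟨?_, fun x => ?_⟩
  · rw [locallyIntegrable_iff]
    intro k hk
    have h2 := hF.1.integrableOn_isCompact (hk.image (continuous_add_const c))
    have := (measurePreserving_add_right volume c).integrableOn_comp_preimage
      (measurableEmbedding_addRight c) (s := (fun x => x + c) '' k) (f := f)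
    rw [preimage_image_eq _ (add_left_injective c)] at this
    exact this.mpr h2
  · rw [intervalIntegral.integral_comp_add_right (fun t => f t) c, ← hF.sub_eq]
    ring

/-- A product of two integrable-type primitives has vanishing total increment. -/
lemma integral_eq_zero (hF : IsPrim F f) (iF : Integrable F) (hf : Integrable f) :
    ∫ x, f x = 0 := by
  have h1 : Tendsto F atTop (𝓝 (F 0 + ∫ x in Ioi (0 : ℝ), f x)) := by
    rw [show F = fun y => F 0 + ∫ t in (0 : ℝ)..y, f t from funext hF.2]
    simpa using (intervalIntegral_tendsto_integral_Ioi 0 hf.integrableOn tendsto_id).const_add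
      (F 0)
  have h2 : Tendsto F atBot (𝓝 (F 0 - ∫ x in Iic (0 : ℝ), f x)) := by
    have e : F = fun y => F 0 - ∫ t in y..(0 : ℝ), f t := by
      funext y; rw [← hF.sub_eq]; ring
    rw [e]
    simpa using (intervalIntegral_tendsto_integral_Iic 0 hf.integrableOn tendsto_id).const_sub
      (F 0)
  -- Integrability of `f` gives limits of `F` at both ends; a nonzero limit would contradict
  -- integrability of `F`, as half-lines have infinite measure.
  have z1 := IntegrableAtFilter.eq_zero_of_tendsto (iF.integrableAtFilter _) (fun s hs => by
    obtain ⟨a, ha⟩ := mem_atTop_sets.mp hs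
    exact top_unique ((Real.volume_Ici (a := a)).symm.le.trans (measure_mono ha))) h1
  have z2 := IntegrableAtFilter.eq_zero_of_tendsto (iF.integrableAtFilter _) (fun s hs => by
    obtain ⟨a, ha⟩ := mem_atBot_sets.mp hs
    exact top_unique ((Real.volume_Iic (a := a)).symm.le.trans (measure_mono ha))) h2
  rw [← intervalIntegral.integral_Iic_add_Ioi hf.integrableOn hf.integrableOn (b := 0)]
  linear_combination z1 - z2

end IsPrim

/-- A locally integrable function with vanishing weak derivative is constant. -/
lemma ae_eq_const_of_integral_deriv_smul_eq_zero {f : ℝ → ℂ} (hf : LocallyIntegrable f)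
    (h : ∀ φ : ℝ → ℝ, ContDiff ℝ ∞ φ → HasCompactSupport φ → ∫ x, deriv φ x • f x = 0) :
    ∃ c : ℂ, f =ᵐ[volume] fun _ => c := by
  let b : ContDiffBump (0 : ℝ) := default
  set ρ : ℝ → ℝ := b.normed volume with hρ
  have ρs : ContDiff ℝ ∞ ρ := b.contDiff_normed
  have ρc : HasCompactSupport ρ := b.hasCompactSupport_normed
  have ρ1 : ∫ x, ρ x = 1 := b.integral_normed
  refine ⟨∫ x, ρ x • f x, ?_⟩
  set c := ∫ x, ρ x • f x with hc
  have key : ∀ᵐ x, f x - c = 0 := by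
    refine ae_eq_zero_of_integral_contDiff_smul_eq_zero
      (hf.sub (locallyIntegrable_const c)) fun φ φs φc => ?_
    have iφ : Integrable φ := φs.continuous.integrable_of_hasCompactSupport φc
    have iρ : Integrable ρ := ρs.continuous.integrable_of_hasCompactSupport ρc
    set J := ∫ x, φ x with hJ
    -- Removing the mean of `φ` makes `θ` the derivative of a test function `ψ`: its primitive
    -- vanishes far to the left by construction and far to the right because `∫ θ = 0`. The
    -- hypothesis then applies to `ψ`.
    set θ : ℝ → ℝ := fun x => φ x - J * ρ x with hθ
    have θs : ContDiff ℝ ∞ θ := φs.sub (contDiff_const.mul ρs)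
    have θc : HasCompactSupport θ := φc.sub (ρc.mul_left)
    have iθ : Integrable θ := θs.continuous.integrable_of_hasCompactSupport θc
    have θ0 : ∫ x, θ x = 0 := by
      rw [hθ, integral_sub iφ (iρ.const_mul _), integral_const_mul, ρ1]; simp [hJ]
    obtain ⟨R, hR⟩ : ∃ R : ℝ, ∀ x, R ≤ |x| → θ x = 0 := by
      obtain ⟨R, hR⟩ := θc.isCompact.isBounded.subset_closedBall 0
      refine ⟨R + 1, fun x hx => ?_⟩
      by_contra hne
      have := hR (subset_tsupport θ hne)
      rw [Metric.mem_closedBall, Real.dist_eq, sub_zero] at this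
      linarith
    set ψ : ℝ → ℝ := fun x => ∫ t in Iic x, θ t with hψ
    have eψ : ∀ x, ψ x = ψ 0 + ∫ t in (0 : ℝ)..x, θ t := by
      intro x
      rw [intervalIntegral.integral_Iic_sub_Iic iθ.integrableOn iθ.integrableOn |>.symm]
      simp [hψ]
    have dψ : ∀ x, HasDerivAt ψ (θ x) x := by
      intro x
      rw [show ψ = fun x => ψ 0 + ∫ t in (0 : ℝ)..x, θ t from funext eψ]
      exact ((θs.continuous.integral_hasStrictDerivAt 0 x).hasDerivAt).const_add _
    have dψ' : deriv ψ = θ := funext fun x => (dψ x).deriv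
    have ψs : ContDiff ℝ ∞ ψ := contDiff_infty_iff_deriv.mpr
      ⟨fun x => (dψ x).differentiableAt, dψ' ▸ θs⟩
    have ψc : HasCompactSupport ψ := by
      refine HasCompactSupport.intro (isCompact_Icc (a := -|R|) (b := |R|)) fun x hx => ?_
      rw [mem_Icc, not_and_or, not_le, not_le] at hx
      rcases hx with hx | hx
      · refine setIntegral_eq_zero_of_forall_eq_zero fun t ht => hR t ?_
        rw [mem_Iic] at ht
        have : t < 0 := by linarith [abs_nonneg R]
        rw [abs_of_neg this]; linarith [le_abs_self R]
      · have : ∫ t in Ioi x, θ t = 0 := by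
          refine setIntegral_eq_zero_of_forall_eq_zero fun t ht => hR t ?_
          rw [mem_Ioi] at ht
          rw [abs_of_pos (by linarith [abs_nonneg R])]; linarith [le_abs_self R]
        rw [← intervalIntegral.integral_Iic_add_Ioi iθ.integrableOn iθ.integrableOn (b := x),
          this, add_zero] at θ0
        exact θ0
    have h1 := h ψ ψs ψc
    rw [dψ'] at h1
    have i1 := hf.integrable_smul_left_of_hasCompactSupport φs.continuous φc
    have i2 := hf.integrable_smul_left_of_hasCompactSupport ρs.continuous ρc
    have e1 : ∫ x, θ x • f x = (∫ x, φ x • f x) - J • c := by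
      rw [hc, ← integral_smul J, ← integral_sub i1 (show Integrable fun x => J • ρ x • f x from i2.smul J)]
      refine integral_congr_ae (Eventually.of_forall fun x => ?_)
      simp only [hθ, sub_smul, mul_smul]
    have e2 : ∫ x, φ x • (f x - c) = (∫ x, φ x • f x) - J • c := by
      rw [hJ, ← integral_smul_const, ← integral_sub i1 (iφ.smul_const c)]
      simp only [smul_sub]
    rw [e2, ← e1, h1]
  filter_upwards [key] with x hx using sub_eq_zero.mp hx

/-- `f' + m f = g` in the sense of distributions. -/
def WeakEq (m : ℝ → ℝ) (f g : ℝ → ℂ) : Prop :=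
  ∀ φ : ℝ → ℝ, ContDiff ℝ ∞ φ → HasCompactSupport φ →
    ∫ x, (deriv φ x - m x * φ x) • f x = -∫ x, φ x • g x

lemma WeakEq.congr {m : ℝ → ℝ} {f g f₁ g₁ : ℝ → ℂ} (h : WeakEq m f g) (hf : f =ᵐ[volume] f₁)
    (hg : g =ᵐ[volume] g₁) : WeakEq m f₁ g₁ := by
  intro φ φs φc
  have e1 : ∫ x, (deriv φ x - m x * φ x) • f x = ∫ x, (deriv φ x - m x * φ x) • f₁ x :=
    integral_congr_ae (hf.mono fun x hx => by simp only [hx])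
  have e2 : ∫ x, φ x • g x = ∫ x, φ x • g₁ x :=
    integral_congr_ae (hg.mono fun x hx => by simp only [hx])
  rw [← e1, ← e2]
  exact h φ φs φc

lemma HasCompactSupport.deriv_sub_mul {φ m : ℝ → ℝ} (φc : HasCompactSupport φ) :
    HasCompactSupport fun x => deriv φ x - m x * φ x :=
  φc.deriv.sub (φc.mul_left (f := m))

lemma continuous_deriv_sub_mul {φ m : ℝ → ℝ} (φs : ContDiff ℝ ∞ φ) (hm : Continuous m) :
    Continuous fun x => deriv φ x - m x * φ x :=
  (φs.continuous_deriv (by simp)).sub (hm.mul φs.continuous)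

lemma IsPrim.weakEq {m : ℝ → ℝ} (hm : Continuous m) {F g : ℝ → ℂ}
    (h : IsPrim F fun x => g x - m x * F x) (hg : LocallyIntegrable g) : WeakEq m F g := by
  intro φ φs φc
  have hd : Continuous (deriv φ) := φs.continuous_deriv (by simp)
  have hφ : IsPrim (fun x => (φ x : ℂ)) (fun x => ((deriv φ x : ℝ) : ℂ)) :=
    IsPrim.of_hasDerivAt
      (fun x => ((φs.differentiable (by simp)) x).hasDerivAt.ofReal_comp) (by exact continuous_ofReal.comp hd)
  have hp := hφ.mul h
  have i1 : Integrable fun x => (deriv φ x - m x * φ x) • F x :=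
    h.continuous.locallyIntegrable.integrable_smul_left_of_hasCompactSupport
      (continuous_deriv_sub_mul φs hm) (HasCompactSupport.deriv_sub_mul φc)
  have i2 : Integrable fun x => φ x • g x :=
    hg.integrable_smul_left_of_hasCompactSupport φs.continuous φc
  have e : (fun x => ((deriv φ x : ℝ) : ℂ) * F x + φ x * (g x - m x * F x))
      = fun x => (deriv φ x - m x * φ x) • F x + φ x • g x := by
    funext x
    simp only [real_smul]; push_cast; ring
  rw [e] at hp
  have i3 : Integrable fun x => (φ x : ℂ) * F x := by
    simpa only [real_smul] using
      h.continuous.locallyIntegrable.integrable_smul_left_of_hasCompactSupport φs.continuous φc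
  have := hp.integral_eq_zero i3 (i1.add i2)
  rw [integral_add i1 i2] at this
  exact eq_neg_of_add_eq_zero_left this

/-- Regularity: `f` differs from a primitive of `g - m f` by a function with zero weak derivative,
that is, by a constant. Weak solutions thus have absolutely continuous representatives. -/
lemma WeakEq.exists_isPrim {m : ℝ → ℝ} (hm : Continuous m) {f g : ℝ → ℂ} (h : WeakEq m f g)
    (hf : LocallyIntegrable f) (hg : LocallyIntegrable g) :
    ∃ F, f =ᵐ[volume] F ∧ IsPrim F fun x => g x - m x * F x := by
  have hmf : LocallyIntegrable fun x => (m x : ℂ) * f x := by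
    simpa only [real_smul] using hf.continuous_smul hm
  have hk : LocallyIntegrable fun x => g x - m x * f x := hg.sub hmf
  set G : ℝ → ℂ := fun x => ∫ t in (0 : ℝ)..x, (g t - m t * f t) with hG
  have pG : IsPrim G fun x => g x - m x * f x := ⟨hk, fun x => by simp [hG]⟩
  have wG : WeakEq (fun _ => 0) G fun x => g x - m x * f x :=
    IsPrim.weakEq continuous_const (by simpa using pG) hk
  obtain ⟨c, hc⟩ := ae_eq_const_of_integral_deriv_smul_eq_zero
    (f := fun x => f x - G x) (hf.sub pG.continuous.locallyIntegrable) (by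
      intro φ φs φc
      have hd : Continuous (deriv φ) := φs.continuous_deriv (by simp)
      have h1 := h φ φs φc
      have h2 := wG φ φs φc
      simp only [zero_mul, sub_zero] at h2
      have i1 := hf.integrable_smul_left_of_hasCompactSupport hd φc.deriv
      have i2 : Integrable fun x => deriv φ x • G x := (pG.continuous.locallyIntegrable
        (μ := volume)).integrable_smul_left_of_hasCompactSupport hd φc.deriv
      have i3 := hmf.integrable_smul_left_of_hasCompactSupport φs.continuous φc
      have i4 := hg.integrable_smul_left_of_hasCompactSupport φs.continuous φc
      have e1 : ∫ x, (deriv φ x - m x * φ x) • f x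
          = (∫ x, deriv φ x • f x) - ∫ x, φ x • ((m x : ℂ) * f x) := by
        rw [← integral_sub i1 i3]
        refine integral_congr_ae (Eventually.of_forall fun x => ?_)
        simp only [real_smul]; push_cast; ring
      have e2 : ∫ x, φ x • (g x - m x * f x)
          = (∫ x, φ x • g x) - ∫ x, φ x • ((m x : ℂ) * f x) := by
        rw [← integral_sub i4 i3]
        simp only [smul_sub]
      simp only [smul_sub]
      rw [integral_sub i1 i2]
      rw [e1] at h1
      rw [e2] at h2
      linear_combination h1 - h2)
  refine ⟨fun x => c + G x, ?_, ?_⟩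
  · filter_upwards [hc] with x hx
    rw [← hx]; ring
  · have : IsPrim (fun x => c + G x) fun x => g x - m x * f x :=
      ⟨hk, fun x => by simp [hG]⟩
    refine this.congr ?_
    filter_upwards [hc] with x hx
    rw [← hx]; ring

end DomainWallDirac

end

/-! ### Critical points of the Rayleigh quotient on a closed graph -/

noncomputable section

namespace DomainWallDirac

open Filter Topology Set

section Variational

variable {E : Type*} [NormedAddCommGroup E] [InnerProductSpace ℂ E]

/-- `(x, y)` is a critical pair of the Rayleigh quotient `‖y‖² / ‖x‖²` on the graph `Γ`, with
critical value `l`. -/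
def IsCritical (Γ : Submodule ℂ (E × E)) (l : ℝ) (x y : E) : Prop :=
  (x, y) ∈ Γ ∧ ∀ p ∈ Γ, inner ℂ y p.2 = l * inner ℂ x p.1

lemma eq_zero_of_forall_linear_add_sq_nonneg {a b : ℝ} (h : ∀ t : ℝ, 0 ≤ 2 * t * a + t ^ 2 * b) :
    a = 0 := by
  have h1 := h (-a / (|b| + 1))
  have hb : 0 < |b| + 1 := by positivity
  have e : 2 * (-a / (|b| + 1)) * a + (-a / (|b| + 1)) ^ 2 * b
      = a ^ 2 * (b - 2 * (|b| + 1)) / (|b| + 1) ^ 2 := by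
    field_simp; ring
  rw [e] at h1
  by_contra hne
  have : a ^ 2 * (b - 2 * (|b| + 1)) / (|b| + 1) ^ 2 < 0 := by
    refine div_neg_of_neg_of_pos (mul_neg_of_pos_of_neg (by positivity) ?_) (by positivity)
    linarith [le_abs_self b, abs_nonneg b]
  linarith

/-- First variation: the nonnegative form `‖q.2‖² - l ‖q.1‖²` vanishes at `p`, so its linear part in
every real direction is zero. The directions `q` and `i q` give the real and imaginary parts. -/
lemma isCritical_of_minimal {Γ : Submodule ℂ (E × E)} {l : ℝ} {p : E × E} (hp : p ∈ Γ)
    (hmin : ∀ q ∈ Γ, l * ‖q.1‖ ^ 2 ≤ ‖q.2‖ ^ 2) (h0 : ‖p.2‖ ^ 2 = l * ‖p.1‖ ^ 2) :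
    IsCritical Γ l p.1 p.2 := by
  have hre : ∀ q ∈ Γ, (inner ℂ p.2 q.2).re = l * (inner ℂ p.1 q.1).re := by
    intro q hq
    have := eq_zero_of_forall_linear_add_sq_nonneg
      (a := (inner ℂ p.2 q.2).re - l * (inner ℂ p.1 q.1).re)
      (b := ‖q.2‖ ^ 2 - l * ‖q.1‖ ^ 2) (fun t => by
        have h1 := hmin (p + (t : ℂ) • q) (Γ.add_mem hp (Γ.smul_mem _ hq))
        simp only [Prod.fst_add, Prod.snd_add, Prod.smul_fst, Prod.smul_snd] at h1
        rw [@norm_add_sq ℂ, @norm_add_sq ℂ, inner_smul_right, inner_smul_right, norm_smul,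
          norm_smul, mul_pow, mul_pow, norm_real, Real.norm_eq_abs, sq_abs, h0] at h1
        simp only [RCLike.re_to_complex, re_ofReal_mul] at h1
        nlinarith)
    linarith
  refine ⟨hp, fun q hq => Complex.ext ?_ ?_⟩
  · rw [hre q hq, re_ofReal_mul]
  · have := hre (I • q) (Γ.smul_mem _ hq)
    simp only [Prod.smul_fst, Prod.smul_snd, inner_smul_right, I_mul_re] at this
    rw [im_ofReal_mul]; linarith

/-- The infimum is attained without any compact embedding: below `k²` the only direction in which a
minimizing sequence could fail to be Cauchy is the one-dimensional complement of `g⊥`, and there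
boundedness yields a convergent subsequence. -/
theorem exists_isCritical [CompleteSpace E] {Γ : Submodule ℂ (E × E)}
    (hΓ : IsClosed (Γ : Set (E × E))) {g : E} {k : ℝ} (hk : 0 < k)
    (hgap : ∀ p ∈ Γ, inner ℂ g p.1 = 0 → k * ‖p.1‖ ≤ ‖p.2‖)
    {p₀ : E × E} (hp₀ : p₀ ∈ Γ) (hlt : ‖p₀.2‖ < k * ‖p₀.1‖) :
    ∃ x y : E, ∃ l : ℝ, 0 ≤ l ∧ l < k ^ 2 ∧ ‖x‖ = 1 ∧ IsCritical Γ l x y := by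
  set S : Set ℝ := {r | ∃ p ∈ Γ, ‖p.1‖ = 1 ∧ r = ‖p.2‖ ^ 2} with hS
  have hx0 : 0 < ‖p₀.1‖ := by
    by_contra h
    have : ‖p₀.1‖ = 0 := le_antisymm (not_lt.mp h) (norm_nonneg _)
    rw [this, mul_zero] at hlt
    exact absurd hlt (not_lt.mpr (norm_nonneg _))
  have hmem : ∀ q ∈ Γ, 0 < ‖q.1‖ → ‖q.2‖ ^ 2 / ‖q.1‖ ^ 2 ∈ S := by
    intro q hq h
    refine ⟨((‖q.1‖⁻¹ : ℝ) : ℂ) • q, Γ.smul_mem _ hq, ?_, ?_⟩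
    · rw [Prod.smul_fst, norm_smul, norm_real, norm_inv, norm_norm, inv_mul_cancel₀ h.ne']
    · rw [Prod.smul_snd, norm_smul, norm_real, norm_inv, norm_norm, mul_pow, inv_pow]
      ring
  have hbdd : BddBelow S := ⟨0, by rintro r ⟨p, -, -, rfl⟩; positivity⟩
  have hne : S.Nonempty := ⟨_, hmem p₀ hp₀ hx0⟩
  set l := sInf S with hl
  have l0 : 0 ≤ l := le_csInf hne (by rintro r ⟨p, -, -, rfl⟩; positivity)
  have lk : l < k ^ 2 := by
    refine (csInf_le hbdd (hmem p₀ hp₀ hx0)).trans_lt ?_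
    rw [div_lt_iff₀ (by positivity), ← mul_pow]
    exact pow_lt_pow_left₀ hlt (norm_nonneg _) two_ne_zero
  set B : E × E → ℝ := fun p => ‖p.2‖ ^ 2 - l * ‖p.1‖ ^ 2 with hB
  have Bnn : ∀ q ∈ Γ, 0 ≤ B q := by
    intro q hq
    rcases (norm_nonneg q.1).eq_or_lt with h | h
    · have hq0 : B q = ‖q.2‖ ^ 2 := by simp [hB, ← h]
      rw [hq0]; positivity
    · have := csInf_le hbdd (hmem q hq h)
      rw [le_div_iff₀ (by positivity)] at this
      exact sub_nonneg.mpr this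
  -- Parallelogram law for `B`, with the nonnegative term `B (p + q)` dropped. Along a minimizing
  -- sequence it makes `B` of differences tend to zero.
  have Bsub : ∀ p ∈ Γ, ∀ q ∈ Γ, B (p - q) ≤ 2 * B p + 2 * B q := by
    intro p hp q hq
    have h1 := Bnn _ (Γ.add_mem hp hq)
    have h2 := parallelogram_law_with_norm ℂ p.1 q.1
    have h3 := parallelogram_law_with_norm ℂ p.2 q.2
    simp only [hB, Prod.fst_add, Prod.snd_add, Prod.fst_sub, Prod.snd_sub] at h1 ⊢
    nlinarith
  have Bsmul : ∀ (c : ℂ) (p : E × E), B (c • p) = ‖c‖ ^ 2 * B p := by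
    intro c p
    simp only [hB, Prod.smul_fst, Prod.smul_snd, norm_smul]; ring
  obtain ⟨r, -, hr, hrS⟩ := exists_seq_tendsto_sInf hne hbdd
  choose p hpΓ hp1 hpr using hrS
  have hBp : Tendsto (fun n => B (p n)) atTop (𝓝 0) := by
    have : (fun n => B (p n)) = fun n => r n - l := by
      funext n; simp [hB, hp1, hpr]
    rw [this]
    rw [← sub_self l]
    exact hr.sub_const l
  have hg0 : inner ℂ g p₀.1 ≠ 0 := fun h => absurd (hgap p₀ hp₀ h) (not_le.mpr hlt)
  -- The trial element cannot be orthogonal to `g`, since it violates the gap; scaled to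
  -- `g`-component one, it serves to subtract that component from the minimizing sequence.
  set e : E × E := (inner ℂ g p₀.1)⁻¹ • p₀ with he
  have heΓ : e ∈ Γ := Γ.smul_mem _ hp₀
  have heg : inner ℂ g e.1 = 1 := by
    rw [he, Prod.smul_fst, inner_smul_right, inv_mul_cancel₀ hg0]
  set c : ℕ → ℂ := fun n => inner ℂ g (p n).1 with hc
  obtain ⟨c₀, -, s, hs, hcs⟩ := tendsto_subseq_of_bounded (x := c)
    (Metric.isBounded_closedBall (x := (0 : ℂ)) (r := ‖g‖)) (fun n => by
      rw [mem_closedBall_zero_iff]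
      simpa [hp1] using norm_inner_le_norm (𝕜 := ℂ) g (p n).1)
  set v : ℕ → E × E := fun n => p (s n) - c (s n) • e with hv
  have hvΓ : ∀ n, v n ∈ Γ := fun n => Γ.sub_mem (hpΓ _) (Γ.smul_mem _ heΓ)
  have hvg : ∀ n, inner ℂ g (v n).1 = 0 := fun n => by
    rw [hv, Prod.fst_sub, Prod.smul_fst, inner_sub_right, inner_smul_right, heg, mul_one, hc,
      sub_self]
  -- On `g⊥` the form `B` controls both components of the graph norm: one entry of the minimum
  -- serves each case of the product's maximum norm.
  set c1 : ℝ := min (1 - l / k ^ 2) (k ^ 2 - l) with hc1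
  have c1pos : 0 < c1 := lt_min (by rw [sub_pos, div_lt_one (by positivity)]; exact lk)
    (by linarith)
  have coer : ∀ q ∈ Γ, inner ℂ g q.1 = 0 → c1 * ‖q‖ ^ 2 ≤ B q := by
    intro q hq hqg
    have h1 : k ^ 2 * ‖q.1‖ ^ 2 ≤ ‖q.2‖ ^ 2 := by
      rw [← mul_pow]
      exact pow_le_pow_left₀ (by positivity) (hgap q hq hqg) 2
    rcases max_choice ‖q.1‖ ‖q.2‖ with h | h
    · rw [Prod.norm_def, h]
      refine (mul_le_mul_of_nonneg_right (min_le_right _ _) (by positivity)).trans ?_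
      simp only [hB]; linarith
    · rw [Prod.norm_def, h]
      refine (mul_le_mul_of_nonneg_right (min_le_left _ _) (by positivity)).trans ?_
      have h2 : l / k ^ 2 * (k ^ 2 * ‖q.1‖ ^ 2) ≤ l / k ^ 2 * ‖q.2‖ ^ 2 :=
        mul_le_mul_of_nonneg_left h1 (by positivity)
      have h3 : l / k ^ 2 * (k ^ 2 * ‖q.1‖ ^ 2) = l * ‖q.1‖ ^ 2 := by field_simp
      simp only [hB]; linarith
  have hcau : CauchySeq v := by
    rw [cauchySeq_iff_tendsto_dist_atTop_0]
    have hc2 := cauchySeq_iff_tendsto_dist_atTop_0.mp hcs.cauchySeq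
    have hb := hBp.comp hs.tendsto_atTop
    have hb1 : Tendsto (fun n : ℕ × ℕ => B (p (s n.1))) atTop (𝓝 0) := by
      rw [← prod_atTop_atTop_eq]; exact hb.comp tendsto_fst
    have hb2 : Tendsto (fun n : ℕ × ℕ => B (p (s n.2))) atTop (𝓝 0) := by
      rw [← prod_atTop_atTop_eq]; exact hb.comp tendsto_snd
    have hbig : Tendsto (fun n : ℕ × ℕ => Real.sqrt (c1⁻¹ * (4 * B (p (s n.1)) + 4 * B (p (s n.2))
        + 2 * (dist ((c ∘ s) n.1) ((c ∘ s) n.2) ^ 2 * B e)))) atTop (𝓝 0) := by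
      have := ((((hb1.const_mul 4).add (hb2.const_mul 4)).add
        (((hc2.pow 2).mul_const (B e)).const_mul 2)).const_mul c1⁻¹).sqrt
      simpa using this
    refine squeeze_zero (fun _ => dist_nonneg) (fun n => Real.le_sqrt_of_sq_le ?_) hbig
    rw [inv_mul_eq_div, le_div_iff₀ c1pos, mul_comm, dist_eq_norm]
    refine (coer _ (Γ.sub_mem (hvΓ _) (hvΓ _)) (by
      rw [Prod.fst_sub, inner_sub_right, hvg, hvg, sub_zero])).trans ?_
    have e1 : v n.1 - v n.2 = (p (s n.1) - p (s n.2)) - (c (s n.1) - c (s n.2)) • e := by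
      simp only [hv, sub_smul]; abel
    rw [e1]
    refine (Bsub _ (Γ.sub_mem (hpΓ _) (hpΓ _)) _ (Γ.smul_mem _ heΓ)).trans ?_
    have h1 := Bsub _ (hpΓ (s n.1)) _ (hpΓ (s n.2))
    rw [Bsmul, dist_eq_norm]
    simp only [Function.comp]
    linarith
  obtain ⟨v₀, hv₀⟩ := cauchySeq_tendsto_of_complete hcau
  have hps : Tendsto (fun n => p (s n)) atTop (𝓝 (v₀ + c₀ • e)) := by
    have := hv₀.add (hcs.smul_const e)
    refine this.congr fun n => ?_
    simp [hv]
  set z := v₀ + c₀ • e with hz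
  have hzΓ : z ∈ Γ := hΓ.mem_of_tendsto hps (Eventually.of_forall fun n => hpΓ _)
  have hz1 : ‖z.1‖ = 1 := by
    have h1 : Tendsto (fun n => ‖(p (s n)).1‖) atTop (𝓝 ‖z.1‖) :=
      ((continuous_fst.tendsto z).comp hps).norm
    simp only [hp1] at h1
    exact tendsto_nhds_unique h1 tendsto_const_nhds
  have hzB : B z = 0 := by
    have hcont : Continuous B := by fun_prop
    exact tendsto_nhds_unique ((hcont.tendsto z).comp hps) (hBp.comp hs.tendsto_atTop)
  exact ⟨z.1, z.2, l, l0, lk, hz1, isCritical_of_minimal hzΓ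
    (fun q hq => sub_nonneg.mp (Bnn q hq)) (sub_eq_zero.mp hzB)⟩

lemma IsCritical.norm_sq {Γ : Submodule ℂ (E × E)} {l : ℝ} {x y : E} (h : IsCritical Γ l x y) :
    ‖y‖ ^ 2 = l * ‖x‖ ^ 2 := by
  have := h.2 _ h.1
  simp only [inner_self_eq_norm_sq_to_K, coe_algebraMap] at this
  exact_mod_cast this

lemma IsCritical.smul {Γ : Submodule ℂ (E × E)} {l : ℝ} {x y : E} (h : IsCritical Γ l x y)
    (c : ℂ) : IsCritical Γ l (c • x) (c • y) := by
  refine ⟨Γ.smul_mem c h.1, fun p hp => ?_⟩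
  rw [inner_smul_left, inner_smul_left, h.2 p hp]; ring

/-- Otherwise the gap would apply to `x` and give `k² ≤ l`. -/
lemma IsCritical.inner_ne_zero {Γ : Submodule ℂ (E × E)} {g : E} {k : ℝ} (hk : 0 < k)
    (hgap : ∀ p ∈ Γ, inner ℂ g p.1 = 0 → k * ‖p.1‖ ≤ ‖p.2‖) {l : ℝ} (hl : l < k ^ 2) {x y : E}
    (h : IsCritical Γ l x y) (hx : x ≠ 0) : inner ℂ g x ≠ 0 := by
  intro h0
  have h1 := pow_le_pow_left₀ (by positivity) (hgap _ h.1 h0) 2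
  have hx' : 0 < ‖x‖ := norm_pos_iff.mpr hx
  simp only [mul_pow] at h1
  rw [h.norm_sq] at h1
  nlinarith [pow_pos hx' 2]

/-- Below the gap, any two critical pairs are proportional. -/
theorem IsCritical.unique {Γ : Submodule ℂ (E × E)} {g : E} {k : ℝ} (hk : 0 < k)
    (hgap : ∀ p ∈ Γ, inner ℂ g p.1 = 0 → k * ‖p.1‖ ≤ ‖p.2‖) {l μ : ℝ} (hl : l < k ^ 2)
    (hμ : μ < k ^ 2) {x y x' y' : E} (h : IsCritical Γ l x y) (hx : x ≠ 0)
    (h' : IsCritical Γ μ x' y') (hx' : x' ≠ 0) :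
    μ = l ∧ ∃ t : ℂ, x' = t • x := by
  have hg := h.inner_ne_zero hk hgap hl hx
  -- This combination is orthogonal to `g`, so the gap bounds its quotient below by `k²`, while
  -- criticality bounds it above by the larger of the two values; it must vanish.
  set t : ℂ := inner ℂ g x' / inner ℂ g x with ht
  have hz : (x' - t • x, y' - t • y) ∈ Γ := Γ.sub_mem h'.1 (Γ.smul_mem t h.1)
  have hzg : inner ℂ g (x' - t • x) = 0 := by
    rw [inner_sub_right, inner_smul_right, ht, div_mul_cancel₀ _ hg, sub_self]
  have h1 := pow_le_pow_left₀ (by positivity) (hgap _ hz hzg) 2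
  simp only [mul_pow] at h1
  have a1 : inner ℂ y' y = μ * inner ℂ x' x := h'.2 _ h.1
  have a2 : inner ℂ y y' = l * inner ℂ x x' := h.2 _ h'.1
  have hxn : 0 < ‖x‖ ^ 2 := pow_pos (norm_pos_iff.mpr hx) 2
  have hxn' : 0 < ‖x'‖ ^ 2 := pow_pos (norm_pos_iff.mpr hx') 2
  rw [@norm_sub_sq ℂ, @norm_sub_sq ℂ, inner_smul_right, inner_smul_right, norm_smul, norm_smul,
    mul_pow, mul_pow, h.norm_sq, h'.norm_sq] at h1
  have hzero : ∀ ν : ℝ, ν < k ^ 2 → k ^ 2 * ‖x' - t • x‖ ^ 2 ≤ ν * ‖x' - t • x‖ ^ 2 →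
      x' = t • x := by
    intro ν hν hle
    by_contra hne
    have : 0 < ‖x' - t • x‖ ^ 2 := pow_pos (norm_pos_iff.mpr (sub_ne_zero.mpr hne)) 2
    nlinarith
  have hns : ‖x' - t • x‖ ^ 2 = ‖x'‖ ^ 2 - 2 * (t * inner ℂ x' x).re + ‖t‖ ^ 2 * ‖x‖ ^ 2 := by
    rw [@norm_sub_sq ℂ, inner_smul_right, norm_smul, mul_pow]; rfl
  rw [a1] at h1
  simp only [RCLike.re_to_complex] at h1
  have e1 : (t * ((μ : ℂ) * inner ℂ x' x)).re = μ * (t * inner ℂ x' x).re := by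
    rw [mul_left_comm, re_ofReal_mul]
  rw [e1, ← hns] at h1
  rcases eq_or_ne μ l with heq | hne
  · refine ⟨heq, t, hzero μ hμ ?_⟩
    rw [hns] at h1 ⊢
    rw [← heq] at h1
    nlinarith
  · exfalso
    -- Symmetry of the two critical relations makes vectors with different values orthogonal, which
    -- is incompatible with proportionality.
    have hort : inner ℂ x' x = 0 := by
      have a3 : inner ℂ y' y = l * inner ℂ x' x := by
        rw [← inner_conj_symm, a2, map_mul, inner_conj_symm, conj_ofReal]
      have : ((μ : ℂ) - l) * inner ℂ x' x = 0 := by rw [sub_mul, ← a1, ← a3, sub_self]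
      rcases mul_eq_zero.mp this with h2 | h2
      · exact absurd (by exact_mod_cast sub_eq_zero.mp h2) hne
      · exact h2
    have hx't : x' = t • x := by
      refine hzero (max μ l) (max_lt hμ hl) ?_
      rw [hns, hort] at h1 ⊢
      simp only [mul_zero, zero_re, sub_zero] at h1 ⊢
      have b1 := mul_le_mul_of_nonneg_right (le_max_left μ l) hxn'.le
      have b2 : ‖t‖ ^ 2 * (l * ‖x‖ ^ 2) ≤ max μ l * (‖t‖ ^ 2 * ‖x‖ ^ 2) := by
        have := mul_le_mul_of_nonneg_right (le_max_right μ l)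
          (by positivity : 0 ≤ ‖t‖ ^ 2 * ‖x‖ ^ 2)
        linarith
      linarith
    have : inner ℂ x' x' = 0 := by
      conv_lhs => rw [hx't, inner_smul_right, ← hx't, hort, mul_zero]
    exact hx' (inner_self_eq_zero.mp this)

end Variational

end DomainWallDirac

end

/-! ### The operators `f ↦ f' ± m f` on scalar `L²` -/

noncomputable section

namespace DomainWallDirac

open Filter Topology Set

/-- The scalar space `L²(ℝ; ℂ)`. -/
abbrev L2C : Type := Lp ℂ 2 (volume : Measure ℝ)

lemma norm_sq_eq_integral {E : Type*} [NormedAddCommGroup E] [InnerProductSpace ℂ E]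
    (f : Lp E 2 (volume : Measure ℝ)) : ‖f‖ ^ 2 = ∫ x, ‖f x‖ ^ 2 := by
  have h1 : inner ℂ f f = ((‖f‖ ^ 2 : ℝ) : ℂ) := by
    rw [inner_self_eq_norm_sq_to_K]; simp
  have h2 : inner ℂ f f = ((∫ x, ‖f x‖ ^ 2 : ℝ) : ℂ) := by
    rw [L2.inner_def, ← integral_complex_ofReal]
    refine integral_congr_ae (Eventually.of_forall fun x => ?_)
    simp only [inner_self_eq_norm_sq_to_K]; simp
  exact_mod_cast h1.symm.trans h2

lemma norm_toLp_sq_eq_integral {E : Type*} [NormedAddCommGroup E] [InnerProductSpace ℂ E]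
    {f : ℝ → E} (hf : MemLp f 2 (volume : Measure ℝ)) : ‖hf.toLp f‖ ^ 2 = ∫ x, ‖f x‖ ^ 2 := by
  rw [norm_sq_eq_integral]
  exact integral_congr_ae (hf.coeFn_toLp.mono fun x hx => by simp only [hx])

lemma memLp_test {φ : ℝ → ℝ} (hφ : Continuous φ) (hc : HasCompactSupport φ) :
    MemLp (fun x => (φ x : ℂ)) 2 (volume : Measure ℝ) :=
  Continuous.memLp_of_hasCompactSupport (by fun_prop)
    (hc.comp_left (g := fun t : ℝ => (t : ℂ)) ofReal_zero)

lemma inner_test {φ : ℝ → ℝ} (hφ : Continuous φ) (hc : HasCompactSupport φ) (f : L2C) :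
    inner ℂ ((memLp_test hφ hc).toLp _) f = ∫ x, φ x • f x := by
  rw [L2.inner_def]
  refine integral_congr_ae ?_
  filter_upwards [(memLp_test hφ hc).coeFn_toLp] with x hx
  rw [hx, RCLike.inner_apply, conj_ofReal, real_smul, mul_comm]

/-- Each test function imposes a continuous linear relation on the pair `(f, g)`. Linearity and
closedness of the graph follow from this form. -/
lemma weakEq_iff_inner {m : ℝ → ℝ} (hm : Continuous m) (f g : L2C) :
    WeakEq m f g ↔ ∀ (φ : ℝ → ℝ) (φs : ContDiff ℝ ∞ φ) (φc : HasCompactSupport φ),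
      inner ℂ ((memLp_test (continuous_deriv_sub_mul φs hm)
        (HasCompactSupport.deriv_sub_mul φc)).toLp _) f
      = -inner ℂ ((memLp_test φs.continuous φc).toLp _) g := by
  refine forall_congr' fun φ => forall_congr' fun φs => forall_congr' fun φc => ?_
  rw [inner_test (continuous_deriv_sub_mul φs hm) (HasCompactSupport.deriv_sub_mul φc),
    inner_test φs.continuous φc]

/-- The graph of the operator `f ↦ f' + m f` on `L²(ℝ; ℂ)`. -/
def opGraph (m : ℝ → ℝ) (hm : Continuous m) : Submodule ℂ (L2C × L2C) where
  carrier := {p | WeakEq m p.1 p.2}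
  zero_mem' := by
    rw [mem_ofPred_eq, weakEq_iff_inner hm]
    intro φ φs φc
    simp
  add_mem' := by
    intro a b ha hb
    rw [mem_ofPred_eq, weakEq_iff_inner hm] at ha hb ⊢
    intro φ φs φc
    rw [Prod.fst_add, Prod.snd_add, inner_add_right, inner_add_right, ha φ φs φc, hb φ φs φc,
      neg_add]
  smul_mem' := by
    intro c a ha
    rw [mem_ofPred_eq, weakEq_iff_inner hm] at ha ⊢
    intro φ φs φc
    rw [Prod.smul_fst, Prod.smul_snd, inner_smul_right, inner_smul_right, ha φ φs φc, mul_neg]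

variable {m : ℝ → ℝ} {hm : Continuous m}

lemma mem_opGraph {p : L2C × L2C} : p ∈ opGraph m hm ↔ WeakEq m p.1 p.2 := Iff.rfl

lemma isClosed_opGraph : IsClosed (opGraph m hm : Set (L2C × L2C)) := by
  have e : (opGraph m hm : Set (L2C × L2C)) = ⋂ (φ : ℝ → ℝ) (φs : ContDiff ℝ ∞ φ)
      (φc : HasCompactSupport φ), {p | inner ℂ ((memLp_test (continuous_deriv_sub_mul φs hm)
        (HasCompactSupport.deriv_sub_mul φc)).toLp _) p.1
      = -inner ℂ ((memLp_test φs.continuous φc).toLp _) p.2} := by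
    ext p
    rw [SetLike.mem_coe, mem_opGraph, weakEq_iff_inner hm]
    simp only [mem_iInter, mem_ofPred_eq]
  rw [e]
  refine isClosed_iInter fun φ => isClosed_iInter fun φs => isClosed_iInter fun φc => ?_
  exact isClosed_eq (by fun_prop) (by fun_prop)

lemma Lp_locallyIntegrable (f : L2C) : LocallyIntegrable f :=
  (Lp.memLp f).locallyIntegrable (by norm_num)

lemma IsPrim.mem_opGraph {F g : ℝ → ℂ} (h : IsPrim F fun x => g x - m x * F x)
    (hF : MemLp F 2 (volume : Measure ℝ)) (hg : MemLp g 2 (volume : Measure ℝ)) :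
    (hF.toLp F, hg.toLp g) ∈ opGraph m hm :=
  (h.weakEq hm (hg.locallyIntegrable (by norm_num))).congr hF.coeFn_toLp.symm hg.coeFn_toLp.symm

lemma exists_isPrim_of_mem_opGraph {f g : L2C} (h : (f, g) ∈ opGraph m hm) :
    ∃ F, f =ᵐ[volume] F ∧ IsPrim F fun x => g x - m x * F x :=
  WeakEq.exists_isPrim hm h (Lp_locallyIntegrable f) (Lp_locallyIntegrable g)

/-- The formal adjoint of `f ↦ f' + m f` is `g ↦ -(g' - m g)`. -/
theorem inner_eq_neg_inner_of_mem_opGraph {hm' : Continuous fun x => -m x} {p g q h : L2C}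
    (hp : (p, g) ∈ opGraph m hm) (hq : (q, h) ∈ opGraph (fun x => -m x) hm') :
    inner ℂ g q = -inner ℂ p h := by
  obtain ⟨P, eP, hP⟩ := exists_isPrim_of_mem_opGraph hp
  obtain ⟨Q, eQ, hQ⟩ := exists_isPrim_of_mem_opGraph hq
  have i0 := L2.integrable_inner (𝕜 := ℂ) p q
  have i1 := L2.integrable_inner (𝕜 := ℂ) g q
  have i2 := L2.integrable_inner (𝕜 := ℂ) p h
  -- The mass terms cancel in the derivative of `conj P * Q`, leaving two integrable inner products
  -- whose total integral vanishes.
  have hmul := hP.conj.mul hQ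
  have hz := (hmul.congr (g := fun x => inner ℂ (g x) (q x) + inner ℂ (p x) (h x)) (by
    filter_upwards [eP, eQ] with x h1 h2
    simp only [RCLike.inner_apply, h1, h2, map_sub, map_mul, conj_ofReal]
    push_cast
    ring)).integral_eq_zero (i0.congr (by
      filter_upwards [eP, eQ] with x h1 h2
      rw [RCLike.inner_apply, h1, h2, mul_comm])) (i1.add i2)
  rw [integral_add i1 i2, ← L2.inner_def, ← L2.inner_def] at hz
  exact eq_neg_of_add_eq_zero_left hz

lemma profile_hasDerivAt (hm : Continuous m) (x : ℝ) :
    HasDerivAt (profile m) (-m x * profile m x) x := by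
  have h1 : HasDerivAt (fun x => -∫ y in (0 : ℝ)..x, m y) (-m x) x :=
    (hm.integral_hasStrictDerivAt 0 x).hasDerivAt.neg
  have h2 := h1.exp
  rw [mul_comm] at h2
  exact h2

lemma profile_pos (m : ℝ → ℝ) (x : ℝ) : 0 < profile m x := Real.exp_pos _

lemma profile_zero (m : ℝ → ℝ) : profile m 0 = 1 := by simp [profile]

lemma profile_continuous (hm : Continuous m) : Continuous (profile m) :=
  continuous_iff_continuousAt.mpr fun x => (profile_hasDerivAt hm x).continuousAt

lemma profile_neg_mass (m : ℝ → ℝ) (x : ℝ) : profile (fun y => -m y) x = (profile m x)⁻¹ := by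
  simp [profile, Real.exp_neg, intervalIntegral.integral_neg]

/-- Integrating factor: the product of the solution with `exp (∫₀ˣ m)` has zero derivative. -/
lemma ae_eq_profile_of_mem_opGraph {p : L2C} (h : (p, 0) ∈ opGraph m hm) :
    ∃ c : ℂ, p =ᵐ[volume] fun x => c * profile m x := by
  obtain ⟨P, eP, hP⟩ := exists_isPrim_of_mem_opGraph h
  have hm' : Continuous fun x => -m x := hm.neg
  have hw : IsPrim (fun x => ((profile (fun y => -m y) x : ℝ) : ℂ))
      (fun x => ((m x * profile (fun y => -m y) x : ℝ) : ℂ)) :=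
    IsPrim.of_hasDerivAt (fun x => by simpa using (profile_hasDerivAt hm' x).ofReal_comp)
      (continuous_ofReal.comp (hm.mul (profile_continuous hm')))
  have hc := (hP.mul hw).congr (g := fun _ => 0) (by
    filter_upwards [Lp.coeFn_zero ℂ 2 (volume : Measure ℝ)] with x hx
    rw [hx]; push_cast; simp; ring)
  refine ⟨P 0, ?_⟩
  filter_upwards [eP] with x hx
  have h1 := hc.2 x
  simp only [profile_zero, profile_neg_mass] at h1
  simp only [intervalIntegral.integral_zero, add_zero, ofReal_one, mul_one, ofReal_inv] at h1
  have h2 : (profile m x : ℂ) ≠ 0 := by exact_mod_cast (profile_pos m x).ne'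
  rw [hx, ← h1, inv_mul_cancel_right₀ h2]

/-- A critical pair of `g ↦ g' - m g` satisfies the Euler–Lagrange equation weakly. -/
lemma IsCritical.mem_opGraph {hm' : Continuous fun x => -m x} {l : ℝ} {x y : L2C}
    (h : IsCritical (opGraph (fun x => -m x) hm') l x y) :
    (y, -(l : ℂ) • x) ∈ opGraph m hm := by
  rw [DomainWallDirac.mem_opGraph, weakEq_iff_inner hm]
  intro φ φs φc
  have hd : Continuous (deriv φ) := φs.continuous_deriv (by simp)
  have hp : IsPrim (fun x => (φ x : ℂ)) (fun x => ((deriv φ x : ℝ) : ℂ)) :=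
    IsPrim.of_hasDerivAt
      (fun x => ((φs.differentiable (by simp)) x).hasDerivAt.ofReal_comp)
      (continuous_ofReal.comp hd)
  -- Test functions belong to the graph, so the critical relation may be applied to them;
  -- conjugated, it is the weak equation `y' + m y = -l x`.
  have hmem : ((memLp_test φs.continuous φc).toLp _,
      (memLp_test (continuous_deriv_sub_mul φs hm)
        (HasCompactSupport.deriv_sub_mul φc)).toLp _) ∈ opGraph (fun x => -m x) hm' := by
    refine IsPrim.mem_opGraph (hp.congr (Eventually.of_forall fun x => ?_)) _ _
    simp only; push_cast; ring
  have h1 := congrArg (starRingEnd ℂ) (h.2 _ hmem)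
  rw [inner_conj_symm, map_mul, inner_conj_symm, conj_ofReal] at h1
  rw [h1, inner_smul_right]; ring

/-- Solutions of the first order system `q' - m q = -iE p`, `p' + m p = -iE q` are critical. -/
lemma isCritical_of_system {hm' : Continuous fun x => -m x} {E : ℝ} {p q : L2C}
    (hp : (p, (-(I * E)) • q) ∈ opGraph m hm)
    (hq : (q, (-(I * E)) • p) ∈ opGraph (fun x => -m x) hm') :
    IsCritical (opGraph (fun x => -m x) hm') (E ^ 2) q ((-(I * E)) • p) := by
  refine ⟨hq, fun r hr => ?_⟩
  have := inner_eq_neg_inner_of_mem_opGraph hp (q := r.1) (h := r.2) hr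
  rw [inner_smul_left] at this ⊢
  rw [← neg_eq_iff_eq_neg] at this
  rw [← this]
  simp only [map_neg, map_mul, conj_I, conj_ofReal]
  push_cast
  ring_nf
  rw [I_sq]; ring

end DomainWallDirac

end

/-! ### Chiral coordinates for the Dirac operator -/

noncomputable section

namespace DomainWallDirac

open Filter Topology Set

/-- The chiral coordinate `a - i b` of a spinor `(a, b)`. -/
def projP : C2 →L[ℂ] ℂ := EuclideanSpace.proj (0 : Fin 2) - I • EuclideanSpace.proj (1 : Fin 2)

/-- The chiral coordinate `a + i b` of a spinor `(a, b)`. -/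
def projQ : C2 →L[ℂ] ℂ := EuclideanSpace.proj (0 : Fin 2) + I • EuclideanSpace.proj (1 : Fin 2)

/-- The embedding of the first chiral component. -/
def embP : ℂ →L[ℂ] C2 := ContinuousLinearMap.toSpanSingleton ℂ !₂[(1 / 2 : ℂ), I / 2]

/-- The embedding of the second chiral component. -/
def embQ : ℂ →L[ℂ] C2 := ContinuousLinearMap.toSpanSingleton ℂ !₂[(1 / 2 : ℂ), -(I / 2)]

lemma projP_apply (v : C2) : projP v = v 0 - I * v 1 := by simp [projP]

lemma projQ_apply (v : C2) : projQ v = v 0 + I * v 1 := by simp [projQ]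

lemma embP_zero (z : ℂ) : embP z 0 = z / 2 := by simp [embP]; ring

lemma embP_one (z : ℂ) : embP z 1 = I * z / 2 := by simp [embP]; ring

lemma embQ_zero (z : ℂ) : embQ z 0 = z / 2 := by simp [embQ]; ring

lemma embQ_one (z : ℂ) : embQ z 1 = -(I * z / 2) := by simp [embQ]; ring

lemma C2_ext {v w : C2} (h0 : v 0 = w 0) (h1 : v 1 = w 1) : v = w := by
  ext i; fin_cases i
  · exact h0
  · exact h1

lemma act_sigma3_zero (v : C2) : act sigma3 v 0 = v 0 := by
  simp [act, sigma3, Matrix.ofLp_toEuclideanCLM, Matrix.mulVec, dotProduct]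

lemma act_sigma3_one (v : C2) : act sigma3 v 1 = -v 1 := by
  simp [act, sigma3, Matrix.ofLp_toEuclideanCLM, Matrix.mulVec, dotProduct]

lemma act_sigma1_zero (v : C2) : act sigma1 v 0 = v 1 := by
  simp [act, sigma1, Matrix.ofLp_toEuclideanCLM, Matrix.mulVec, dotProduct]

lemma act_sigma1_one (v : C2) : act sigma1 v 1 = v 0 := by
  simp [act, sigma1, Matrix.ofLp_toEuclideanCLM, Matrix.mulVec, dotProduct]

lemma embP_projP_add (v : C2) : embP (projP v) + embQ (projQ v) = v := by
  apply C2_ext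
  · simp only [PiLp.add_apply, embP_zero, embQ_zero, projP_apply, projQ_apply]; ring
  · simp only [PiLp.add_apply, embP_one, embQ_one, projP_apply, projQ_apply]
    linear_combination (-v 1) * I_mul_I

lemma norm_sq_embP_add_embQ (a b : ℂ) :
    ‖embP a + embQ b‖ ^ 2 = (‖a‖ ^ 2 + ‖b‖ ^ 2) / 2 := by
  rw [EuclideanSpace.norm_sq_eq, Fin.sum_univ_two]
  simp only [PiLp.add_apply, embP_zero, embQ_zero, embP_one, embQ_one, Complex.sq_norm,
    normSq_apply, add_re, add_im, div_re, div_im, neg_re, neg_im, mul_re, mul_im, I_re, I_im]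
  norm_num
  ring

/-- The spinor field with chiral components `p` and `q`. -/
def join (p q : L2C) : H :=
  embP.compLpL 2 (volume : Measure ℝ) p + embQ.compLpL 2 (volume : Measure ℝ) q

/-- The first chiral component of a spinor field. -/
def compP : H →L[ℂ] L2C := projP.compLpL 2 (volume : Measure ℝ)

/-- The second chiral component of a spinor field. -/
def compQ : H →L[ℂ] L2C := projQ.compLpL 2 (volume : Measure ℝ)

lemma coeFn_compP (f : H) : compP f =ᵐ[volume] fun x => projP (f x) :=
  ContinuousLinearMap.coeFn_compLpL _ _

lemma coeFn_compQ (f : H) : compQ f =ᵐ[volume] fun x => projQ (f x) :=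
  ContinuousLinearMap.coeFn_compLpL _ _

lemma coeFn_join (p q : L2C) : join p q =ᵐ[volume] fun x => embP (p x) + embQ (q x) := by
  filter_upwards [Lp.coeFn_add (embP.compLpL 2 (volume : Measure ℝ) p)
    (embQ.compLpL 2 (volume : Measure ℝ) q),
    ContinuousLinearMap.coeFn_compLpL (μ := volume) (p := 2) embP p,
    ContinuousLinearMap.coeFn_compLpL (μ := volume) (p := 2) embQ q] with x h1 h2 h3
  rw [join, h1, Pi.add_apply, h2, h3]

lemma join_compP_compQ (f : H) : join (compP f) (compQ f) = f := by
  refine Lp.ext ?_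
  filter_upwards [coeFn_join (compP f) (compQ f), coeFn_compP f, coeFn_compQ f] with x h1 h2 h3
  rw [h1, h2, h3, embP_projP_add]

lemma join_smul (c : ℂ) (p q : L2C) : join (c • p) (c • q) = c • join p q := by
  simp only [join, map_smul, smul_add]

lemma join_sub (p q p' q' : L2C) : join p q - join p' q' = join (p - p') (q - q') := by
  simp only [join, map_sub]; abel

lemma norm_sq_join (p q : L2C) : ‖join p q‖ ^ 2 = (‖p‖ ^ 2 + ‖q‖ ^ 2) / 2 := by
  have e : ∫ x, ‖join p q x‖ ^ 2 = ∫ x, (‖p x‖ ^ 2 + ‖q x‖ ^ 2) / 2 := by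
    refine integral_congr_ae ?_
    filter_upwards [coeFn_join p q] with x hx
    rw [hx, norm_sq_embP_add_embQ]
  rw [norm_sq_eq_integral, e, integral_div, integral_add, norm_sq_eq_integral,
    norm_sq_eq_integral]
  · exact (Lp.memLp p).integrable_norm_pow two_ne_zero
  · exact (Lp.memLp q).integrable_norm_pow two_ne_zero

lemma HasWeakDeriv.weakEq_comp {f f' : H} (h : HasWeakDeriv f f') (l : C2 →L[ℂ] ℂ) :
    WeakEq (fun _ => 0) (fun x => l (f x)) (fun x => l (f' x)) := by
  intro φ φs φc
  have hd : Continuous (deriv φ) := φs.continuous_deriv (by simp)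
  have h1 := congrArg l (h φ φs φc)
  rw [map_neg, ← l.integral_comp_comm (integrable_test_smul f hd φc.deriv),
    ← l.integral_comp_comm (integrable_test_smul f' φs.continuous φc)] at h1
  simpa only [ContinuousLinearMap.map_smul_of_tower, zero_mul, sub_zero] using h1

lemma hasWeakDeriv_compLpL {p p' : L2C} (h : WeakEq (fun _ => 0) p p') (l : ℂ →L[ℂ] C2) :
    HasWeakDeriv (l.compLpL 2 (volume : Measure ℝ) p) (l.compLpL 2 (volume : Measure ℝ) p') := by
  intro φ φs φc
  have hd : Continuous (deriv φ) := φs.continuous_deriv (by simp)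
  have h1 := congrArg l (h φ φs φc)
  simp only [zero_mul, sub_zero] at h1
  rw [map_neg, ← l.integral_comp_comm
      ((Lp_locallyIntegrable p).integrable_smul_left_of_hasCompactSupport hd φc.deriv),
    ← l.integral_comp_comm
      ((Lp_locallyIntegrable p').integrable_smul_left_of_hasCompactSupport φs.continuous φc)] at h1
  rw [integral_congr_ae (g := fun x => l (deriv φ x • p x)), h1,
    integral_congr_ae (f := fun x => φ x • (l.compLpL 2 (volume : Measure ℝ) p') x)
      (g := fun x => l (φ x • p' x))]
  · filter_upwards [l.coeFn_compLpL (p := 2) (μ := volume) p'] with x hx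
    rw [hx, ContinuousLinearMap.map_smul_of_tower]
  · filter_upwards [l.coeFn_compLpL (p := 2) (μ := volume) p] with x hx
    rw [hx, ContinuousLinearMap.map_smul_of_tower]

variable {m : ℝ → ℝ} {hm : Continuous m} {hm' : Continuous fun x => -m x}

lemma weakEq_of_weakEq_zero (hm : Continuous m) {f f' g : ℝ → ℂ} (h : WeakEq (fun _ => 0) f f')
    (hf : LocallyIntegrable f) (hf' : LocallyIntegrable f')
    (hg : g =ᵐ[volume] fun x => f' x + m x * f x) : WeakEq m f g := by
  obtain ⟨F, eF, hF⟩ := h.exists_isPrim continuous_const hf hf'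
  have hmf : LocallyIntegrable fun x => (m x : ℂ) * f x := by
    simpa only [real_smul] using hf.continuous_smul hm
  have hgl : LocallyIntegrable g := (hf'.add hmf).congr hg.symm
  refine ((hF.congr ?_).weakEq hm hgl).congr eF.symm (ae_eq_refl g)
  filter_upwards [eF, hg] with x h1 h2
  rw [h2, h1]; simp

/-- A bounded mass keeps `m p` in `L²`, so `g - m p` is an admissible derivative in the sense of the
`H¹` domain. -/
lemma exists_weakDeriv (hm : Continuous m) {B : ℝ} (hB : ∀ x, |m x| ≤ B) {p g : L2C}
    (h : WeakEq m p g) : ∃ p' : L2C, WeakEq (fun _ => 0) p p' ∧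
      g =ᵐ[volume] fun x => p' x + m x * p x := by
  have hmp : MemLp (fun x => (m x : ℂ) * p x) 2 (volume : Measure ℝ) := by
    refine (Lp.memLp p).of_le_mul (c := B)
      ((continuous_ofReal.comp hm).aestronglyMeasurable.mul (Lp.aestronglyMeasurable p)) ?_
    refine Eventually.of_forall fun x => ?_
    rw [norm_mul, norm_real, Real.norm_eq_abs]
    exact mul_le_mul_of_nonneg_right (hB x) (norm_nonneg _)
  have hd : MemLp (fun x => g x - m x * p x) 2 (volume : Measure ℝ) := (Lp.memLp g).sub hmp
  obtain ⟨P, eP, hP⟩ := h.exists_isPrim hm (Lp_locallyIntegrable p) (Lp_locallyIntegrable g)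
  refine ⟨hd.toLp _, ?_, ?_⟩
  · refine ((hP.congr ?_).weakEq continuous_const (Lp_locallyIntegrable _)).congr eP.symm
      (ae_eq_refl _)
    filter_upwards [hd.coeFn_toLp, eP] with x h1 h2
    rw [h1, h2]; simp
  · filter_upwards [hd.coeFn_toLp] with x h1
    rw [h1]; ring

lemma locallyIntegrable_comp (l : C2 →L[ℂ] ℂ) (f : H) :
    LocallyIntegrable fun x => l (f x) :=
  (l.comp_memLp' (Lp.memLp f)).locallyIntegrable (by norm_num)

/-- The Dirac operator in chiral coordinates: `(p, q) ↦ (i (q' - m q), i (p' + m p))`. -/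
theorem chiral_of_mem_diracGraph {f k : H} (h : (f, k) ∈ diracGraph m) :
    (compP f, (-I) • compQ k) ∈ opGraph m hm ∧
      (compQ f, (-I) • compP k) ∈ opGraph (fun x => -m x) hm' := by
  obtain ⟨f', hf', hk⟩ := h
  simp only at hf' hk
  constructor
  · refine (weakEq_of_weakEq_zero hm (hf'.weakEq_comp projP) (locallyIntegrable_comp _ _)
      (locallyIntegrable_comp _ _) (g := ((-I) • compQ k : L2C)) ?_).congr (coeFn_compP f).symm
      (ae_eq_refl _)
    filter_upwards [hk, coeFn_compQ k, Lp.coeFn_smul (-I) (compQ k)] with x h1 h2 h3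
    rw [h3, Pi.smul_apply, h2, h1]
    simp only [projP_apply, projQ_apply, PiLp.add_apply, PiLp.smul_apply, act_sigma3_zero,
      act_sigma3_one, act_sigma1_zero, act_sigma1_one, smul_eq_mul]
    linear_combination (-f' x 0 - (m x : ℂ) * f x 0 + I * f' x 1) * I_sq
  · refine (weakEq_of_weakEq_zero hm' (hf'.weakEq_comp projQ) (locallyIntegrable_comp _ _)
      (locallyIntegrable_comp _ _) (g := ((-I) • compP k : L2C)) ?_).congr (coeFn_compQ f).symm
      (ae_eq_refl _)
    filter_upwards [hk, coeFn_compP k, Lp.coeFn_smul (-I) (compP k)] with x h1 h2 h3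
    rw [h3, Pi.smul_apply, h2, h1]
    simp only [projP_apply, projQ_apply, PiLp.add_apply, PiLp.smul_apply, act_sigma3_zero,
      act_sigma3_one, act_sigma1_zero, act_sigma1_one, smul_eq_mul, ofReal_neg]
    linear_combination (-f' x 0 + (m x : ℂ) * f x 0 - I * f' x 1) * I_sq

/-- The converse passage, used to feed scalar functions into the spectral gap hypothesis and to
build eigenvectors from solutions of the scalar system. -/
theorem mem_diracGraph_of_chiral {B : ℝ} (hB : ∀ x, |m x| ≤ B) {p g q h : L2C}
    (hp : (p, g) ∈ opGraph m hm) (hq : (q, h) ∈ opGraph (fun x => -m x) hm') :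
    (join p q, join (I • h) (I • g)) ∈ diracGraph m := by
  obtain ⟨p', wp, ep⟩ := exists_weakDeriv hm hB hp
  obtain ⟨q', wq, eq⟩ := exists_weakDeriv hm' (B := B) (by simpa using hB) hq
  refine ⟨join p' q', (hasWeakDeriv_compLpL wp embP).add (hasWeakDeriv_compLpL wq embQ), ?_⟩
  filter_upwards [ep, eq, coeFn_join p q, coeFn_join p' q', coeFn_join (I • h) (I • g),
    Lp.coeFn_smul I h, Lp.coeFn_smul I g] with x h1 h2 h3 h4 h5 h6 h7
  rw [h3, h4, h5, h6, h7, Pi.smul_apply, Pi.smul_apply, h1, h2]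
  apply C2_ext
  · simp only [PiLp.add_apply, PiLp.smul_apply, act_sigma3_zero, act_sigma1_zero, smul_eq_mul,
      embP_zero, embQ_zero, embP_one, embQ_one, ofReal_neg]
    ring
  · simp only [PiLp.add_apply, PiLp.smul_apply, act_sigma3_one, act_sigma1_one, smul_eq_mul,
      embP_zero, embQ_zero, embP_one, embQ_one, ofReal_neg]
    linear_combination (-(m x : ℂ) * (p x + q x) / 2) * I_sq

lemma mem_eigenspace_iff {E : ℂ} {f : H} :
    f ∈ eigenspace m E ↔ (f, E • f) ∈ diracGraph m := by
  rw [← diracOp_graph]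
  constructor
  · rintro ⟨hf, hE⟩
    rw [← hE]
    exact (diracOp m).mem_graph ⟨f, hf⟩
  · intro h
    obtain ⟨y, hy, hE⟩ := (diracOp m).mem_graph_iff.mp h
    simp only at hy hE
    subst hy
    exact ⟨y.2, hE⟩

theorem system_of_mem_eigenspace {E : ℂ} {f : H} (h : f ∈ eigenspace m E) :
    (compP f, (-(I * E)) • compQ f) ∈ opGraph m hm ∧
      (compQ f, (-(I * E)) • compP f) ∈ opGraph (fun x => -m x) hm' := by
  have := chiral_of_mem_diracGraph (hm := hm) (hm' := hm') (mem_eigenspace_iff.mp h)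
  simpa only [map_smul, smul_smul, neg_mul] using this

theorem join_mem_eigenspace {B : ℝ} (hB : ∀ x, |m x| ≤ B) {E : ℂ} {p q : L2C}
    (hp : (p, (-(I * E)) • q) ∈ opGraph m hm)
    (hq : (q, (-(I * E)) • p) ∈ opGraph (fun x => -m x) hm') :
    join p q ∈ eigenspace m E := by
  rw [mem_eigenspace_iff]
  have := mem_diracGraph_of_chiral hB hp hq
  have e : I * -(I * E) = E := by linear_combination (-E) * I_sq
  rwa [smul_smul, smul_smul, e, join_smul] at this

end DomainWallDirac

end

/-! ### The spectral gap for three walls by IMS localization -/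

noncomputable section

namespace DomainWallDirac

open Filter Topology Set

/-- `F` is square integrable with `F' + m F = h` and `h` square integrable. -/
def Sol (m : ℝ → ℝ) (F h : ℝ → ℂ) : Prop :=
  IsPrim F (fun x => h x - m x * F x) ∧ MemLp F 2 (volume : Measure ℝ) ∧
    MemLp h 2 (volume : Measure ℝ)

lemma MemLp.real_mul_of_bound {a : ℝ → ℝ} (ha : Continuous a) {B : ℝ} (hB : ∀ x, |a x| ≤ B)
    {f : ℝ → ℂ} (hf : MemLp f 2 (volume : Measure ℝ)) :
    MemLp (fun x => (a x : ℂ) * f x) 2 (volume : Measure ℝ) := by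
  refine hf.of_le_mul (c := B)
    ((continuous_ofReal.comp ha).aestronglyMeasurable.mul hf.aestronglyMeasurable) ?_
  refine Eventually.of_forall fun x => ?_
  rw [norm_mul, norm_real, Real.norm_eq_abs]
  exact mul_le_mul_of_nonneg_right (hB x) (norm_nonneg _)

lemma Sol.real_mul {m a a' : ℝ → ℝ} {F h : ℝ → ℂ} (hs : Sol m F h) (ha : ∀ x, HasDerivAt a (a' x) x)
    (ha' : Continuous a') {A B : ℝ} (hA : ∀ x, |a x| ≤ A) (hB : ∀ x, |a' x| ≤ B) :
    Sol m (fun x => a x * F x) (fun x => a x * h x + a' x * F x) := by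
  have hc : Continuous a := continuous_iff_continuousAt.mpr fun x => (ha x).continuousAt
  have hp : IsPrim (fun x => (a x : ℂ)) fun x => (a' x : ℂ) :=
    IsPrim.of_hasDerivAt (fun x => (ha x).ofReal_comp) (continuous_ofReal.comp ha')
  refine ⟨(hp.mul hs.1).congr (Eventually.of_forall fun x => ?_),
    MemLp.real_mul_of_bound hc hA hs.2.1,
    (MemLp.real_mul_of_bound hc hA hs.2.2).add (MemLp.real_mul_of_bound ha' hB hs.2.1)⟩
  simp only; ring

/-- IMS formula for the partition `cos² + sin² = 1`: the localized right-hand sides `cos θ h - θ'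
sin θ Q` and `sin θ h + θ' cos θ Q` have cross terms that cancel, so the only loss is `θ'² |Q|²`. -/
lemma Sol.cos_sin {m θ θ' : ℝ → ℝ} {Q h : ℝ → ℂ} (hs : Sol m Q h)
    (hθ : ∀ x, HasDerivAt θ (θ' x) x) (hθ' : Continuous θ') {c : ℝ} (hc : ∀ x, |θ' x| ≤ c) :
    ∃ h₁ h₂, Sol m (fun x => Real.cos (θ x) * Q x) h₁ ∧ Sol m (fun x => Real.sin (θ x) * Q x) h₂ ∧
      (∫ x, ‖Q x‖ ^ 2 = (∫ x, ‖Real.cos (θ x) * Q x‖ ^ 2) + ∫ x, ‖Real.sin (θ x) * Q x‖ ^ 2) ∧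
      (∫ x, ‖h₁ x‖ ^ 2) + ∫ x, ‖h₂ x‖ ^ 2 ≤ (∫ x, ‖h x‖ ^ 2) + c ^ 2 * ∫ x, ‖Q x‖ ^ 2 := by
  have hcθ : Continuous θ := continuous_iff_continuousAt.mpr fun x => (hθ x).continuousAt
  have hb1 : ∀ x, |-Real.sin (θ x) * θ' x| ≤ c := fun x => by
    rw [abs_mul, abs_neg]
    exact (mul_le_mul (Real.abs_sin_le_one _) (hc x) (abs_nonneg _) zero_le_one).trans
      (one_mul c).le
  have hb2 : ∀ x, |Real.cos (θ x) * θ' x| ≤ c := fun x => by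
    rw [abs_mul]
    exact (mul_le_mul (Real.abs_cos_le_one _) (hc x) (abs_nonneg _) zero_le_one).trans
      (one_mul c).le
  have s1 := hs.real_mul (fun x => (hθ x).cos) (by fun_prop) (fun x => Real.abs_cos_le_one _) hb1
  have s2 := hs.real_mul (fun x => (hθ x).sin) (by fun_prop) (fun x => Real.abs_sin_le_one _) hb2
  refine ⟨_, _, s1, s2, ?_, ?_⟩
  · rw [← integral_add (s1.2.1.integrable_norm_pow two_ne_zero)
      (s2.2.1.integrable_norm_pow two_ne_zero)]
    refine integral_congr_ae (Eventually.of_forall fun x => ?_)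
    simp only [norm_mul, norm_real, mul_pow, Real.norm_eq_abs, sq_abs]
    rw [← add_mul, Real.cos_sq_add_sin_sq, one_mul]
  · rw [← integral_add (s1.2.2.integrable_norm_pow two_ne_zero)
      (s2.2.2.integrable_norm_pow two_ne_zero), ← integral_const_mul,
      ← integral_add (hs.2.2.integrable_norm_pow two_ne_zero)
        ((hs.2.1.integrable_norm_pow two_ne_zero).const_mul _)]
    refine integral_mono ?_ ?_ fun x => ?_
    · exact (s1.2.2.integrable_norm_pow two_ne_zero).add (s2.2.2.integrable_norm_pow two_ne_zero)
    · exact (hs.2.2.integrable_norm_pow two_ne_zero).add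
        ((hs.2.1.integrable_norm_pow two_ne_zero).const_mul _)
    · simp only [Complex.sq_norm, normSq_apply, add_re, add_im, re_ofReal_mul, im_ofReal_mul]
      have h1 := Real.cos_sq_add_sin_sq (θ x)
      have h2 : θ' x ^ 2 ≤ c ^ 2 := by
        rw [← sq_abs]; exact pow_le_pow_left₀ (abs_nonneg _) (hc x) 2
      have h3 := mul_le_mul_of_nonneg_right h2
        (add_nonneg (mul_self_nonneg (Q x).re) (mul_self_nonneg (Q x).im))
      have e : ∀ C S t a b q r : ℝ, C ^ 2 + S ^ 2 = 1 →
          (C * a + -S * t * q) * (C * a + -S * t * q) + (C * b + -S * t * r) * (C * b + -S * t * r)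
          + ((S * a + C * t * q) * (S * a + C * t * q)
            + (S * b + C * t * r) * (S * b + C * t * r))
          = a * a + b * b + t ^ 2 * (q * q + r * r) := by
        intro C S t a b q r h
        linear_combination (a ^ 2 + b ^ 2 + t ^ 2 * (q ^ 2 + r ^ 2)) * h
      rw [e _ _ _ _ _ _ _ h1]
      linarith

/-- A localized function sees the mass only on its support, so three walls may be replaced there by
a single one. -/
lemma Sol.congr_mass {m m' : ℝ → ℝ} {F h : ℝ → ℂ} (hs : Sol m F h)
    (e : ∀ x, m x = m' x ∨ F x = 0) : Sol m' F h := by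
  refine ⟨hs.1.congr (Eventually.of_forall fun x => ?_), hs.2⟩
  rcases e x with h | h
  · simp only [h]
  · simp only [h, mul_zero]

lemma Sol.shift {m : ℝ → ℝ} {F h : ℝ → ℂ} (hs : Sol m F h) (c : ℝ) :
    Sol (fun x => m (x + c)) (fun x => F (x + c)) (fun x => h (x + c)) :=
  ⟨hs.1.comp_add c, hs.2.1.comp_measurePreserving (measurePreserving_add_right volume c),
    hs.2.2.comp_measurePreserving (measurePreserving_add_right volume c)⟩

lemma Sol.mem_opGraph {m : ℝ → ℝ} {hm : Continuous m} {F h : ℝ → ℂ} (hs : Sol m F h) :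
    (hs.2.1.toLp F, hs.2.2.toLp h) ∈ opGraph m hm :=
  hs.1.mem_opGraph _ _

section OneWall

variable {kinf : ℝ} {κ : ℝ → ℝ}

/-- The zero mode has only a `p`-component, hence the orthogonality condition concerns `p` alone.
Setting `p = 0` yields an unconditional gap for `∂ - κ`; setting `q = 0` yields the conditional gap
for `∂ + κ`. -/
lemma join_gap (hκ : IsDomainWall kinf κ) (hgap : SpectralGap kinf κ) (hk : 0 ≤ kinf)
    {hm : Continuous κ} {hm' : Continuous fun x => -κ x} {p g q h : L2C}
    (hp : (p, g) ∈ opGraph κ hm) (hq : (q, h) ∈ opGraph (fun x => -κ x) hm')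
    (ho : ∫ x, profile κ x • p x = 0) :
    kinf ^ 2 * (‖p‖ ^ 2 + ‖q‖ ^ 2) ≤ ‖g‖ ^ 2 + ‖h‖ ^ 2 := by
  obtain ⟨B, hB⟩ := hκ.exists_bound
  have hmem := mem_diracGraph_of_chiral hB hp hq
  rw [← diracOp_graph] at hmem
  obtain ⟨y, hy, hE⟩ := (diracOp κ).mem_graph_iff.mp hmem
  simp only at hy hE
  have hint : ∫ x, inner ℂ (zeroMode κ x) ((y : H) x) = 0 := by
    have e : ∫ x, inner ℂ (zeroMode κ x) ((y : H) x)
        = ∫ x, (gam κ : ℂ) * (profile κ x • p x) := by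
      refine integral_congr_ae ?_
      rw [hy]
      filter_upwards [coeFn_join p q] with x hx
      rw [hx, zeroMode, inner_smul_left, conj_ofReal, PiLp.inner_apply, Fin.sum_univ_two]
      simp only [RCLike.inner_apply, PiLp.add_apply, embP_zero, embQ_zero, embP_one, embQ_one,
        real_smul]
      simp
      linear_combination (-(gam κ : ℂ) * profile κ x * (p x - q x) / 2) * I_sq
    rw [e, integral_const_mul, ho, mul_zero]
  have h1 := pow_le_pow_left₀ (by positivity) (hgap y hint) 2
  rw [hE, hy, mul_pow, norm_sq_join, norm_sq_join, norm_smul, norm_smul, norm_I] at h1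
  linarith

lemma Sol.gap_neg (hκ : IsDomainWall kinf κ) (hgap : SpectralGap kinf κ) (hk : 0 ≤ kinf)
    {F h : ℝ → ℂ} (hs : Sol (fun x => -κ x) F h) :
    kinf ^ 2 * ∫ x, ‖F x‖ ^ 2 ≤ ∫ x, ‖h x‖ ^ 2 := by
  have hm := hκ.contDiff.continuous
  have := join_gap hκ hgap hk (hm := hm) (hm' := hm.neg) (Submodule.zero_mem _) hs.mem_opGraph
    (by
      rw [← integral_zero ℝ ℂ]
      refine integral_congr_ae ?_
      filter_upwards [Lp.coeFn_zero ℂ 2 (volume : Measure ℝ)] with x hx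
      simp only [hx, Pi.zero_apply, smul_zero])
  rw [norm_toLp_sq_eq_integral, norm_toLp_sq_eq_integral] at this
  simpa using this

lemma Sol.gap_pos (hκ : IsDomainWall kinf κ) (hgap : SpectralGap kinf κ) (hk : 0 ≤ kinf)
    {F h : ℝ → ℂ} (hs : Sol κ F h) (ho : ∫ x, profile κ x • F x = 0) :
    kinf ^ 2 * ∫ x, ‖F x‖ ^ 2 ≤ ∫ x, ‖h x‖ ^ 2 := by
  have hm := hκ.contDiff.continuous
  have := join_gap hκ hgap hk (hm := hm) (hm' := hm.neg) hs.mem_opGraph (Submodule.zero_mem _)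
    (by
      rw [← ho]
      exact integral_congr_ae (hs.2.1.coeFn_toLp.mono fun x hx => by simp only [hx]))
  rw [norm_toLp_sq_eq_integral, norm_toLp_sq_eq_integral] at this
  simpa using this

end OneWall

section ThreeWall

variable {kinf : ℝ} {κ : ℝ → ℝ} {δ : ℝ}

/-- The formula extends from `[δ, ∞)` down to `1`: on `[1, δ]` both `-κ x` and `κ (x - 2δ)` equal
`-κ∞`. The localization needs this overlap to let its cutoffs vary there. -/
lemma threeWall_of_one_le (hκ : IsDomainWall kinf κ) (hδ : 1 ≤ δ) {x : ℝ} (hx : 1 ≤ x) :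
    threeWall κ δ x = κ (x - 2 * δ) := by
  unfold threeWall
  rw [if_neg (by linarith)]
  split_ifs with h
  · rw [hκ.right x hx, hκ.left _ (by linarith)]
  · rfl

lemma threeWall_of_le_neg_one (hκ : IsDomainWall kinf κ) (hδ : 1 ≤ δ) {x : ℝ} (hx : x ≤ -1) :
    threeWall κ δ x = κ (x + 2 * δ) := by
  unfold threeWall
  split_ifs with h h'
  · rfl
  · rw [hκ.left x hx, hκ.right _ (by linarith), neg_neg]
  · linarith

lemma threeWall_of_abs_le (hκ : IsDomainWall kinf κ) (hδ : 1 ≤ δ) {x : ℝ} (h1 : -δ ≤ x)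
    (h2 : x ≤ δ) : threeWall κ δ x = -κ x := by
  rcases h1.eq_or_lt with h | h
  · rw [threeWall_of_le_neg_one hκ hδ (by linarith), ← h, ← hκ.odd]; congr 1; ring
  · unfold threeWall
    rw [if_neg (not_le.mpr h), if_pos h2]

lemma threeWall_odd (hκ : IsDomainWall kinf κ) (hδ : 1 ≤ δ) (x : ℝ) :
    threeWall κ δ (-x) = -threeWall κ δ x := by
  rcases le_total x (-1) with h | h
  · rw [threeWall_of_le_neg_one hκ hδ h, threeWall_of_one_le hκ hδ (by linarith), ← hκ.odd]
    congr 1; ring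
  rcases le_total 1 x with h' | h'
  · rw [threeWall_of_one_le hκ hδ h', threeWall_of_le_neg_one hκ hδ (by linarith), ← hκ.odd]
    congr 1; ring
  · rw [threeWall_of_abs_le hκ hδ (by linarith) (by linarith),
      threeWall_of_abs_le hκ hδ (by linarith) (by linarith), hκ.odd]

lemma threeWall_continuous (hκ : IsDomainWall kinf κ) (hδ : 1 ≤ δ) :
    Continuous (threeWall κ δ) := by
  have hc := hκ.contDiff.continuous
  unfold threeWall
  refine Continuous.if_le (by fun_prop) (Continuous.if_le (by fun_prop) (by fun_prop)
    continuous_id continuous_const ?_) continuous_id continuous_const ?_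
  · rintro x rfl
    rw [← hκ.odd]; congr 1; ring
  · rintro x rfl
    rw [if_pos (by linarith), ← hκ.odd]; congr 1; ring

/-- A mixing angle rising from `0` on `(-∞, 1]` to `π / 2` on `[δ, ∞)`. -/
def mixingAngle (kinf : ℝ) (κ : ℝ → ℝ) (δ x : ℝ) : ℝ :=
  Real.pi / 4 * (κ ((2 * x - (δ + 1)) / (δ - 1)) / kinf + 1)

lemma mixingAngle_left (hκ : IsDomainWall kinf κ) (hk : 0 < kinf) (hδ : 1 < δ) {x : ℝ}
    (hx : x ≤ 1) : mixingAngle kinf κ δ x = 0 := by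
  have : (2 * x - (δ + 1)) / (δ - 1) ≤ -1 := by
    rw [div_le_iff₀ (by linarith)]; linarith
  rw [mixingAngle, hκ.left _ this, neg_div, div_self hk.ne']; ring

lemma mixingAngle_right (hκ : IsDomainWall kinf κ) (hk : 0 < kinf) (hδ : 1 < δ) {x : ℝ}
    (hx : δ ≤ x) : mixingAngle kinf κ δ x = Real.pi / 2 := by
  have : 1 ≤ (2 * x - (δ + 1)) / (δ - 1) := by
    rw [le_div_iff₀ (by linarith)]; linarith
  rw [mixingAngle, hκ.right _ this, div_self hk.ne']; ring

lemma IsDomainWall.hasDerivAt (hκ : IsDomainWall kinf κ) (x : ℝ) :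
    HasDerivAt κ (deriv κ x) x :=
  (hκ.contDiff.differentiable (by simp) x).hasDerivAt

lemma IsDomainWall.continuous_deriv (hκ : IsDomainWall kinf κ) : Continuous (deriv κ) :=
  hκ.contDiff.continuous_deriv (by simp)

lemma IsDomainWall.deriv_eq_zero (hκ : IsDomainWall kinf κ) {x : ℝ} (hx : 1 < |x|) :
    deriv κ x = 0 := by
  rcases lt_abs.mp hx with h | h
  · have : κ =ᶠ[𝓝 x] fun _ => kinf := by
      filter_upwards [lt_mem_nhds h] with y hy using hκ.right y hy.le
    rw [this.deriv_eq, deriv_const]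
  · have : κ =ᶠ[𝓝 x] fun _ => -kinf := by
      filter_upwards [gt_mem_nhds (show x < -1 by linarith)] with y hy using hκ.left y hy.le
    rw [this.deriv_eq, deriv_const]

lemma IsDomainWall.exists_deriv_bound (hκ : IsDomainWall kinf κ) :
    ∃ C, 0 ≤ C ∧ ∀ x, |deriv κ x| ≤ C := by
  obtain ⟨B, hB⟩ := (isCompact_Icc (a := (-1 : ℝ)) (b := 1)).exists_bound_of_continuousOn
    hκ.continuous_deriv.continuousOn
  refine ⟨max B 0, le_max_right _ _, fun x => ?_⟩
  rcases le_or_gt |x| 1 with h | h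
  · exact (hB x (abs_le.mp h)).trans (le_max_left _ _)
  · rw [hκ.deriv_eq_zero h, abs_zero]; exact le_max_right _ _

lemma mixingAngle_hasDerivAt (hκ : IsDomainWall kinf κ) (x : ℝ) :
    HasDerivAt (mixingAngle kinf κ δ)
      (Real.pi / 4 * (deriv κ ((2 * x - (δ + 1)) / (δ - 1)) * (2 / (δ - 1)) / kinf)) x := by
  have h1 : HasDerivAt (fun x => (2 * x - (δ + 1)) / (δ - 1)) (2 / (δ - 1)) x := by
    simpa using (((hasDerivAt_id x).const_mul 2).sub_const (δ + 1)).div_const (δ - 1)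
  exact ((((hκ.hasDerivAt _).comp x h1).div_const kinf).add_const 1).const_mul _

/-- The cut-off central zero mode. -/
def trialCenter (kinf : ℝ) (κ : ℝ → ℝ) (δ x : ℝ) : ℝ :=
  profile κ x * (Real.cos (mixingAngle kinf κ δ (-x)) * Real.cos (mixingAngle kinf κ δ x))

lemma mixingAngle_continuous (hκ : IsDomainWall kinf κ) : Continuous (mixingAngle kinf κ δ) :=
  continuous_iff_continuousAt.mpr fun x => (mixingAngle_hasDerivAt hκ x).continuousAt

lemma trialCenter_continuous (hκ : IsDomainWall kinf κ) : Continuous (trialCenter kinf κ δ) := by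
  have h1 := profile_continuous hκ.contDiff.continuous
  have h2 := mixingAngle_continuous (δ := δ) hκ
  unfold trialCenter
  fun_prop

lemma trialCenter_hasCompactSupport (hκ : IsDomainWall kinf κ) (hk : 0 < kinf) (hδ : 1 < δ) :
    HasCompactSupport (trialCenter kinf κ δ) := by
  refine HasCompactSupport.intro (isCompact_Icc (a := -δ) (b := δ)) fun x hx => ?_
  rw [mem_Icc, not_and_or, not_le, not_le] at hx
  rcases hx with hx | hx
  · rw [trialCenter, mixingAngle_right hκ hk hδ (x := -x) (by linarith), Real.cos_pi_div_two]; ring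
  · rw [trialCenter, mixingAngle_right hκ hk hδ (x := x) (by linarith), Real.cos_pi_div_two]; ring

/-- IMS localization: up to an error `O(δ⁻²)`, the one-wall gap survives for three walls. -/
lemma Sol.gap_threeWall_aux (hκ : IsDomainWall kinf κ) (hgap : SpectralGap kinf κ) (hk : 0 < kinf)
    (hδ : 1 < δ) {c : ℝ}
    (hc : ∀ x, |Real.pi / 4 * (deriv κ ((2 * x - (δ + 1)) / (δ - 1)) * (2 / (δ - 1)) / kinf)| ≤ c)
    {Q h : ℝ → ℂ} (hs : Sol (fun x => -threeWall κ δ x) Q h)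
    (ho : ∫ x, trialCenter kinf κ δ x • Q x = 0) :
    kinf ^ 2 * ∫ x, ‖Q x‖ ^ 2 ≤ (∫ x, ‖h x‖ ^ 2) + 2 * c ^ 2 * ∫ x, ‖Q x‖ ^ 2 := by
  have hdc := hκ.continuous_deriv
  obtain ⟨h₁, h₂, s1, s2, e1, i1⟩ := hs.cos_sin (θ := mixingAngle kinf κ δ)
    (fun x => mixingAngle_hasDerivAt hκ x) (by fun_prop) hc
  obtain ⟨h₃, h₄, s3, s4, e2, i2⟩ := s1.cos_sin (θ := fun x => mixingAngle kinf κ δ (-x))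
    (fun x => (mixingAngle_hasDerivAt (δ := δ) hκ (-x)).comp x (hasDerivAt_neg x))
    (by fun_prop) (c := c) (fun x => by simpa using hc (-x))
  -- Right piece, supported in `x ≥ 1`: the mass is a translate of `-κ`, for which the gap needs no
  -- orthogonality. The left piece is the mirror image.
  have g2 := ((s2.congr_mass (m' := fun x => -κ (x - 2 * δ)) fun x => by
    rcases le_total x 1 with hx | hx
    · right; simp [mixingAngle_left hκ hk hδ hx]
    · left; rw [threeWall_of_one_le hκ hδ.le hx]).shift (2 * δ))
  simp only [add_sub_cancel_right] at g2
  have g2 := g2.gap_neg hκ hgap hk.le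
  rw [integral_add_right_eq_self (fun x => ‖h₂ x‖ ^ 2),
    integral_add_right_eq_self (fun x => ‖Real.sin (mixingAngle kinf κ δ x) * Q x‖ ^ 2)] at g2
  have g4 := ((s4.congr_mass (m' := fun x => -κ (x + 2 * δ)) fun x => by
    rcases le_total (-x) 1 with hx | hx
    · right; simp [mixingAngle_left hκ hk hδ hx]
    · left; rw [threeWall_of_le_neg_one hκ hδ.le (by linarith)]).shift (-(2 * δ)))
  simp only [neg_add_cancel_right] at g4
  have g4 := g4.gap_neg hκ hgap hk.le
  rw [integral_add_right_eq_self (fun x => ‖h₄ x‖ ^ 2),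
    integral_add_right_eq_self (fun x => ‖Real.sin (mixingAngle kinf κ δ (-x))
      * (Real.cos (mixingAngle kinf κ δ x) * Q x)‖ ^ 2)] at g4
  -- Central piece, supported in `[-δ, δ]`, where the mass is `κ`. The orthogonality required by the
  -- one-wall gap is exactly `ho`, since the cutoffs have been moved onto the zero mode in
  -- `trialCenter`.
  have g3 := (s3.congr_mass (m' := κ) fun x => by
    rcases le_total x (-δ) with hx | hx
    · right; simp [mixingAngle_right hκ hk hδ (show δ ≤ -x by linarith)]
    rcases le_total δ x with hx' | hx'
    · right; simp [mixingAngle_right hκ hk hδ hx']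
    · left; rw [threeWall_of_abs_le hκ hδ.le hx hx', neg_neg]).gap_pos hκ hgap hk.le (by
      rw [← ho]
      refine integral_congr_ae (Eventually.of_forall fun x => ?_)
      simp only [trialCenter, real_smul]; push_cast; ring)
  have n2 : 0 ≤ ∫ x, ‖Real.sin (mixingAngle kinf κ δ x) * Q x‖ ^ 2 :=
    integral_nonneg fun x => by positivity
  nlinarith [sq_nonneg c]

theorem exists_gap_threeWall (hκ : IsDomainWall kinf κ) (hgap : SpectralGap kinf κ)
    (hk : 0 < kinf) {K : ℝ} (hK : 0 ≤ K) (hKk : K < kinf) :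
    ∃ δ₁ : ℝ, 1 < δ₁ ∧ ∀ δ, δ₁ < δ → ∀ (hm' : Continuous fun x => -threeWall κ δ x),
      ∃ g : L2C, ∀ p ∈ opGraph (fun x => -threeWall κ δ x) hm',
        inner ℂ g p.1 = 0 → K * ‖p.1‖ ≤ ‖p.2‖ := by
  obtain ⟨C, C0, hC⟩ := hκ.exists_deriv_bound
  have hpi := Real.pi_pos
  -- `A / (δ - 1)` bounds the slope of the mixing angle. The value `r` is chosen so that the
  -- localization loss `2 r²` is exactly `κ∞² - K²`, and `δ > A / r + 2` brings the slope below `r`.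
  set A := Real.pi / 4 * (C * 2 / kinf) with hA
  have A0 : 0 ≤ A := by positivity
  have hgap2 : 0 < kinf ^ 2 - K ^ 2 := by nlinarith
  set r := Real.sqrt ((kinf ^ 2 - K ^ 2) / 2) with hr
  have r0 : 0 < r := Real.sqrt_pos.mpr (by positivity)
  have r2 : r ^ 2 = (kinf ^ 2 - K ^ 2) / 2 := Real.sq_sqrt (by positivity)
  refine ⟨A / r + 2, by have : 0 ≤ A / r := by positivity
                        linarith, fun δ hδ hm' => ?_⟩
  have hδ0 : 0 ≤ A / r := by positivity
  have hδ1 : 1 < δ := by linarith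
  refine ⟨(memLp_test (trialCenter_continuous hκ)
    (trialCenter_hasCompactSupport hκ hk hδ1)).toLp _, fun p hp ho => ?_⟩
  rw [inner_test (trialCenter_continuous hκ) (trialCenter_hasCompactSupport hκ hk hδ1)] at ho
  obtain ⟨Q, eQ, hQ⟩ := exists_isPrim_of_mem_opGraph hp
  have hs : Sol (fun x => -threeWall κ δ x) Q p.2 :=
    ⟨hQ, (memLp_congr_ae eQ).mp (Lp.memLp p.1), Lp.memLp p.2⟩
  have key := hs.gap_threeWall_aux hκ hgap hk hδ1 (c := r) (fun x => by
    have d0 : 0 < δ - 1 := by linarith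
    rw [abs_mul, abs_of_pos (by positivity : 0 < Real.pi / 4), abs_div, abs_mul, abs_of_pos hk,
      abs_of_pos (by positivity : 0 < 2 / (δ - 1))]
    calc Real.pi / 4 * (|deriv κ ((2 * x - (δ + 1)) / (δ - 1))| * (2 / (δ - 1)) / kinf)
        ≤ Real.pi / 4 * (C * (2 / (δ - 1)) / kinf) := by gcongr; exact hC _
      _ = A / (δ - 1) := by rw [hA]; field_simp
      _ ≤ r := by
        rw [div_le_iff₀ d0]
        have : A / r ≤ δ - 1 := by linarith
        rw [div_le_iff₀ r0] at this
        linarith) (by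
      rw [← ho]
      exact integral_congr_ae (eQ.mono fun x hx => by simp only [hx]))
  have e1 : ∫ x, ‖Q x‖ ^ 2 = ‖p.1‖ ^ 2 := by
    rw [norm_sq_eq_integral]
    exact integral_congr_ae (eQ.mono fun x hx => by simp only [hx])
  rw [e1, ← norm_sq_eq_integral, r2] at key
  refine abs_le_of_sq_le_sq' ?_ (norm_nonneg _) |>.2
  rw [mul_pow]
  linarith

end ThreeWall

end DomainWallDirac

end

/-! ### Exponential bounds for the one-wall and three-wall profiles -/

noncomputable section

namespace DomainWallDirac

open Filter Topology Set

lemma intervalIntegral_neg_of_odd {f : ℝ → ℝ} (hf : ∀ x, f (-x) = -f x) (x : ℝ) :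
    ∫ y in (0 : ℝ)..(-x), f y = ∫ y in (0 : ℝ)..x, f y := by
  have h := intervalIntegral.integral_comp_neg (fun y => f y) (a := 0) (b := x)
  simp only [hf, intervalIntegral.integral_neg, neg_zero] at h
  rw [intervalIntegral.integral_symm, ← h, neg_neg]

lemma profile_even {m : ℝ → ℝ} (hm : ∀ x, m (-x) = -m x) (x : ℝ) :
    profile m (-x) = profile m x := by
  rw [profile, profile, intervalIntegral_neg_of_odd hm]

lemma profile_abs {m : ℝ → ℝ} (hm : ∀ x, m (-x) = -m x) (x : ℝ) :
    profile m |x| = profile m x := by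
  rcases abs_choice x with h | h
  · rw [h]
  · rw [h, profile_even hm]

section OneWall

variable {kinf : ℝ} {κ : ℝ → ℝ}

lemma profile_of_one_le (hκ : IsDomainWall kinf κ) {x : ℝ} (hx : 1 ≤ x) :
    profile κ x = profile κ 1 * Real.exp (-kinf * (x - 1)) := by
  have hc := hκ.contDiff.continuous
  have h1 : ∫ y in (1 : ℝ)..x, κ y = kinf * (x - 1) := by
    rw [intervalIntegral.integral_congr (g := fun _ => kinf)]
    · simp [mul_comm]
    · intro y hy
      rw [uIcc_of_le hx] at hy
      exact hκ.right y hy.1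
  rw [profile, profile, ← Real.exp_add, ← intervalIntegral.integral_add_adjacent_intervals
    (hc.intervalIntegrable 0 1) (hc.intervalIntegrable 1 x), h1]
  congr 1; ring

/-- Two-sided exponential bounds for the one-wall profile. -/
def ProfileBound (kinf : ℝ) (κ : ℝ → ℝ) (b : ℝ) : Prop :=
  1 ≤ b ∧ ∀ x, profile κ x ≤ b * Real.exp (-kinf * |x|) ∧
    Real.exp (-kinf * |x|) ≤ b * profile κ x

lemma exists_profileBound (hκ : IsDomainWall kinf κ) : ∃ b : ℝ, ProfileBound kinf κ b := by
  have hc := profile_continuous hκ.contDiff.continuous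
  obtain ⟨b₁, h₁⟩ := (isCompact_Icc (a := (0 : ℝ)) (b := 1)).exists_bound_of_continuousOn
    (f := fun x => profile κ x * Real.exp (kinf * x)) (by fun_prop)
  obtain ⟨b₂, h₂⟩ := (isCompact_Icc (a := (0 : ℝ)) (b := 1)).exists_bound_of_continuousOn
    (f := fun x => (profile κ x)⁻¹ * Real.exp (-kinf * x))
    (by
      have : ∀ x, profile κ x ≠ 0 := fun x => (profile_pos κ x).ne'
      fun_prop (disch := simp [this]))
  set b := max 1 (max b₁ b₂) with hb
  have hb1 : b₁ ≤ b := (le_max_left _ _).trans (le_max_right _ _)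
  have hb2 : b₂ ≤ b := (le_max_right _ _).trans (le_max_right _ _)
  have hIcc : ∀ x ∈ Icc (0 : ℝ) 1, profile κ x ≤ b * Real.exp (-kinf * x) ∧
      Real.exp (-kinf * x) ≤ b * profile κ x := by
    intro x hx
    have g1 := (le_abs_self _).trans ((h₁ x hx).trans hb1)
    have g2 := (le_abs_self _).trans ((h₂ x hx).trans hb2)
    constructor
    · have e : Real.exp (kinf * x) * Real.exp (-kinf * x) = 1 := by
        rw [← Real.exp_add]; simp
      calc profile κ x = profile κ x * Real.exp (kinf * x) * Real.exp (-kinf * x) := by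
            rw [mul_assoc, e, mul_one]
        _ ≤ b * Real.exp (-kinf * x) := mul_le_mul_of_nonneg_right g1 (Real.exp_pos _).le
    · have hp := profile_pos κ x
      rw [inv_mul_eq_div, div_le_iff₀ hp] at g2
      exact g2
  refine ⟨b, le_max_left _ _, fun x => ?_⟩
  rw [← profile_abs hκ.odd]
  rcases le_total |x| 1 with h | h
  · exact hIcc _ ⟨abs_nonneg x, h⟩
  -- Beyond `1` the profile is a pure exponential, so the bounds at `1` propagate with the same
  -- constant.
  · obtain ⟨g1, g2⟩ := hIcc 1 ⟨zero_le_one, le_rfl⟩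
    have e : Real.exp (-kinf * |x|) = Real.exp (-kinf * 1) * Real.exp (-kinf * (|x| - 1)) := by
      rw [← Real.exp_add]; congr 1; ring
    rw [profile_of_one_le hκ h, e, ← mul_assoc, ← mul_assoc]
    exact ⟨by gcongr, by gcongr⟩

end OneWall

section Bumps

variable {k : ℝ}

lemma integrable_exp_neg_mul_abs (hk : 0 < k) :
    Integrable (fun x : ℝ => Real.exp (-k * |x|)) := by
  rw [← integrableOn_univ, ← Iic_union_Ioi (a := (0 : ℝ)), integrableOn_union]
  constructor
  · refine (integrableOn_exp_mul_Iic hk 0).congr_fun (fun x hx => ?_) measurableSet_Iic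
    simp only [abs_of_nonpos (mem_Iic.mp hx)]; congr 1; ring
  · refine (integrableOn_exp_mul_Ioi (neg_lt_zero.mpr hk) 0).congr_fun (fun x hx => ?_)
      measurableSet_Ioi
    simp only [abs_of_pos (mem_Ioi.mp hx)]

lemma integral_exp_neg_mul_abs (hk : 0 < k) : ∫ x : ℝ, Real.exp (-k * |x|) = 2 / k := by
  rw [integral_comp_abs (f := fun x => Real.exp (-k * x)),
    integral_exp_mul_Ioi (neg_lt_zero.mpr hk)]
  simp only [mul_zero, Real.exp_zero]; field_simp

/-- The sum of two exponential bumps centred at `±a`. -/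
def twoBumps (k a x : ℝ) : ℝ := Real.exp (-k * |x - a|) + Real.exp (-k * |x + a|)

lemma twoBumps_pos (k a x : ℝ) : 0 < twoBumps k a x := by unfold twoBumps; positivity

lemma twoBumps_sq_le (k a x : ℝ) :
    twoBumps k a x ^ 2 ≤ 2 * Real.exp (-(2 * k) * |x - a|) + 2 * Real.exp (-(2 * k) * |x + a|) := by
  have e : ∀ t, Real.exp (-(2 * k) * t) = Real.exp (-k * t) ^ 2 := fun t => by
    rw [← Real.exp_nat_mul]; congr 1; push_cast; ring
  rw [twoBumps, e, e]
  nlinarith [sq_nonneg (Real.exp (-k * |x - a|) - Real.exp (-k * |x + a|))]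

/-- The norm bound is independent of the separation `a`; this is how pointwise estimates become `L²`
estimates uniform in `δ`. -/
lemma memLp_of_le_twoBumps (hk : 0 < k) {a A : ℝ} {f : ℝ → ℂ} (hf : AEStronglyMeasurable f volume)
    (h : ∀ x, ‖f x‖ ≤ A * twoBumps k a x) :
    ∃ hm : MemLp f 2 (volume : Measure ℝ), ‖hm.toLp f‖ ≤ A * (2 / Real.sqrt k) := by
  have A0 : 0 ≤ A := by
    have := (norm_nonneg _).trans (h 0)
    exact nonneg_of_mul_nonneg_left this (twoBumps_pos _ _ _)
  have i0 := integrable_exp_neg_mul_abs (k := 2 * k) (by positivity)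
  have i1 := i0.comp_sub_right a
  have i2 := i0.comp_add_right a
  have hle : ∀ x, ‖f x‖ ^ 2 ≤ A ^ 2 * (2 * Real.exp (-(2 * k) * |x - a|)
      + 2 * Real.exp (-(2 * k) * |x + a|)) := fun x => by
    refine (pow_le_pow_left₀ (norm_nonneg _) (h x) 2).trans ?_
    rw [mul_pow]
    exact mul_le_mul_of_nonneg_left (twoBumps_sq_le _ _ _) (by positivity)
  have ib : Integrable fun x => A ^ 2 * (2 * Real.exp (-(2 * k) * |x - a|)
      + 2 * Real.exp (-(2 * k) * |x + a|)) := ((i1.const_mul 2).add (i2.const_mul 2)).const_mul _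
  have hm : MemLp f 2 (volume : Measure ℝ) := by
    rw [← memLp_norm_iff hf, memLp_two_iff_integrable_sq hf.norm]
    refine ib.mono' (hf.norm.pow 2) (Eventually.of_forall fun x => ?_)
    rw [Real.norm_eq_abs, abs_of_nonneg (by positivity)]
    exact hle x
  refine ⟨hm, ?_⟩
  refine abs_le_of_sq_le_sq' ?_ (by positivity) |>.2
  rw [norm_toLp_sq_eq_integral]
  calc ∫ x, ‖f x‖ ^ 2 ≤ _ := integral_mono (hm.integrable_norm_pow two_ne_zero) ib hle
    _ = (A * (2 / Real.sqrt k)) ^ 2 := by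
      rw [integral_const_mul, integral_add (i1.const_mul 2) (i2.const_mul 2), integral_const_mul,
        integral_const_mul, integral_sub_right_eq_self (fun x => Real.exp (-(2 * k) * |x|)),
        integral_add_right_eq_self (fun x => Real.exp (-(2 * k) * |x|)),
        integral_exp_neg_mul_abs (by positivity), mul_pow, div_pow, Real.sq_sqrt hk.le]
      field_simp; ring

end Bumps

section ThreeWallProfile

variable {kinf : ℝ} {κ : ℝ → ℝ} {δ : ℝ}

/-- The height `exp (2 ∫₀^δ κ)` of the three-wall profile at the outer walls. -/
def peak (κ : ℝ → ℝ) (δ : ℝ) : ℝ := (profile κ δ ^ 2)⁻¹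

lemma peak_pos (κ : ℝ → ℝ) (δ : ℝ) : 0 < peak κ δ := by
  have := profile_pos κ δ
  unfold peak; positivity

lemma profile_threeWall_center (hκ : IsDomainWall kinf κ) (hδ : 1 ≤ δ) {x : ℝ} (h1 : -δ ≤ x)
    (h2 : x ≤ δ) : profile (threeWall κ δ) x = (profile κ x)⁻¹ := by
  rw [← profile_neg_mass, profile, profile]
  congr 2
  refine intervalIntegral.integral_congr fun y hy => ?_
  have hy' := uIcc_subset_uIcc (a₁ := (0 : ℝ)) (b₁ := x) (a₂ := -δ) (b₂ := δ)
    (by rw [mem_uIcc]; left; constructor <;> linarith) (by rw [mem_uIcc]; left; exact ⟨h1, h2⟩) hy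
  rw [uIcc_of_le (by linarith)] at hy'
  exact threeWall_of_abs_le hκ hδ hy'.1 hy'.2

/-- Both factors are in their purely exponential range in this window and the exponents add up to a
constant, namely its value at the midpoint `x = δ`. -/
lemma profile_mul_reflect (hκ : IsDomainWall kinf κ) {x : ℝ} (h1 : 1 ≤ x)
    (h2 : x ≤ 2 * δ - 1) : profile κ x * profile κ (x - 2 * δ) = profile κ δ ^ 2 := by
  rw [← profile_even hκ.odd (x - 2 * δ), profile_of_one_le hκ h1,
    profile_of_one_le hκ (x := -(x - 2 * δ)) (by linarith),
    profile_of_one_le hκ (x := δ) (by linarith)]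
  have : Real.exp (-kinf * (x - 1)) * Real.exp (-kinf * (-(x - 2 * δ) - 1))
      = Real.exp (-kinf * (δ - 1)) ^ 2 := by
    rw [← Real.exp_add, ← Real.exp_nat_mul]; congr 1; push_cast; ring
  linear_combination (profile κ 1 ^ 2) * this

lemma profile_add_integral {m : ℝ → ℝ} (hm : Continuous m) (a x : ℝ) :
    profile m x = profile m a * Real.exp (-∫ y in a..x, m y) := by
  rw [profile, profile, ← Real.exp_add,
    ← intervalIntegral.integral_add_adjacent_intervals (hm.intervalIntegrable 0 a)
      (hm.intervalIntegrable a x)]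
  congr 1; ring

lemma profile_threeWall_right (hκ : IsDomainWall kinf κ) (hδ : 1 ≤ δ) {x : ℝ} (hx : 1 ≤ x) :
    profile (threeWall κ δ) x = peak κ δ * profile κ (x - 2 * δ) := by
  have hc := hκ.contDiff.continuous
  have e : ∫ y in (1 : ℝ)..x, threeWall κ δ y = ∫ y in (1 - 2 * δ)..(x - 2 * δ), κ y := by
    rw [← intervalIntegral.integral_comp_sub_right (fun y => κ y) (2 * δ)]
    refine intervalIntegral.integral_congr fun y hy => ?_
    rw [uIcc_of_le hx] at hy
    exact threeWall_of_one_le hκ hδ hy.1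
  have h1 := profile_pos κ 1
  have h2 := profile_pos κ δ
  have h3 := profile_pos κ (1 - 2 * δ)
  have key := profile_mul_reflect (δ := δ) hκ (x := 1) le_rfl (by linarith)
  rw [profile_add_integral (threeWall_continuous hκ hδ) 1 x, e,
    profile_threeWall_center hκ hδ (by linarith) hδ,
    profile_add_integral hc (1 - 2 * δ) (x - 2 * δ), peak, ← key]
  field_simp

/-- The central formula persists past `δ`, up to distance one from the outer wall; thus `1/u` equals
the central zero mode exactly on almost all of the interval between the walls. -/
lemma profile_threeWall_mid (hκ : IsDomainWall kinf κ) (hδ : 1 ≤ δ) {x : ℝ} (h0 : 0 ≤ x)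
    (hx : x ≤ 2 * δ - 1) : profile (threeWall κ δ) x = (profile κ x)⁻¹ := by
  rcases le_total x 1 with h | h
  · exact profile_threeWall_center hκ hδ (by linarith) (by linarith)
  · rw [profile_threeWall_right hκ hδ h, peak, ← profile_mul_reflect hκ h hx]
    have h1 := profile_pos κ x
    have h3 := profile_pos κ (x - 2 * δ)
    field_simp

lemma peak_bounds {b : ℝ} (hb : ProfileBound kinf κ b) (hδ : 1 ≤ δ) :
    peak κ δ ≤ b ^ 2 * Real.exp (2 * kinf * δ) ∧ Real.exp (2 * kinf * δ) ≤ b ^ 2 * peak κ δ := by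
  obtain ⟨h1, h2⟩ := hb.2 δ
  have hp := profile_pos κ δ
  rw [abs_of_nonneg (by linarith)] at h1 h2
  have e : Real.exp (2 * kinf * δ) * Real.exp (-kinf * δ) ^ 2 = 1 := by
    rw [← Real.exp_nat_mul, ← Real.exp_add, Real.exp_eq_one_iff]; push_cast; ring
  have g1 := pow_le_pow_left₀ hp.le h1 2
  have g2 := pow_le_pow_left₀ (Real.exp_pos _).le h2 2
  have hE := Real.exp_pos (2 * kinf * δ)
  rw [mul_pow] at g1 g2
  unfold peak
  constructor
  · rw [inv_le_iff_one_le_mul₀ (by positivity), ← e]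
    nlinarith
  · rw [← div_eq_mul_inv, le_div_iff₀ (by positivity)]
    nlinarith

/-- Two-sided exponential bounds for the three-wall profile on the right half-line. -/
lemma profile_threeWall_bounds (hκ : IsDomainWall kinf κ) {b : ℝ} (hb : ProfileBound kinf κ b)
    (hδ : 1 ≤ δ) {x : ℝ} (hx : 0 ≤ x) :
    profile (threeWall κ δ) x ≤ b ^ 3 * (peak κ δ * Real.exp (-kinf * |x - 2 * δ|)) ∧
    peak κ δ * Real.exp (-kinf * |x - 2 * δ|) ≤ b ^ 3 * profile (threeWall κ δ) x := by
  obtain ⟨hb1, hb'⟩ := hb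
  have hU := peak_pos κ δ
  have b3 : b ≤ b ^ 3 := le_self_pow₀ hb1 (by norm_num)
  rcases le_total 1 x with h | h
  · rw [profile_threeWall_right hκ hδ h]
    obtain ⟨h1, h2⟩ := hb' (x - 2 * δ)
    have hp := profile_pos κ (x - 2 * δ)
    have hE := Real.exp_pos (-kinf * |x - 2 * δ|)
    constructor
    · calc _ ≤ peak κ δ * (b * Real.exp (-kinf * |x - 2 * δ|)) := by gcongr
        _ = b * (peak κ δ * Real.exp (-kinf * |x - 2 * δ|)) := by ring
        _ ≤ _ := by gcongr
    · calc _ ≤ peak κ δ * (b * profile κ (x - 2 * δ)) := by gcongr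
        _ = b * (peak κ δ * profile κ (x - 2 * δ)) := by ring
        _ ≤ _ := by gcongr
  · rw [profile_threeWall_center hκ hδ (by linarith) (by linarith)]
    obtain ⟨h1, h2⟩ := hb' x
    obtain ⟨h3, h4⟩ := peak_bounds ⟨hb1, hb'⟩ hδ
    have hp := profile_pos κ x
    have e : Real.exp (-kinf * |x - 2 * δ|) * Real.exp (2 * kinf * δ) * Real.exp (-kinf * |x|)
        = 1 := by
      rw [abs_of_nonneg hx, abs_of_nonpos (by linarith), ← Real.exp_add, ← Real.exp_add,
        Real.exp_eq_one_iff]; ring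
    set E1 := Real.exp (-kinf * |x - 2 * δ|) with hE1
    set E2 := Real.exp (2 * kinf * δ)
    set E3 := Real.exp (-kinf * |x|)
    have p1 : 0 < E1 := Real.exp_pos _
    have p2 : 0 < E2 := Real.exp_pos _
    have p3 : 0 < E3 := Real.exp_pos _
    constructor
    · rw [inv_le_iff_one_le_mul₀ hp, ← e]
      calc E1 * E2 * E3 ≤ E1 * (b ^ 2 * peak κ δ) * (b * profile κ x) := by gcongr
        _ = _ := by ring
    · rw [← div_eq_mul_inv, le_div_iff₀ hp]
      calc peak κ δ * E1 * profile κ x ≤ (b ^ 2 * E2) * E1 * (b * E3) := by gcongr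
        _ = b ^ 3 * (E1 * E2 * E3) := by ring
        _ = b ^ 3 := by rw [e, mul_one]

end ThreeWallProfile

end DomainWallDirac

end

/-! ### The trial functions and their pointwise approximation -/

noncomputable section

namespace DomainWallDirac

open Filter Topology Set

section Trial

variable {kinf : ℝ} {κ : ℝ → ℝ} {δ : ℝ}

/-- The density `(κ / κ∞) u²`, where `u` is the three-wall profile. -/
def trialDensity (kinf : ℝ) (κ : ℝ → ℝ) (δ x : ℝ) : ℝ :=
  κ x / kinf * profile (threeWall κ δ) x ^ 2

/-- The mass of the trial density on the right half-line. -/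
def trialMass (kinf : ℝ) (κ : ℝ → ℝ) (δ : ℝ) : ℝ := ∫ x in Ioi (0 : ℝ), trialDensity kinf κ δ x

/-- The trial function for the second chiral component. -/
def trialQ (kinf : ℝ) (κ : ℝ → ℝ) (δ x : ℝ) : ℝ :=
  (profile (threeWall κ δ) x)⁻¹ *
    (trialMass kinf κ δ - ∫ y in (0 : ℝ)..x, trialDensity kinf κ δ y)

/-- The trial function for the first chiral component. -/
def trialP (kinf : ℝ) (κ : ℝ → ℝ) (δ x : ℝ) : ℝ := κ x / kinf * profile (threeWall κ δ) x

lemma trialDensity_continuous (hκ : IsDomainWall kinf κ) (hδ : 1 ≤ δ) :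
    Continuous (trialDensity kinf κ δ) := by
  have h1 := hκ.contDiff.continuous
  have h2 := profile_continuous (threeWall_continuous hκ hδ)
  unfold trialDensity
  fun_prop

lemma trialDensity_odd (hκ : IsDomainWall kinf κ) (hδ : 1 ≤ δ) (x : ℝ) :
    trialDensity kinf κ δ (-x) = -trialDensity kinf κ δ x := by
  rw [trialDensity, trialDensity, hκ.odd, profile_even (threeWall_odd hκ hδ)]; ring

lemma trialQ_even (hκ : IsDomainWall kinf κ) (hδ : 1 ≤ δ) (x : ℝ) :
    trialQ kinf κ δ (-x) = trialQ kinf κ δ x := by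
  rw [trialQ, trialQ, profile_even (threeWall_odd hκ hδ),
    intervalIntegral_neg_of_odd (trialDensity_odd hκ hδ)]

/-- Variation of constants for `G' - m G = -Y`. The constant `trialMass` is the one that compensates
the growth of `1/u` at `+∞`; since the density is odd, it also works at `-∞`. -/
lemma trialQ_hasDerivAt (hκ : IsDomainWall kinf κ) (hδ : 1 ≤ δ) (x : ℝ) :
    HasDerivAt (trialQ kinf κ δ)
      (threeWall κ δ x * trialQ kinf κ δ x - trialP kinf κ δ x) x := by
  have hc := threeWall_continuous hκ hδ
  have h1 := (profile_hasDerivAt hc x).inv (profile_pos _ x).ne'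
  have h2 := ((trialDensity_continuous hκ hδ).integral_hasStrictDerivAt 0 x).hasDerivAt.const_sub
    (trialMass kinf κ δ)
  have hp := (profile_pos (threeWall κ δ) x).ne'
  refine (h1.mul h2).congr_deriv ?_
  simp only [trialQ, trialP, trialDensity, Pi.inv_apply]
  field_simp
  ring

/-- As `u` solves the homogeneous equation, only the derivative of the factor `κ/κ∞`, an odd step
between the signs of the two outer modes, survives as residual. -/
lemma trialP_hasDerivAt (hκ : IsDomainWall kinf κ) (hδ : 1 ≤ δ) (x : ℝ) :
    HasDerivAt (trialP kinf κ δ) (deriv κ x / kinf * profile (threeWall κ δ) x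
      - threeWall κ δ x * trialP kinf κ δ x) x := by
  have h1 := ((hκ.hasDerivAt x).div_const kinf).mul
    (profile_hasDerivAt (threeWall_continuous hκ hδ) x)
  refine h1.congr_deriv ?_
  simp only [trialP]; ring

lemma exists_cutoff_bound (hκ : IsDomainWall kinf κ) (hk : 0 < kinf) :
    ∃ X : ℝ, 0 ≤ X ∧ ∀ x, |κ x / kinf| ≤ X := by
  obtain ⟨B, hB⟩ := hκ.exists_bound
  refine ⟨B / kinf, div_nonneg ((abs_nonneg _).trans (hB 0)) hk.le, fun x => ?_⟩
  rw [abs_div, abs_of_pos hk]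
  have := hB x
  gcongr

lemma abs_trialDensity_le (hκ : IsDomainWall kinf κ) {b : ℝ} (hb : ProfileBound kinf κ b)
    {X : ℝ} (X0 : 0 ≤ X) (hX : ∀ x, |κ x / kinf| ≤ X) (hδ : 1 ≤ δ) {x : ℝ} (hx : 0 ≤ x) :
    |trialDensity kinf κ δ x|
      ≤ X * (b ^ 3 * peak κ δ) ^ 2 * Real.exp (-(2 * kinf) * |x - 2 * δ|) := by
  have h1 := (profile_threeWall_bounds hκ hb hδ hx).1
  have e : Real.exp (-(2 * kinf) * |x - 2 * δ|) = Real.exp (-kinf * |x - 2 * δ|) ^ 2 := by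
    rw [← Real.exp_nat_mul]; congr 1; push_cast; ring
  have hp := profile_pos (threeWall κ δ) x
  rw [trialDensity, abs_mul, abs_of_nonneg (by positivity : 0 ≤ profile (threeWall κ δ) x ^ 2), e,
    mul_assoc, ← mul_pow, mul_assoc (b ^ 3)]
  have := hX x
  gcongr

lemma integrableOn_trialDensity (hκ : IsDomainWall kinf κ) (hk : 0 < kinf) (hδ : 1 ≤ δ) :
    IntegrableOn (trialDensity kinf κ δ) (Ioi 0) := by
  obtain ⟨b, hb⟩ := exists_profileBound hκ
  obtain ⟨X, X0, hX⟩ := exists_cutoff_bound hκ hk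
  have i0 := ((integrable_exp_neg_mul_abs (k := 2 * kinf) (by positivity)).comp_sub_right
    (2 * δ)).const_mul (X * (b ^ 3 * peak κ δ) ^ 2)
  refine i0.integrableOn.mono' (trialDensity_continuous hκ hδ).aestronglyMeasurable ?_
  filter_upwards [ae_restrict_mem measurableSet_Ioi] with x hx
  exact abs_trialDensity_le hκ hb X0 hX hδ (le_of_lt hx)

lemma abs_trialMass_le (hκ : IsDomainWall kinf κ) (hk : 0 < kinf) {b : ℝ}
    (hb : ProfileBound kinf κ b) {X : ℝ} (X0 : 0 ≤ X) (hX : ∀ x, |κ x / kinf| ≤ X) (hδ : 1 ≤ δ) :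
    |trialMass kinf κ δ| ≤ X * (b ^ 3 * peak κ δ) ^ 2 / kinf := by
  have i0 := ((integrable_exp_neg_mul_abs (k := 2 * kinf) (by positivity)).comp_sub_right
    (2 * δ)).const_mul (X * (b ^ 3 * peak κ δ) ^ 2)
  calc |trialMass kinf κ δ|
      ≤ ∫ x in Ioi (0 : ℝ),
          X * (b ^ 3 * peak κ δ) ^ 2 * Real.exp (-(2 * kinf) * |x - 2 * δ|) := by
        rw [← Real.norm_eq_abs]
        refine norm_integral_le_of_norm_le i0.integrableOn ?_
        filter_upwards [ae_restrict_mem measurableSet_Ioi] with x hx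
        exact abs_trialDensity_le hκ hb X0 hX hδ (le_of_lt hx)
    _ ≤ ∫ x, X * (b ^ 3 * peak κ δ) ^ 2 * Real.exp (-(2 * kinf) * |x - 2 * δ|) :=
        setIntegral_le_integral i0 (Eventually.of_forall fun x => by positivity)
    _ = X * (b ^ 3 * peak κ δ) ^ 2 / kinf := by
        rw [integral_const_mul, integral_sub_right_eq_self
          (fun x => Real.exp (-(2 * kinf) * |x|)), integral_exp_neg_mul_abs (by positivity)]
        field_simp

lemma abs_integral_trialDensity_le (hκ : IsDomainWall kinf κ) (hk : 0 < kinf) {b : ℝ}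
    (hb : ProfileBound kinf κ b) {X : ℝ} (X0 : 0 ≤ X) (hX : ∀ x, |κ x / kinf| ≤ X) (hδ : 1 ≤ δ)
    {x : ℝ} (hx : 0 ≤ x) :
    |∫ y in (0 : ℝ)..x, trialDensity kinf κ δ y|
      ≤ X * (b ^ 3 * peak κ δ) ^ 2 * (Real.exp (2 * kinf * (x - 2 * δ)) / (2 * kinf)) := by
  have i0 := ((integrableOn_exp_mul_Iic (a := 2 * kinf) (by positivity) x).const_mul
    (X * (b ^ 3 * peak κ δ) ^ 2 * Real.exp (2 * kinf * (-(2 * δ)))))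
  have hE : ∀ y, X * (b ^ 3 * peak κ δ) ^ 2 * Real.exp (2 * kinf * (-(2 * δ)))
      * Real.exp (2 * kinf * y)
      = X * (b ^ 3 * peak κ δ) ^ 2 * Real.exp (2 * kinf * (y - 2 * δ)) := fun y => by
    rw [mul_assoc, ← Real.exp_add]; congr 2; ring
  rw [intervalIntegral.integral_of_le hx]
  calc |∫ y in Ioc 0 x, trialDensity kinf κ δ y|
      ≤ ∫ y in Ioc 0 x, X * (b ^ 3 * peak κ δ) ^ 2 * Real.exp (2 * kinf * (-(2 * δ)))
          * Real.exp (2 * kinf * y) := by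
        rw [← Real.norm_eq_abs]
        refine norm_integral_le_of_norm_le (IntegrableOn.mono_set i0 Ioc_subset_Iic_self) ?_
        filter_upwards [ae_restrict_mem measurableSet_Ioc] with y hy
        refine (abs_trialDensity_le hκ hb X0 hX hδ hy.1.le).trans ?_
        rw [hE]
        refine mul_le_mul_of_nonneg_left (Real.exp_le_exp.mpr ?_) (by positivity)
        rw [neg_mul, ← mul_neg]
        exact mul_le_mul_of_nonneg_left (neg_abs_le _) (by positivity)
    _ ≤ ∫ y in Iic x, X * (b ^ 3 * peak κ δ) ^ 2 * Real.exp (2 * kinf * (-(2 * δ)))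
          * Real.exp (2 * kinf * y) :=
        setIntegral_mono_set i0 (Eventually.of_forall fun y => by positivity)
          (LE.le.eventuallyLE Ioc_subset_Iic_self)
    _ = _ := by
        rw [integral_const_mul, integral_exp_mul_Iic (by positivity), ← mul_div_assoc, hE,
          mul_div_assoc]

lemma abs_trialMass_sub_integral_le (hκ : IsDomainWall kinf κ) (hk : 0 < kinf) {b : ℝ}
    (hb : ProfileBound kinf κ b) {X : ℝ} (X0 : 0 ≤ X) (hX : ∀ x, |κ x / kinf| ≤ X) (hδ : 1 ≤ δ)
    {x : ℝ} (hx : 0 ≤ x) :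
    |trialMass kinf κ δ - ∫ y in (0 : ℝ)..x, trialDensity kinf κ δ y|
      ≤ X * (b ^ 3 * peak κ δ) ^ 2 * (Real.exp (-(2 * kinf) * (x - 2 * δ)) / (2 * kinf)) := by
  have hi := integrableOn_trialDensity hκ hk hδ
  have hsplit : trialMass kinf κ δ - ∫ y in (0 : ℝ)..x, trialDensity kinf κ δ y
      = ∫ y in Ioi x, trialDensity kinf κ δ y := by
    rw [trialMass, ← intervalIntegral.integral_interval_add_Ioi hi
      (hi.mono_set (Ioi_subset_Ioi hx))]
    ring
  have hneg : -(2 * kinf) < 0 := by linarith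
  have i0 := ((integrableOn_exp_mul_Ioi hneg x).const_mul
    (X * (b ^ 3 * peak κ δ) ^ 2 * Real.exp (-(2 * kinf) * (-(2 * δ)))))
  have hE : ∀ y, X * (b ^ 3 * peak κ δ) ^ 2 * Real.exp (-(2 * kinf) * (-(2 * δ)))
      * Real.exp (-(2 * kinf) * y)
      = X * (b ^ 3 * peak κ δ) ^ 2 * Real.exp (-(2 * kinf) * (y - 2 * δ)) := fun y => by
    rw [mul_assoc, ← Real.exp_add]; congr 2; ring
  rw [hsplit]
  calc |∫ y in Ioi x, trialDensity kinf κ δ y|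
      ≤ ∫ y in Ioi x, X * (b ^ 3 * peak κ δ) ^ 2 * Real.exp (-(2 * kinf) * (-(2 * δ)))
          * Real.exp (-(2 * kinf) * y) := by
        rw [← Real.norm_eq_abs]
        refine norm_integral_le_of_norm_le i0 ?_
        filter_upwards [ae_restrict_mem measurableSet_Ioi] with y hy
        refine (abs_trialDensity_le hκ hb X0 hX hδ (hx.trans (le_of_lt hy))).trans ?_
        rw [hE]
        refine mul_le_mul_of_nonneg_left (Real.exp_le_exp.mpr ?_) (by positivity)
        exact mul_le_mul_of_nonpos_left (le_abs_self _) hneg.le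
    _ = _ := by
        rw [integral_const_mul, integral_exp_mul_Ioi hneg, neg_div_neg_eq, ← mul_div_assoc, hE,
          mul_div_assoc]

/-- The trial function `trialQ` is the one-wall profile up to a relative error `O(e^{-2κ∞δ})`. -/
lemma exists_trialQ_bound (hκ : IsDomainWall kinf κ) (hk : 0 < kinf) :
    ∃ C : ℝ, ∀ δ, 1 ≤ δ → ∀ x,
      |trialQ kinf κ δ x - trialMass kinf κ δ * profile κ x|
        ≤ C * peak κ δ * twoBumps kinf (2 * δ) x := by
  obtain ⟨b, hb⟩ := exists_profileBound hκ
  obtain ⟨X, X0, hX⟩ := exists_cutoff_bound hκ hk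
  have hb1 := hb.1
  have hb0 : 0 < b := by linarith
  set C1 := X * b ^ 15 / (2 * kinf) with hC1
  set C2 := X * b ^ 9 * Real.exp (4 * kinf) / (2 * kinf) + X * b ^ 9 * Real.exp (2 * kinf) / kinf
    with hC2
  have C10 : 0 ≤ C1 := by positivity
  have C20 : 0 ≤ C2 := by positivity
  refine ⟨C1 + C2, fun δ hδ x => ?_⟩
  have hU := peak_pos κ δ
  have half : ∀ x, 0 ≤ x → |trialQ kinf κ δ x - trialMass kinf κ δ * profile κ x|
      ≤ (C1 + C2) * peak κ δ * Real.exp (-kinf * |x - 2 * δ|) := by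
    intro x hx
    obtain ⟨u1, u2⟩ := profile_threeWall_bounds hκ hb hδ hx
    have hu := profile_pos (threeWall κ δ) x
    -- Up to `2δ - 1` one has `1/u = profile κ`, so the mass terms cancel exactly and only the
    -- partial integral remains. Beyond that point both terms are separately of size `U e^{-κ∞|x -
    -- 2δ|}`.
    rcases le_total x (2 * δ - 1) with h | h
    · have hP := profile_threeWall_mid hκ hδ hx h
      have e0 : trialQ kinf κ δ x - trialMass kinf κ δ * profile κ x
          = -((profile (threeWall κ δ) x)⁻¹ * ∫ y in (0 : ℝ)..x, trialDensity kinf κ δ y) := by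
        rw [trialQ, hP, inv_inv]; ring
      have hG := abs_integral_trialDensity_le hκ hk hb X0 hX hδ hx
      have e1 : Real.exp (2 * kinf * (x - 2 * δ)) = Real.exp (-kinf * |x - 2 * δ|) ^ 2 := by
        rw [abs_of_nonpos (by linarith), ← Real.exp_nat_mul]; congr 1; push_cast; ring
      rw [e0, abs_neg, abs_mul, abs_inv, abs_of_pos hu, inv_mul_le_iff₀ hu]
      rw [e1] at hG
      set E := Real.exp (-kinf * |x - 2 * δ|)
      have hE : 0 < E := Real.exp_pos _
      set u := profile (threeWall κ δ) x
      calc _ ≤ X * (b ^ 3 * peak κ δ) ^ 2 * (E ^ 2 / (2 * kinf)) := hG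
        _ = X * b ^ 6 / (2 * kinf) * (peak κ δ * E) * (peak κ δ * E) := by ring
        _ ≤ X * b ^ 6 / (2 * kinf) * (b ^ 3 * u) * (peak κ δ * E) := by gcongr
        _ = X * b ^ 9 / (2 * kinf) * (u * (peak κ δ * E)) := by ring
        _ ≤ C1 * (u * (peak κ δ * E)) := by
          rw [hC1]; gcongr; norm_num
        _ ≤ (C1 + C2) * (u * (peak κ δ * E)) := by gcongr; linarith
        _ = u * ((C1 + C2) * peak κ δ * E) := by ring
    · have hT := abs_trialMass_sub_integral_le hκ hk hb X0 hX hδ hx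
      have hN := abs_trialMass_le hκ hk hb X0 hX hδ
      have hPx := (hb.2 x).1
      have hPp := profile_pos κ x
      have hUb := (peak_bounds hb hδ).1
      -- Here `x` may lie up to one unit to the left of the wall at `2δ`, which costs a factor
      -- `e^{2κ∞}`.
      have sh : -kinf * (x - 2 * δ) ≤ 2 * kinf + -kinf * |x - 2 * δ| := by
        rcases le_total 0 (x - 2 * δ) with h0 | h0
        · rw [abs_of_nonneg h0]; linarith
        · rw [abs_of_nonpos h0]; nlinarith
      set E := Real.exp (-kinf * |x - 2 * δ|) with hEdef
      have hE : 0 < E := Real.exp_pos _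
      have e1 : Real.exp (-(2 * kinf) * (x - 2 * δ)) ≤ Real.exp (4 * kinf) * E ^ 2 := by
        rw [hEdef, ← Real.exp_nat_mul, ← Real.exp_add]
        apply Real.exp_le_exp.mpr
        push_cast; linarith
      have e2 : Real.exp (-kinf * |x|) * Real.exp (2 * kinf * δ) ≤ Real.exp (2 * kinf) * E := by
        rw [hEdef, ← Real.exp_add, ← Real.exp_add, abs_of_nonneg hx]
        apply Real.exp_le_exp.mpr
        linarith
      have b1 : |trialQ kinf κ δ x|
          ≤ X * b ^ 9 * Real.exp (4 * kinf) / (2 * kinf) * (peak κ δ * E) := by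
        rw [trialQ, abs_mul, abs_inv, abs_of_pos hu, inv_mul_le_iff₀ hu]
        set u := profile (threeWall κ δ) x
        calc _ ≤ X * (b ^ 3 * peak κ δ) ^ 2 *
              (Real.exp (-(2 * kinf) * (x - 2 * δ)) / (2 * kinf)) := hT
          _ ≤ X * (b ^ 3 * peak κ δ) ^ 2 * (Real.exp (4 * kinf) * E ^ 2 / (2 * kinf)) := by
            gcongr
          _ = X * b ^ 6 * Real.exp (4 * kinf) / (2 * kinf) * (peak κ δ * E)
              * (peak κ δ * E) := by ring
          _ ≤ X * b ^ 6 * Real.exp (4 * kinf) / (2 * kinf) * (b ^ 3 * u)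
              * (peak κ δ * E) := by gcongr
          _ = _ := by ring
      have b2 : |trialMass kinf κ δ * profile κ x|
          ≤ X * b ^ 9 * Real.exp (2 * kinf) / kinf * (peak κ δ * E) := by
        rw [abs_mul, abs_of_pos hPp]
        calc |trialMass kinf κ δ| * profile κ x
            ≤ (X * (b ^ 3 * peak κ δ) ^ 2 / kinf) * (b * Real.exp (-kinf * |x|)) := by gcongr
          _ = X * b ^ 7 / kinf * peak κ δ * (peak κ δ * Real.exp (-kinf * |x|)) := by ring
          _ ≤ X * b ^ 7 / kinf * peak κ δ *
              (b ^ 2 * Real.exp (2 * kinf * δ) * Real.exp (-kinf * |x|)) := by gcongr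
          _ = X * b ^ 9 / kinf * peak κ δ *
              (Real.exp (-kinf * |x|) * Real.exp (2 * kinf * δ)) := by ring
          _ ≤ X * b ^ 9 / kinf * peak κ δ * (Real.exp (2 * kinf) * E) := by gcongr
          _ = _ := by ring
      calc _ ≤ |trialQ kinf κ δ x| + |trialMass kinf κ δ * profile κ x| := abs_sub _ _
        _ ≤ C2 * (peak κ δ * E) := by rw [hC2, add_mul]; exact add_le_add b1 b2
        _ ≤ (C1 + C2) * (peak κ δ * E) := by gcongr; linarith
        _ = _ := by ring
  rcases le_total 0 x with h | h
  · refine (half x h).trans ?_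
    gcongr
    unfold twoBumps
    linarith [Real.exp_pos (-kinf * |x + 2 * δ|)]
  · have := half (-x) (by linarith)
    rw [trialQ_even hκ hδ, profile_even hκ.odd] at this
    refine this.trans ?_
    gcongr
    unfold twoBumps
    rw [show |-x - 2 * δ| = |x + 2 * δ| by rw [← abs_neg]; congr 1; ring]
    linarith [Real.exp_pos (-kinf * |x - 2 * δ|)]

/-- The trial function `trialP` is the difference of the shifted one-wall profiles up to a
relative error `O(e^{-2κ∞δ})`. -/
lemma exists_trialP_bound (hκ : IsDomainWall kinf κ) (hk : 0 < kinf) :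
    ∃ C : ℝ, ∀ δ, 1 ≤ δ → ∀ x,
      |trialP kinf κ δ x - peak κ δ * (profile κ (x - 2 * δ) - profile κ (x + 2 * δ))|
        ≤ C * twoBumps kinf 0 x := by
  obtain ⟨b, hb⟩ := exists_profileBound hκ
  obtain ⟨X, X0, hX⟩ := exists_cutoff_bound hκ hk
  have hb1 := hb.1
  have hb0 : 0 < b := by linarith
  set C1 := (X * b + b ^ 3) * Real.exp (2 * kinf) + b ^ 3 with hC1
  have C10 : 0 ≤ C1 := by positivity
  refine ⟨C1, fun δ hδ x => ?_⟩
  have hU := peak_pos κ δ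
  have hUb := (peak_bounds hb hδ).1
  have half : ∀ x, 0 ≤ x →
      |trialP kinf κ δ x - peak κ δ * (profile κ (x - 2 * δ) - profile κ (x + 2 * δ))|
        ≤ C1 * Real.exp (-kinf * |x|) := by
    intro x hx
    have hR : peak κ δ * profile κ (x + 2 * δ) ≤ b ^ 3 * Real.exp (-kinf * |x|) := by
      have h1 := (hb.2 (x + 2 * δ)).1
      rw [abs_of_nonneg (by linarith)] at h1
      rw [abs_of_nonneg hx]
      calc _ ≤ (b ^ 2 * Real.exp (2 * kinf * δ)) * (b * Real.exp (-kinf * (x + 2 * δ))) := by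
            gcongr
            exact (profile_pos _ _).le
        _ = b ^ 3 * (Real.exp (2 * kinf * δ) * Real.exp (-kinf * (x + 2 * δ))) := by ring
        _ = _ := by rw [← Real.exp_add]; congr 2; ring
    have hR0 : 0 ≤ peak κ δ * profile κ (x + 2 * δ) := (mul_pos hU (profile_pos _ _)).le
    -- For `x ≥ 1` the cutoff is one and the right profile is matched exactly, so the error is the
    -- tail of the left profile. On `[0, 1]` all three terms are individually `O(1)`.
    rcases le_total 1 x with h | h
    · have e0 : trialP kinf κ δ x - peak κ δ * (profile κ (x - 2 * δ) - profile κ (x + 2 * δ))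
          = peak κ δ * profile κ (x + 2 * δ) := by
        rw [trialP, profile_threeWall_right hκ hδ h, hκ.right x h, div_self hk.ne']; ring
      rw [e0, abs_of_nonneg hR0]
      refine hR.trans ?_
      gcongr
      rw [hC1]
      have : 0 ≤ (X * b + b ^ 3) * Real.exp (2 * kinf) := by positivity
      linarith
    · have hu := profile_threeWall_center hκ hδ (x := x) (by linarith) (by linarith)
      have hPp := profile_pos κ x
      have g1 : |trialP kinf κ δ x| ≤ X * b * (Real.exp (2 * kinf) * Real.exp (-kinf * |x|)) := by
        rw [trialP, hu, abs_mul, abs_inv, abs_of_pos hPp]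
        have h2 : (profile κ x)⁻¹ ≤ b * (Real.exp (2 * kinf) * Real.exp (-kinf * |x|)) := by
          rw [inv_le_iff_one_le_mul₀ hPp]
          have e : (1 : ℝ) ≤ Real.exp (2 * kinf) * Real.exp (-kinf * |x|) * Real.exp (-kinf * |x|)
              := by
            rw [← Real.exp_add, ← Real.exp_add, abs_of_nonneg hx]
            apply Real.one_le_exp
            nlinarith
          calc (1 : ℝ) ≤ Real.exp (2 * kinf) * Real.exp (-kinf * |x|) * Real.exp (-kinf * |x|) := e
            _ ≤ Real.exp (2 * kinf) * Real.exp (-kinf * |x|) * (b * profile κ x) := by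
              gcongr; exact (hb.2 x).2
            _ = _ := by ring
        calc _ ≤ X * (b * (Real.exp (2 * kinf) * Real.exp (-kinf * |x|))) := by
              have := hX x
              gcongr
          _ = _ := by ring
      have g2 : peak κ δ * profile κ (x - 2 * δ)
          ≤ b ^ 3 * (Real.exp (2 * kinf) * Real.exp (-kinf * |x|)) := by
        have h1 := (hb.2 (x - 2 * δ)).1
        rw [abs_of_nonpos (by linarith)] at h1
        calc _ ≤ (b ^ 2 * Real.exp (2 * kinf * δ)) * (b * Real.exp (-kinf * -(x - 2 * δ))) := by
              gcongr
              exact (profile_pos _ _).le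
          _ = b ^ 3 * (Real.exp (2 * kinf * δ) * Real.exp (-kinf * -(x - 2 * δ))) := by ring
          _ ≤ _ := by
            rw [← Real.exp_add, ← Real.exp_add, abs_of_nonneg hx]
            refine mul_le_mul_of_nonneg_left (Real.exp_le_exp.mpr ?_) (by positivity)
            nlinarith
      have g20 : 0 ≤ peak κ δ * profile κ (x - 2 * δ) := (mul_pos hU (profile_pos _ _)).le
      rw [abs_le] at g1 ⊢
      rw [hC1, add_mul, add_mul, add_mul]
      have n1 : 0 < Real.exp (2 * kinf) * Real.exp (-kinf * |x|) := by positivity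
      constructor <;> nlinarith
  have h0 : C1 * Real.exp (-kinf * |x|) ≤ C1 * twoBumps kinf 0 x := by
    gcongr
    unfold twoBumps
    rw [sub_zero, add_zero]
    linarith [Real.exp_pos (-kinf * |x|)]
  refine le_trans ?_ h0
  rcases le_total 0 x with h | h
  · exact half x h
  · have := half (-x) (by linarith)
    rw [abs_neg x, show -x - 2 * δ = -(x + 2 * δ) by ring,
      show -x + 2 * δ = -(x - 2 * δ) by ring, profile_even hκ.odd, profile_even hκ.odd, trialP,
      profile_even (threeWall_odd hκ hδ), hκ.odd] at this
    rw [← abs_neg]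
    refine le_trans (le_of_eq ?_) this
    congr 1
    rw [trialP]; ring

/-- The residual is confined to `|x| ≤ 1`, where `u = 1 / profile κ` does not depend on `δ`. Its
boundedness, against norms of order `U` and `U²` for the trial pair, drives all the error terms. -/
lemma exists_trialP_residual_bound (hκ : IsDomainWall kinf κ) (hk : 0 < kinf) :
    ∃ C : ℝ, ∀ δ, 1 ≤ δ → ∀ x,
      |deriv κ x / kinf * profile (threeWall κ δ) x| ≤ C * twoBumps kinf 0 x := by
  obtain ⟨b, hb⟩ := exists_profileBound hκ
  obtain ⟨B, B0, hB⟩ := hκ.exists_deriv_bound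
  have hb0 : 0 < b := by linarith [hb.1]
  refine ⟨B / kinf * (b * Real.exp (2 * kinf)), fun δ hδ x => ?_⟩
  rcases lt_or_ge 1 |x| with h | h
  · rw [hκ.deriv_eq_zero h, zero_div, zero_mul, abs_zero]
    exact mul_nonneg (by positivity) (twoBumps_pos _ _ _).le
  · obtain ⟨h1, h2⟩ := abs_le.mp h
    have hPp := profile_pos κ x
    rw [profile_threeWall_center hκ hδ (by linarith) (by linarith), abs_mul, abs_inv,
      abs_of_pos hPp, abs_div, abs_of_pos hk]
    have hi : (profile κ x)⁻¹ ≤ b * Real.exp (2 * kinf) * Real.exp (-kinf * |x|) := by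
      rw [inv_le_iff_one_le_mul₀ hPp]
      have e : (1 : ℝ) ≤ Real.exp (2 * kinf) * Real.exp (-kinf * |x|) * Real.exp (-kinf * |x|)
          := by
        rw [← Real.exp_add, ← Real.exp_add]
        apply Real.one_le_exp
        nlinarith
      calc (1 : ℝ) ≤ Real.exp (2 * kinf) * Real.exp (-kinf * |x|) * Real.exp (-kinf * |x|) := e
        _ ≤ Real.exp (2 * kinf) * Real.exp (-kinf * |x|) * (b * profile κ x) := by
          gcongr; exact (hb.2 x).2
        _ = _ := by ring
    have ht : Real.exp (-kinf * |x|) ≤ twoBumps kinf 0 x := by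
      unfold twoBumps
      rw [sub_zero, add_zero]
      linarith [Real.exp_pos (-kinf * |x|)]
    calc _ ≤ B / kinf * (b * Real.exp (2 * kinf) * Real.exp (-kinf * |x|)) := by
          gcongr; exact hB x
      _ ≤ B / kinf * (b * Real.exp (2 * kinf) * twoBumps kinf 0 x) := by gcongr
      _ = _ := by ring

end Trial

end DomainWallDirac

end

/-! ### Norms of the trial functions -/

noncomputable section

namespace DomainWallDirac

open Filter Topology Set

section Norms

variable {kinf : ℝ} {κ : ℝ → ℝ} {δ : ℝ}

lemma exp_neg_two_mul_eq_sq (k t : ℝ) : Real.exp (-(2 * k) * t) = Real.exp (-k * t) ^ 2 := by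
  rw [← Real.exp_nat_mul]; congr 1; push_cast; ring

lemma integrable_profile_sq (hκ : IsDomainWall kinf κ) (hk : 0 < kinf) :
    Integrable fun x => profile κ x ^ 2 := by
  obtain ⟨b, hb⟩ := exists_profileBound hκ
  have hc := profile_continuous hκ.contDiff.continuous
  refine ((integrable_exp_neg_mul_abs (k := 2 * kinf) (by positivity)).const_mul (b ^ 2)).mono'
    (hc.pow 2).aestronglyMeasurable (Eventually.of_forall fun x => ?_)
  rw [Real.norm_eq_abs, abs_of_nonneg (by positivity), exp_neg_two_mul_eq_sq, ← mul_pow]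
  exact pow_le_pow_left₀ (profile_pos _ _).le (hb.2 x).1 2

/-- The trial mass equals `U² ‖exp (-∫ κ)‖²` up to a bounded error. -/
lemma exists_trialMass_bound (hκ : IsDomainWall kinf κ) (hk : 0 < kinf) :
    ∃ C : ℝ, ∀ δ, 1 ≤ δ →
      |trialMass kinf κ δ - peak κ δ ^ 2 * ∫ x, profile κ x ^ 2| ≤ C := by
  obtain ⟨b, hb⟩ := exists_profileBound hκ
  obtain ⟨X, X0, hX⟩ := exists_cutoff_bound hκ hk
  have hb0 : 0 < b := by linarith [hb.1]
  refine ⟨X * (b ^ 3 * (b ^ 2 * Real.exp (2 * kinf))) ^ 2 / (2 * kinf)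
    + b ^ 6 * (Real.exp (2 * kinf) / (2 * kinf)), fun δ hδ => ?_⟩
  have hU := peak_pos κ δ
  obtain ⟨hU1, hU2⟩ := peak_bounds hb hδ
  have hi := integrableOn_trialDensity hκ hk hδ
  have ip := (integrable_profile_sq hκ hk).comp_sub_right (2 * δ)
  -- On `(1, ∞)` the density is exactly `U²` times the shifted squared profile. The part of the
  -- profile missing on `(-∞, 1]` has mass `O(e^{-4κ∞δ})`, hence contributes `O(1)` after
  -- multiplication by `U²`.
  have e1 : trialMass kinf κ δ = (∫ x in (0 : ℝ)..1, trialDensity kinf κ δ x)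
      + ∫ x in Ioi (1 : ℝ), peak κ δ ^ 2 * profile κ (x - 2 * δ) ^ 2 := by
    rw [trialMass, ← intervalIntegral.integral_interval_add_Ioi hi
      (hi.mono_set (Ioi_subset_Ioi zero_le_one))]
    congr 1
    refine setIntegral_congr_fun measurableSet_Ioi fun x hx => ?_
    have hx1 : 1 ≤ x := le_of_lt hx
    simp only [trialDensity]
    rw [hκ.right x hx1, div_self hk.ne', profile_threeWall_right hκ hδ hx1]; ring
  have e2 : ∫ x, profile κ x ^ 2 = (∫ x in Iic (1 : ℝ), profile κ (x - 2 * δ) ^ 2)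
      + ∫ x in Ioi (1 : ℝ), profile κ (x - 2 * δ) ^ 2 := by
    rw [intervalIntegral.integral_Iic_add_Ioi ip.integrableOn ip.integrableOn,
      integral_sub_right_eq_self (fun x => profile κ x ^ 2)]
  have g1 := abs_integral_trialDensity_le hκ hk hb X0 hX hδ (x := 1) zero_le_one
  have g1' : X * (b ^ 3 * peak κ δ) ^ 2 * (Real.exp (2 * kinf * (1 - 2 * δ)) / (2 * kinf))
      ≤ X * (b ^ 3 * (b ^ 2 * Real.exp (2 * kinf))) ^ 2 / (2 * kinf) := by
    have e : Real.exp (2 * kinf * (1 - 2 * δ)) * Real.exp (2 * kinf * δ) ^ 2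
        = Real.exp (2 * kinf) := by
      rw [← Real.exp_nat_mul, ← Real.exp_add]; congr 1; push_cast; ring
    have e' : (1 : ℝ) ≤ Real.exp (2 * kinf) := Real.one_le_exp (by positivity)
    calc _ ≤ X * (b ^ 3 * (b ^ 2 * Real.exp (2 * kinf * δ))) ^ 2
          * (Real.exp (2 * kinf * (1 - 2 * δ)) / (2 * kinf)) := by gcongr
      _ = X * (b ^ 3 * b ^ 2) ^ 2 * (Real.exp (2 * kinf * (1 - 2 * δ))
          * Real.exp (2 * kinf * δ) ^ 2) / (2 * kinf) := by ring
      _ = X * (b ^ 3 * b ^ 2) ^ 2 * Real.exp (2 * kinf) / (2 * kinf) := by rw [e]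
      _ ≤ X * (b ^ 3 * b ^ 2) ^ 2 * Real.exp (2 * kinf) ^ 2 / (2 * kinf) := by
        gcongr; exact le_self_pow₀ e' (by norm_num)
      _ = _ := by ring
  have g2 : ∫ x in Iic (1 : ℝ), profile κ (x - 2 * δ) ^ 2
      ≤ b ^ 2 * (Real.exp (2 * kinf * (1 - 2 * δ)) / (2 * kinf)) := by
    have i0 := ((integrableOn_exp_mul_Iic (a := 2 * kinf) (by positivity) 1).const_mul
      (b ^ 2 * Real.exp (2 * kinf * (-(2 * δ)))))
    have hE : ∀ y, b ^ 2 * Real.exp (2 * kinf * (-(2 * δ))) * Real.exp (2 * kinf * y)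
        = b ^ 2 * Real.exp (2 * kinf * (y - 2 * δ)) := fun y => by
      rw [mul_assoc, ← Real.exp_add]; congr 2; ring
    calc _ ≤ ∫ x in Iic (1 : ℝ), b ^ 2 * Real.exp (2 * kinf * (-(2 * δ)))
          * Real.exp (2 * kinf * x) := by
          refine setIntegral_mono_on ip.integrableOn i0 measurableSet_Iic fun x hx => ?_
          rw [hE]
          have h1 := (hb.2 (x - 2 * δ)).1
          rw [mem_Iic] at hx
          rw [abs_of_nonpos (by linarith)] at h1
          calc _ ≤ (b * Real.exp (-kinf * -(x - 2 * δ))) ^ 2 :=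
                pow_le_pow_left₀ (profile_pos _ _).le h1 2
            _ = _ := by
              rw [mul_pow, ← exp_neg_two_mul_eq_sq]; congr 2; ring
      _ = _ := by
        rw [integral_const_mul, integral_exp_mul_Iic (by positivity), ← mul_div_assoc, hE,
          mul_div_assoc]
  have g20 : 0 ≤ ∫ x in Iic (1 : ℝ), profile κ (x - 2 * δ) ^ 2 :=
    integral_nonneg fun x => by positivity
  have g3 : peak κ δ ^ 2 * ∫ x in Iic (1 : ℝ), profile κ (x - 2 * δ) ^ 2
      ≤ b ^ 6 * (Real.exp (2 * kinf) / (2 * kinf)) := by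
    have e : Real.exp (2 * kinf * δ) ^ 2 * Real.exp (2 * kinf * (1 - 2 * δ))
        = Real.exp (2 * kinf) := by
      rw [← Real.exp_nat_mul, ← Real.exp_add]; congr 1; push_cast; ring
    calc _ ≤ (b ^ 2 * Real.exp (2 * kinf * δ)) ^ 2 *
          (b ^ 2 * (Real.exp (2 * kinf * (1 - 2 * δ)) / (2 * kinf))) := by gcongr
      _ = b ^ 6 * (Real.exp (2 * kinf * δ) ^ 2 * Real.exp (2 * kinf * (1 - 2 * δ)) / (2 * kinf)) :=
        by ring
      _ = _ := by rw [e]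
  rw [e1, e2, integral_const_mul]
  have g30 : 0 ≤ peak κ δ ^ 2 * ∫ x in Iic (1 : ℝ), profile κ (x - 2 * δ) ^ 2 := by positivity
  rw [abs_le] at g1 ⊢
  constructor <;> nlinarith

/-- The overlap of the outer zero modes is `O(e^{-2κ∞δ})`. -/
lemma exists_overlap_bound (hκ : IsDomainWall kinf κ) (hk : 0 < kinf) :
    ∃ C : ℝ, ∀ δ, 1 ≤ δ →
      |(∫ x, (profile κ (x - 2 * δ) - profile κ (x + 2 * δ)) ^ 2) - 2 * ∫ x, profile κ x ^ 2|
        ≤ C * (peak κ δ)⁻¹ := by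
  obtain ⟨b, hb⟩ := exists_profileBound hκ
  have hb0 : 0 < b := by linarith [hb.1]
  have hc := profile_continuous hκ.contDiff.continuous
  refine ⟨2 * (b ^ 4 * (2 / kinf)), fun δ hδ => ?_⟩
  have hU := peak_pos κ δ
  have iR := (integrable_profile_sq hκ hk).comp_sub_right (2 * δ)
  have iL := (integrable_profile_sq hκ hk).comp_add_right (2 * δ)
  have i0 := (integrable_exp_neg_mul_abs hk).const_mul (b ^ 2 * Real.exp (-(2 * kinf * δ)))
  have hle : ∀ x, profile κ (x - 2 * δ) * profile κ (x + 2 * δ)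
      ≤ b ^ 2 * Real.exp (-(2 * kinf * δ)) * Real.exp (-kinf * |x|) := fun x => by
    have h1 := (hb.2 (x - 2 * δ)).1
    have h2 := (hb.2 (x + 2 * δ)).1
    calc _ ≤ (b * Real.exp (-kinf * |x - 2 * δ|)) * (b * Real.exp (-kinf * |x + 2 * δ|)) := by
          gcongr
          exact (profile_pos _ _).le
      _ = b ^ 2 * (Real.exp (-kinf * |x - 2 * δ|) * Real.exp (-kinf * |x + 2 * δ|)) := by ring
      _ ≤ b ^ 2 * (Real.exp (-(2 * kinf * δ)) * Real.exp (-kinf * |x|)) := by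
        rw [← Real.exp_add, ← Real.exp_add]
        refine mul_le_mul_of_nonneg_left (Real.exp_le_exp.mpr ?_) (by positivity)
        -- Averaging the two lower bounds gives `2δ + |x|`: half of the decay produces the small
        -- factor, the other half keeps the product integrable uniformly in `δ`.
        have t1 : 4 * δ ≤ |x - 2 * δ| + |x + 2 * δ| := by
          have := le_abs_self (x + 2 * δ)
          have := neg_abs_le (x - 2 * δ)
          linarith
        have t2 : 2 * |x| ≤ |x - 2 * δ| + |x + 2 * δ| := by
          have := abs_add_le (x - 2 * δ) (x + 2 * δ)
          rw [show x - 2 * δ + (x + 2 * δ) = 2 * x by ring, abs_mul, abs_two] at this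
          exact this
        nlinarith
      _ = _ := by ring
  have hpos : ∀ x, 0 ≤ profile κ (x - 2 * δ) * profile κ (x + 2 * δ) := fun x =>
    (mul_pos (profile_pos _ _) (profile_pos _ _)).le
  have iRL : Integrable fun x => profile κ (x - 2 * δ) * profile κ (x + 2 * δ) := by
    refine i0.mono' (by fun_prop) (Eventually.of_forall fun x => ?_)
    rw [Real.norm_eq_abs, abs_of_nonneg (hpos x)]
    exact hle x
  have e : ∫ x, (profile κ (x - 2 * δ) - profile κ (x + 2 * δ)) ^ 2
      = 2 * (∫ x, profile κ x ^ 2)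
        - 2 * ∫ x, profile κ (x - 2 * δ) * profile κ (x + 2 * δ) := by
    have e0 : ∀ x, (profile κ (x - 2 * δ) - profile κ (x + 2 * δ)) ^ 2
        = (profile κ (x - 2 * δ) ^ 2 + profile κ (x + 2 * δ) ^ 2)
          - 2 * (profile κ (x - 2 * δ) * profile κ (x + 2 * δ)) := fun x => by ring
    simp only [e0]
    rw [integral_sub (f := fun x => profile κ (x - 2 * δ) ^ 2 + profile κ (x + 2 * δ) ^ 2)
      (iR.add iL) (iRL.const_mul 2), integral_add iR iL, integral_const_mul,
      integral_sub_right_eq_self (fun x => profile κ x ^ 2),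
      integral_add_right_eq_self (fun x => profile κ x ^ 2)]
    ring
  have o1 : ∫ x, profile κ (x - 2 * δ) * profile κ (x + 2 * δ)
      ≤ b ^ 2 * Real.exp (-(2 * kinf * δ)) * (2 / kinf) := by
    rw [← integral_exp_neg_mul_abs hk, ← integral_const_mul]
    exact integral_mono iRL i0 hle
  have o0 : 0 ≤ ∫ x, profile κ (x - 2 * δ) * profile κ (x + 2 * δ) := integral_nonneg hpos
  have hε : Real.exp (-(2 * kinf * δ)) ≤ b ^ 2 * (peak κ δ)⁻¹ := by
    rw [Real.exp_neg, ← div_eq_mul_inv, inv_le_iff_one_le_mul₀ (Real.exp_pos _), div_mul_eq_mul_div,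
      le_div_iff₀ hU, one_mul]
    exact (peak_bounds hb hδ).1
  have o2 : b ^ 2 * Real.exp (-(2 * kinf * δ)) * (2 / kinf)
      ≤ b ^ 4 * (2 / kinf) * (peak κ δ)⁻¹ := by
    calc _ ≤ b ^ 2 * (b ^ 2 * (peak κ δ)⁻¹) * (2 / kinf) := by gcongr
      _ = _ := by ring
  rw [e, abs_le]
  constructor <;> nlinarith

end Norms

/-! ### The quasimode in `L²` -/

section Package

variable {kinf : ℝ} {κ : ℝ → ℝ}

lemma memLp_profile (hκ : IsDomainWall kinf κ) (hk : 0 < kinf) :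
    MemLp (fun x => (profile κ x : ℂ)) 2 (volume : Measure ℝ) := by
  have hc : Continuous fun x => (profile κ x : ℂ) :=
    continuous_ofReal.comp (profile_continuous hκ.contDiff.continuous)
  rw [← memLp_norm_iff hc.aestronglyMeasurable,
    memLp_two_iff_integrable_sq hc.norm.aestronglyMeasurable]
  simpa using integrable_profile_sq hκ hk

lemma memLp_profile_diff (hκ : IsDomainWall kinf κ) (hk : 0 < kinf) (δ : ℝ) :
    MemLp (fun x => ((profile κ (x - 2 * δ) - profile κ (x + 2 * δ) : ℝ) : ℂ)) 2
      (volume : Measure ℝ) := by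
  have h := memLp_profile hκ hk
  have h1 := h.comp_measurePreserving (measurePreserving_sub_right volume (2 * δ))
  have h2 := h.comp_measurePreserving (measurePreserving_add_right volume (2 * δ))
  refine (h1.sub h2).ae_eq (Eventually.of_forall fun x => ?_)
  simp [Function.comp]

/-- Quasi-modes of the three-wall operator with all the estimates needed for the asymptotics. -/
theorem exists_quasimodes (hκ : IsDomainWall kinf κ) (hk : 0 < kinf) :
    ∃ C : ℝ, 0 < C ∧ ∀ δ, 1 ≤ δ → ∀ (hm : Continuous (threeWall κ δ))
      (hm' : Continuous fun x => -threeWall κ δ x),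
      ∃ (G Y Z : L2C) (N : ℝ), (G, -Y) ∈ opGraph (fun x => -threeWall κ δ x) hm' ∧
        (Y, Z) ∈ opGraph (threeWall κ δ) hm ∧ ‖Z‖ ≤ C ∧
        ‖G - (N : ℂ) • (memLp_profile hκ hk).toLp _‖ ≤ C * peak κ δ ∧
        ‖Y - (peak κ δ : ℂ) • (memLp_profile_diff hκ hk δ).toLp _‖ ≤ C ∧
        |N - peak κ δ ^ 2 * ‖(memLp_profile hκ hk).toLp _‖ ^ 2| ≤ C ∧
        |‖(memLp_profile_diff hκ hk δ).toLp _‖ ^ 2 - 2 * ‖(memLp_profile hκ hk).toLp _‖ ^ 2|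
          ≤ C * (peak κ δ)⁻¹ := by
  obtain ⟨C1, h1⟩ := exists_trialQ_bound hκ hk
  obtain ⟨C2, h2⟩ := exists_trialP_bound hκ hk
  obtain ⟨C3, h3⟩ := exists_trialP_residual_bound hκ hk
  obtain ⟨C4, h4⟩ := exists_trialMass_bound hκ hk
  obtain ⟨C5, h5⟩ := exists_overlap_bound hκ hk
  set c := 2 / Real.sqrt kinf with hc
  have c0 : 0 < c := by have := Real.sqrt_pos.mpr hk; positivity
  set C := 1 + |C1| * c + |C2| * c + |C3| * c + |C4| + |C5| with hC
  have a1 := mul_nonneg (abs_nonneg C1) c0.le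
  have a2 := mul_nonneg (abs_nonneg C2) c0.le
  have a3 := mul_nonneg (abs_nonneg C3) c0.le
  have a4 := abs_nonneg C4
  have a5 := abs_nonneg C5
  refine ⟨C, by linarith, fun δ hδ hm hm' => ?_⟩
  have hU := peak_pos κ δ
  have vP := memLp_profile hκ hk
  have vD := memLp_profile_diff hκ hk δ
  have cP : Continuous (profile κ) := profile_continuous hκ.contDiff.continuous
  have cQ : Continuous (trialQ kinf κ δ) := continuous_iff_continuousAt.mpr fun x =>
    (trialQ_hasDerivAt hκ hδ x).continuousAt
  have cY : Continuous (trialP kinf κ δ) := continuous_iff_continuousAt.mpr fun x =>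
    (trialP_hasDerivAt hκ hδ x).continuousAt
  have cu := profile_continuous hm
  have cκ' := hκ.continuous_deriv
  set N := trialMass kinf κ δ with hN
  obtain ⟨mQ, nQ⟩ := memLp_of_le_twoBumps hk (a := 2 * δ) (A := C1 * peak κ δ)
    (f := fun x => ((trialQ kinf κ δ x - N * profile κ x : ℝ) : ℂ))
    (Continuous.aestronglyMeasurable (by fun_prop)) (fun x => by
      rw [norm_real, Real.norm_eq_abs]; exact h1 δ hδ x)
  obtain ⟨mY, nY⟩ := memLp_of_le_twoBumps hk (a := 0) (A := C2)
    (f := fun x => ((trialP kinf κ δ x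
      - peak κ δ * (profile κ (x - 2 * δ) - profile κ (x + 2 * δ)) : ℝ) : ℂ))
    (Continuous.aestronglyMeasurable (by fun_prop)) (fun x => by
      rw [norm_real, Real.norm_eq_abs]; exact h2 δ hδ x)
  obtain ⟨mZ, nZ⟩ := memLp_of_le_twoBumps hk (a := 0) (A := C3)
    (f := fun x => ((deriv κ x / kinf * profile (threeWall κ δ) x : ℝ) : ℂ))
    (Continuous.aestronglyMeasurable (by fun_prop)) (fun x => by
      rw [norm_real, Real.norm_eq_abs]; exact h3 δ hδ x)
  have MQ : MemLp (fun x => (trialQ kinf κ δ x : ℂ)) 2 (volume : Measure ℝ) :=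
    (mQ.add (vP.const_mul (N : ℂ))).ae_eq (Eventually.of_forall fun x => by simp)
  have MY : MemLp (fun x => (trialP kinf κ δ x : ℂ)) 2 (volume : Measure ℝ) :=
    (mY.add (vD.const_mul (peak κ δ : ℂ))).ae_eq (Eventually.of_forall fun x => by simp)
  have pQ : IsPrim (fun x => (trialQ kinf κ δ x : ℂ)) (fun x => (-(trialP kinf κ δ x : ℂ))
      - ((-threeWall κ δ x : ℝ) : ℂ) * trialQ kinf κ δ x) :=
    (IsPrim.of_hasDerivAt (fun x => (trialQ_hasDerivAt hκ hδ x).ofReal_comp)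
      (continuous_ofReal.comp ((hm.mul cQ).sub cY))).congr
      (Eventually.of_forall fun x => by simp only; push_cast; ring)
  have pY : IsPrim (fun x => (trialP kinf κ δ x : ℂ))
      (fun x => ((deriv κ x / kinf * profile (threeWall κ δ) x : ℝ) : ℂ)
      - (threeWall κ δ x : ℂ) * trialP kinf κ δ x) :=
    (IsPrim.of_hasDerivAt (fun x => (trialP_hasDerivAt hκ hδ x).ofReal_comp)
      (continuous_ofReal.comp (((cκ'.div_const _).mul cu).sub (hm.mul cY)))).congr
      (Eventually.of_forall fun x => by simp only; push_cast; ring)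
  refine ⟨MQ.toLp _, MY.toLp _, mZ.toLp _, N, ?_, pY.mem_opGraph MY mZ, ?_, ?_, ?_, ?_, ?_⟩
  · exact pQ.mem_opGraph (hm := hm') MQ MY.neg
  · refine nZ.trans ((mul_le_mul_of_nonneg_right (le_abs_self C3) c0.le).trans ?_)
    linarith
  · have e : MQ.toLp _ - (N : ℂ) • vP.toLp _ = mQ.toLp _ := by
      rw [← MemLp.toLp_const_smul, ← MemLp.toLp_sub]
      refine MemLp.toLp_congr _ _ (Eventually.of_forall fun x => ?_)
      simp
    rw [e]
    refine nQ.trans ?_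
    have : C1 * c ≤ C := (mul_le_mul_of_nonneg_right (le_abs_self C1) c0.le).trans (by linarith)
    calc C1 * peak κ δ * c = C1 * c * peak κ δ := by ring
      _ ≤ C * peak κ δ := by gcongr
  · have e : MY.toLp _ - (peak κ δ : ℂ) • vD.toLp _ = mY.toLp _ := by
      rw [← MemLp.toLp_const_smul, ← MemLp.toLp_sub]
      refine MemLp.toLp_congr _ _ (Eventually.of_forall fun x => ?_)
      simp
    rw [e]
    refine nY.trans ((mul_le_mul_of_nonneg_right (le_abs_self C2) c0.le).trans ?_)
    linarith
  · rw [norm_toLp_sq_eq_integral]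
    simp only [norm_real, Real.norm_eq_abs, sq_abs]
    exact (h4 δ hδ).trans ((le_abs_self C4).trans (by linarith))
  · rw [norm_toLp_sq_eq_integral, norm_toLp_sq_eq_integral]
    simp only [norm_real, Real.norm_eq_abs, sq_abs]
    refine (h5 δ hδ).trans ?_
    have : C5 ≤ C := (le_abs_self C5).trans (by linarith)
    gcongr

end Package

end DomainWallDirac

end

/-! ### Abstract perturbation theory for a quasimode -/

noncomputable section

namespace DomainWallDirac

open Filter Topology Set

section Abstract

variable {E : Type*} [NormedAddCommGroup E] [InnerProductSpace ℂ E]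

/-- The gap persists on the orthogonal complement of a critical vector below the gap. -/
lemma IsCritical.gap_orthogonal {Γ : Submodule ℂ (E × E)} {g : E} {k : ℝ} (hk : 0 < k)
    (hgap : ∀ p ∈ Γ, inner ℂ g p.1 = 0 → k * ‖p.1‖ ≤ ‖p.2‖) {l : ℝ} (hl : l < k ^ 2) {x y : E}
    (h : IsCritical Γ l x y) (hx : x ≠ 0) {r s : E} (hr : (r, s) ∈ Γ) (ho : inner ℂ x r = 0) :
    k * ‖r‖ ≤ ‖s‖ := by
  have hg := h.inner_ne_zero hk hgap hl hx
  -- Correcting `r` by a multiple of `x` makes it orthogonal to `g`. The pairs `(r, s)` and `(x, y)`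
  -- are orthogonal in both slots, so Pythagoras separates them, and the `x`-part has quotient `l <
  -- k²`.
  set t : ℂ := -(inner ℂ g r / inner ℂ g x) with ht
  have hz : (r + t • x, s + t • y) ∈ Γ := Γ.add_mem hr (Γ.smul_mem t h.1)
  have hzg : inner ℂ g (r + t • x) = 0 := by
    rw [inner_add_right, inner_smul_right, ht, neg_mul, div_mul_cancel₀ _ hg, add_neg_cancel]
  have h1 := pow_le_pow_left₀ (by positivity) (hgap _ hz hzg) 2
  have hor : inner ℂ r (t • x) = 0 := by
    rw [inner_smul_right, ← inner_conj_symm, ho, map_zero, mul_zero]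
  have hos : inner ℂ s (t • y) = 0 := by
    have := h.2 _ hr
    simp only [ho, mul_zero] at this
    rw [inner_smul_right, ← inner_conj_symm, this, map_zero, mul_zero]
  simp only [mul_pow] at h1
  rw [@norm_add_sq ℂ, @norm_add_sq ℂ, hor, hos, norm_smul, norm_smul, mul_pow, mul_pow,
    h.norm_sq] at h1
  simp only [map_zero, mul_zero, add_zero] at h1
  have h2 : ‖t‖ ^ 2 * (l * ‖x‖ ^ 2) ≤ k ^ 2 * (‖t‖ ^ 2 * ‖x‖ ^ 2) := by
    have : l * (‖t‖ ^ 2 * ‖x‖ ^ 2) ≤ k ^ 2 * (‖t‖ ^ 2 * ‖x‖ ^ 2) := by gcongr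
    linarith
  refine abs_le_of_sq_le_sq' ?_ (norm_nonneg _) |>.2
  rw [mul_pow]
  linarith

lemma norm_normalize_sub_le {w y : E} (hw : w ≠ 0) {β : ℝ} (hβ : 0 < β) :
    ‖((‖w‖⁻¹ : ℝ) : ℂ) • w - ((β⁻¹ : ℝ) : ℂ) • y‖ ≤ (‖w - y‖ + |‖w‖ - β|) / β := by
  have hw' : 0 < ‖w‖ := norm_pos_iff.mpr hw
  have e : ((‖w‖⁻¹ : ℝ) : ℂ) • w - ((β⁻¹ : ℝ) : ℂ) • y
      = ((β⁻¹ : ℝ) : ℂ) • (w - y) + ((‖w‖⁻¹ - β⁻¹ : ℝ) : ℂ) • w := by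
    push_cast; module
  have e2 : |‖w‖⁻¹ - β⁻¹| * ‖w‖ = |‖w‖ - β| / β := by
    rw [inv_sub_inv hw'.ne' hβ.ne', abs_div, abs_of_pos (mul_pos hw' hβ), abs_sub_comm]
    field_simp
  rw [e]
  refine (norm_add_le _ _).trans (le_of_eq ?_)
  rw [norm_smul, norm_smul, Complex.norm_real, Complex.norm_real, Real.norm_eq_abs,
    Real.norm_eq_abs, e2, abs_of_pos (inv_pos.mpr hβ)]
  field_simp

/-- A quasimode is close to a multiple of the critical vector. -/
theorem IsCritical.exists_near {Γ : Submodule ℂ (E × E)} {g : E} {k : ℝ} (hk : 0 < k)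
    (hgap : ∀ p ∈ Γ, inner ℂ g p.1 = 0 → k * ‖p.1‖ ≤ ‖p.2‖) {l : ℝ} (hl : l < k ^ 2) {x y : E}
    (h : IsCritical Γ l x y) (hx : ‖x‖ = 1) {G Y Z : E} (hG : (G, -Y) ∈ Γ)
    (hZ : ∀ p ∈ Γ, inner ℂ Z p.1 = -inner ℂ Y p.2) :
    ∃ X W : E, ‖X - G‖ ≤ ‖Z‖ / k ^ 2 ∧ ‖W - Y‖ ≤ ‖Z‖ / k ∧ IsCritical Γ l X (-W) := by
  -- The critical vector is taken to be the orthogonal projection of `G` on the line of `x`; `(r,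
  -- s)` is the error in the two slots.
  set c : ℂ := inner ℂ x G with hc
  have hr : (G - c • x, -Y - c • y) ∈ Γ := Γ.sub_mem hG (Γ.smul_mem c h.1)
  set r := G - c • x with hrd
  set s := -Y - c • y with hsd
  have hx0 : x ≠ 0 := by
    rintro rfl
    simp at hx
  have ho : inner ℂ x r = 0 := by
    rw [hrd, inner_sub_right, inner_smul_right, inner_self_eq_norm_sq_to_K, hx]
    simp [hc]
  have h1 := h.gap_orthogonal hk hgap hl hx0 hr ho
  have h2 : inner ℂ y s = 0 := by
    rw [h.2 _ hr, ho, mul_zero]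
  -- Since `s` is orthogonal to `y`, `⟨s, s⟩ = -⟨Y, s⟩ = ⟨Z, r⟩`. Combined with `k ‖r‖ ≤ ‖s‖`, this
  -- bounds both errors by the residual.
  have h3 : ‖s‖ ^ 2 ≤ ‖Z‖ * ‖r‖ := by
    have e : inner ℂ s s = inner ℂ Z r := by
      rw [hZ _ hr]
      nth_rewrite 1 [hsd]
      rw [inner_sub_left, inner_smul_left, h2, inner_neg_left]
      simp
    calc ‖s‖ ^ 2 = ‖(inner ℂ s s : ℂ)‖ := by
          rw [inner_self_eq_norm_sq_to_K]; simp
      _ ≤ _ := by rw [e]; exact norm_inner_le_norm _ _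
  have h4 : ‖s‖ ≤ ‖Z‖ / k := by
    rw [le_div_iff₀ hk]
    rcases (norm_nonneg s).eq_or_lt with h0 | h0
    · rw [← h0, zero_mul]; exact norm_nonneg _
    · refine le_of_mul_le_mul_right ?_ h0
      nlinarith [norm_nonneg Z]
  have h5 : ‖r‖ ≤ ‖Z‖ / k ^ 2 := by
    rw [pow_two, ← div_div, le_div_iff₀ hk, mul_comm]
    exact h1.trans h4
  refine ⟨c • x, -(c • y), ?_, ?_, ?_⟩
  · rw [norm_sub_rev]; exact h5
  · have : -(c • y) - Y = s := by rw [hsd]; abel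
    rw [this]; exact h4
  · rw [neg_neg]; exact h.smul c

lemma abs_div_sub_le {n U A B c₁ c₂ : ℝ} (hn : 0 < n) (hU : 0 < U) (hc₁ : 0 ≤ c₁)
    (hB : |B - Real.sqrt 2 * n * U| ≤ c₁) (hA : |A - U ^ 2 * n ^ 3| ≤ c₂ * U)
    (hA' : U ^ 2 * n ^ 3 / 2 ≤ A) :
    |B / A - Real.sqrt 2 / (n ^ 2 * U)|
      ≤ (2 * c₁ / n ^ 3 + 2 * Real.sqrt 2 * c₂ / n ^ 5) / U ^ 2 := by
  have hA0 : 0 < A := lt_of_lt_of_le (by positivity) hA'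
  have hc₂ : 0 ≤ c₂ := nonneg_of_mul_nonneg_left ((abs_nonneg _).trans hA) hU
  have e : B / A - Real.sqrt 2 / (n ^ 2 * U) = (B - Real.sqrt 2 * n * U) / A
      - Real.sqrt 2 * (A - U ^ 2 * n ^ 3) / (n ^ 2 * U * A) := by
    field_simp; ring
  have b1 : |(B - Real.sqrt 2 * n * U) / A| ≤ c₁ / (U ^ 2 * n ^ 3 / 2) := by
    rw [abs_div, abs_of_pos hA0]; gcongr
  have b2 : |Real.sqrt 2 * (A - U ^ 2 * n ^ 3) / (n ^ 2 * U * A)|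
      ≤ Real.sqrt 2 * (c₂ * U) / (n ^ 2 * U * (U ^ 2 * n ^ 3 / 2)) := by
    rw [abs_div, abs_mul, abs_of_pos (show (0:ℝ) < n ^ 2 * U * A by positivity),
      abs_of_nonneg (Real.sqrt_nonneg 2)]
    gcongr
  rw [e]
  refine (abs_sub _ _).trans ((add_le_add b1 b2).trans (le_of_eq ?_))
  field_simp

/-- Existence and asymptotics of the critical pair carried by a quasimode of size `U`. -/
theorem exists_critical_asymptotics [CompleteSpace E] {n k C : ℝ} (hn : 0 < n) (hk : 0 < k)
    (hC : 0 ≤ C) :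
    ∃ C' U₀ : ℝ, 0 < C' ∧ 1 ≤ U₀ ∧ ∀ U, U₀ ≤ U → ∀ (Γ : Submodule ℂ (E × E)) (g v d G Y Z : E)
      (N : ℝ), IsClosed (Γ : Set (E × E)) →
      (∀ p ∈ Γ, inner ℂ g p.1 = 0 → k * ‖p.1‖ ≤ ‖p.2‖) →
      (∀ q, (q, (0 : E)) ∈ Γ → q = 0) → (G, -Y) ∈ Γ →
      (∀ p ∈ Γ, inner ℂ Z p.1 = -inner ℂ Y p.2) → ‖v‖ = n → ‖Z‖ ≤ C →
      ‖G - (N : ℂ) • v‖ ≤ C * U → ‖Y - (U : ℂ) • d‖ ≤ C → |N - U ^ 2 * n ^ 2| ≤ C →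
      |‖d‖ ^ 2 - 2 * n ^ 2| ≤ C * U⁻¹ →
      ∃ (e : ℝ) (φ ψ : E), 0 < e ∧ e < k ∧ ‖φ‖ = 1 ∧ ‖ψ‖ = 1 ∧
        IsCritical Γ (e ^ 2) φ (-((e : ℂ) • ψ)) ∧
        |e - Real.sqrt 2 / (n ^ 2 * U)| ≤ C' / U ^ 2 ∧
        ‖φ - ((n⁻¹ : ℝ) : ℂ) • v‖ ≤ C' / U ∧
        ‖ψ - (((Real.sqrt 2 * n)⁻¹ : ℝ) : ℂ) • d‖ ≤ C' / U := by
  have h2 : 0 < Real.sqrt 2 := by positivity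
  have hs2 : Real.sqrt 2 ^ 2 = 2 := Real.sq_sqrt (by norm_num)
  -- `c₁` collects the error of `‖W‖` against `√2 n U`, and `c₂ U` that of `X` against `U² n² v`. In
  -- the threshold below, the term with `c₂` keeps `‖X‖` at least half its leading value; the last
  -- term makes the quotient of the quasimode smaller than `k`.
  set c₁ : ℝ := C + C / k + C / (Real.sqrt 2 * n) with hc₁
  set c₂ : ℝ := C + C / k ^ 2 + C * n with hc₂
  have c1 : 0 ≤ c₁ := by positivity
  have c2 : 0 ≤ c₂ := by positivity
  refine ⟨2 * c₁ / n ^ 3 + 2 * Real.sqrt 2 * c₂ / n ^ 5 + 2 * c₂ / n ^ 3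
    + 2 * c₁ / (Real.sqrt 2 * n) + 1,
    1 + 2 * c₂ / n ^ 3 + 2 * (Real.sqrt 2 * n + c₁) / (k * n ^ 3), by positivity, ?_, ?_⟩
  · have : 0 ≤ 2 * c₂ / n ^ 3 + 2 * (Real.sqrt 2 * n + c₁) / (k * n ^ 3) := by positivity
    linarith
  intro U hU Γ g v d G Y Z N hΓ hgap hker hG hZ hv hZC hGv hYd hN hd
  have hU1 : 1 ≤ U := by
    have : 0 ≤ 2 * c₂ / n ^ 3 + 2 * (Real.sqrt 2 * n + c₁) / (k * n ^ 3) := by positivity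
    linarith
  have hU0 : 0 < U := by linarith
  have hUa : 2 * c₂ ≤ U * n ^ 3 := by
    rw [← div_le_iff₀ (by positivity)]
    have : 0 ≤ 2 * (Real.sqrt 2 * n + c₁) / (k * n ^ 3) := by positivity
    linarith
  have hUb : 2 * (Real.sqrt 2 * n + c₁) < U * (k * n ^ 3) := by
    rw [← div_lt_iff₀ (by positivity)]
    have : 0 ≤ 2 * c₂ / n ^ 3 := by positivity
    linarith
  have hdn : |‖d‖ - Real.sqrt 2 * n| ≤ C / (Real.sqrt 2 * n) * U⁻¹ := by
    have e : |‖d‖ - Real.sqrt 2 * n| * (‖d‖ + Real.sqrt 2 * n) = |‖d‖ ^ 2 - 2 * n ^ 2| := by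
      have e' : ‖d‖ ^ 2 - 2 * n ^ 2 = (‖d‖ - Real.sqrt 2 * n) * (‖d‖ + Real.sqrt 2 * n) := by
        linear_combination n ^ 2 * hs2
      rw [e', abs_mul, abs_of_nonneg (show 0 ≤ ‖d‖ + Real.sqrt 2 * n by positivity)]
    rw [div_mul_eq_mul_div, le_div_iff₀ (by positivity)]
    refine le_trans ?_ (e.le.trans hd)
    gcongr
    linarith [norm_nonneg d]
  have hvn : ‖((U ^ 2 * n ^ 2 : ℝ) : ℂ) • v‖ = U ^ 2 * n ^ 3 := by
    rw [norm_smul, Complex.norm_real, Real.norm_of_nonneg (by positivity), hv]; ring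
  have estX : ∀ X : E, ‖X - G‖ ≤ C / k ^ 2 →
      ‖X - ((U ^ 2 * n ^ 2 : ℝ) : ℂ) • v‖ ≤ c₂ * U := by
    intro X hX
    have e : X - ((U ^ 2 * n ^ 2 : ℝ) : ℂ) • v
        = (X - G) + (G - (N : ℂ) • v) + ((N - U ^ 2 * n ^ 2 : ℝ) : ℂ) • v := by
      push_cast; module
    rw [e]
    refine (norm_add₃_le).trans ?_
    rw [norm_smul, Complex.norm_real, Real.norm_eq_abs, hv]
    have t1 : C / k ^ 2 ≤ C / k ^ 2 * U := le_mul_of_one_le_right (by positivity) hU1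
    have t2 : |N - U ^ 2 * n ^ 2| * n ≤ C * n * U :=
      (mul_le_mul_of_nonneg_right hN hn.le).trans (le_mul_of_one_le_right (by positivity) hU1)
    rw [hc₂]; linarith
  have estX' : ∀ X : E, ‖X - G‖ ≤ C / k ^ 2 → |‖X‖ - U ^ 2 * n ^ 3| ≤ c₂ * U := by
    intro X hX
    rw [← hvn]
    exact (abs_norm_sub_norm_le _ _).trans (estX X hX)
  have estX'' : ∀ X : E, ‖X - G‖ ≤ C / k ^ 2 → U ^ 2 * n ^ 3 / 2 ≤ ‖X‖ := by
    intro X hX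
    have := (abs_le.mp (estX' X hX)).1
    nlinarith
  have estW : ∀ W : E, ‖W - Y‖ ≤ C / k → ‖W - (U : ℂ) • d‖ ≤ C + C / k := by
    intro W hW
    have := norm_sub_le_norm_sub_add_norm_sub W Y ((U : ℂ) • d)
    linarith
  have estW' : ∀ W : E, ‖W - Y‖ ≤ C / k → |‖W‖ - Real.sqrt 2 * n * U| ≤ c₁ := by
    intro W hW
    have h3 := (abs_norm_sub_norm_le W ((U : ℂ) • d)).trans (estW W hW)
    rw [norm_smul, Complex.norm_real, Real.norm_of_nonneg hU0.le] at h3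
    have h4 : |U * ‖d‖ - Real.sqrt 2 * n * U| ≤ C / (Real.sqrt 2 * n) := by
      have e : U * ‖d‖ - Real.sqrt 2 * n * U = U * (‖d‖ - Real.sqrt 2 * n) := by ring
      rw [e, abs_mul, abs_of_pos hU0]
      refine (mul_le_mul_of_nonneg_left hdn hU0.le).trans (le_of_eq ?_)
      field_simp
    refine (abs_sub_le _ (U * ‖d‖) _).trans ?_
    rw [hc₁]; linarith
  -- The estimates for `X` and `W` also hold for `G` and `Y` themselves, so the quasimode is an
  -- admissible trial element below the gap.
  have hlt : ‖-Y‖ < k * ‖G‖ := by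
    have a1 := estX'' G (by simp; positivity)
    have a2 := (abs_le.mp (estW' Y (by simp; positivity))).2
    rw [norm_neg]
    have a3 : k * (U ^ 2 * n ^ 3 / 2) ≤ k * ‖G‖ := by gcongr
    have a4 : c₁ ≤ c₁ * U := le_mul_of_one_le_right c1 hU1
    nlinarith
  obtain ⟨x, y, l, hl0, hlk, hx, hcr⟩ := exists_isCritical hΓ hk hgap hG hlt
  obtain ⟨X, W, hX, hW, hXW⟩ := hcr.exists_near hk hgap hlk hx hG hZ
  replace hX := hX.trans (div_le_div_of_nonneg_right hZC (by positivity))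
  replace hW := hW.trans (div_le_div_of_nonneg_right hZC (by positivity))
  have hXpos : 0 < ‖X‖ := lt_of_lt_of_le (by positivity) (estX'' X hX)
  have hXne : X ≠ 0 := norm_pos_iff.mp hXpos
  -- Injectivity of the operator is what makes the critical value strictly positive.
  have hWne : W ≠ 0 := by
    rintro rfl
    exact hXne (hker X (by simpa using hXW.1))
  have hWpos : 0 < ‖W‖ := norm_pos_iff.mpr hWne
  have hnorm : ‖W‖ ^ 2 = l * ‖X‖ ^ 2 := by simpa using hXW.norm_sq
  have hle : l = (‖W‖ / ‖X‖) ^ 2 := by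
    rw [div_pow, hnorm]; field_simp
  have hq1 := (hXW.smul ((‖X‖⁻¹ : ℝ) : ℂ))
  refine ⟨‖W‖ / ‖X‖, ((‖X‖⁻¹ : ℝ) : ℂ) • X, ((‖W‖⁻¹ : ℝ) : ℂ) • W, by positivity, ?_, ?_, ?_,
    ?_, ?_, ?_, ?_⟩
  · exact lt_of_pow_lt_pow_left₀ 2 hk.le (hle ▸ hlk)
  · rw [norm_smul, Complex.norm_real, Real.norm_of_nonneg (by positivity)]
    exact inv_mul_cancel₀ hXpos.ne'
  · rw [norm_smul, Complex.norm_real, Real.norm_of_nonneg (by positivity)]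
    exact inv_mul_cancel₀ hWpos.ne'
  · rw [← hle]
    convert hq1 using 1
    rw [smul_smul, smul_neg, ← Complex.ofReal_mul]
    congr 3
    field_simp
  · refine (abs_div_sub_le hn hU0 c1 (estW' W hW) (estX' X hX) (estX'' X hX)).trans ?_
    refine div_le_div_of_nonneg_right ?_ (by positivity)
    have : 0 ≤ 2 * c₂ / n ^ 3 + 2 * c₁ / (Real.sqrt 2 * n) := by positivity
    linarith
  · have e : ((n⁻¹ : ℝ) : ℂ) • v
        = (((U ^ 2 * n ^ 3)⁻¹ : ℝ) : ℂ) • (((U ^ 2 * n ^ 2 : ℝ) : ℂ) • v) := by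
      rw [smul_smul, ← Complex.ofReal_mul]
      congr 2
      field_simp
    rw [e]
    refine (norm_normalize_sub_le hXne (by positivity)).trans ?_
    calc _ ≤ (c₂ * U + c₂ * U) / (U ^ 2 * n ^ 3) := by
          gcongr
          · exact estX X hX
          · exact estX' X hX
      _ = 2 * c₂ / n ^ 3 / U := by field_simp; ring
      _ ≤ _ := by
          gcongr
          have : 0 ≤ 2 * c₁ / n ^ 3 + 2 * Real.sqrt 2 * c₂ / n ^ 5
            + 2 * c₁ / (Real.sqrt 2 * n) := by positivity
          linarith
  · have e : (((Real.sqrt 2 * n)⁻¹ : ℝ) : ℂ) • d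
        = (((Real.sqrt 2 * n * U)⁻¹ : ℝ) : ℂ) • ((U : ℂ) • d) := by
      rw [smul_smul, ← Complex.ofReal_mul]
      congr 2
      field_simp
    rw [e]
    refine (norm_normalize_sub_le hWne (by positivity)).trans ?_
    have hcc : C + C / k ≤ c₁ := by
      have : 0 ≤ C / (Real.sqrt 2 * n) := by positivity
      linarith
    calc _ ≤ (c₁ + c₁) / (Real.sqrt 2 * n * U) := by
          gcongr
          · exact (estW W hW).trans hcc
          · exact estW' W hW
      _ = 2 * c₁ / (Real.sqrt 2 * n) / U := by field_simp; ring
      _ ≤ _ := by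
          gcongr
          have : 0 ≤ 2 * c₁ / n ^ 3 + 2 * Real.sqrt 2 * c₂ / n ^ 5
            + 2 * c₂ / n ^ 3 := by positivity
          linarith

end Abstract

end DomainWallDirac

end

/-! ### Zero modes and eigenvectors from critical pairs -/

noncomputable section

namespace DomainWallDirac

open Filter Topology Set

section Modes

variable {m : ℝ → ℝ} {hm : Continuous m} {hm' : Continuous fun x => -m x}

lemma profile_mem_opGraph (hu : MemLp (fun x => (profile m x : ℂ)) 2 (volume : Measure ℝ)) :
    (hu.toLp _, 0) ∈ opGraph m hm := by
  have h : IsPrim (fun x => (profile m x : ℂ)) (fun x => ((-m x * profile m x : ℝ) : ℂ)) :=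
    IsPrim.of_hasDerivAt (fun x => (profile_hasDerivAt hm x).ofReal_comp)
      (continuous_ofReal.comp (hm.neg.mul (profile_continuous hm)))
  refine (IsPrim.weakEq hm (g := fun _ => 0) (h.congr (Eventually.of_forall fun x => ?_))
    (locallyIntegrable_const 0)).congr hu.coeFn_toLp.symm (Lp.coeFn_zero ℂ 2 volume).symm
  simp only; push_cast; ring

/-- A square integrable zero mode excludes square integrable zero modes for the opposite mass. -/
lemma eq_zero_of_mem_opGraph_neg
    (hu : MemLp (fun x => (profile m x : ℂ)) 2 (volume : Measure ℝ)) {q : L2C}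
    (hq : (q, 0) ∈ opGraph (fun x => -m x) hm') : q = 0 := by
  obtain ⟨c, hc⟩ := ae_eq_profile_of_mem_opGraph hq
  -- A zero mode for the opposite mass is `c / profile m`; its product with the square integrable
  -- profile is the constant `c`, which can be integrable on the line only if it vanishes.
  have h1 : Integrable fun x => q x * (profile m x : ℂ) := (Lp.memLp q).integrable_mul hu
  have h2 : Integrable (fun _ : ℝ => c) := h1.congr (by
    filter_upwards [hc] with x hx
    have : (profile m x : ℂ) ≠ 0 := by exact_mod_cast (profile_pos m x).ne'
    rw [hx, profile_neg_mass]; push_cast; rw [mul_assoc, inv_mul_cancel₀ this, mul_one])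
  rw [integrable_const_iff, isFiniteMeasure_iff] at h2
  simp only [Real.volume_univ, lt_self_iff_false, or_false] at h2
  rw [Lp.eq_zero_iff_ae_eq_zero]
  filter_upwards [hc] with x hx
  rw [hx, h2]; simp

lemma zeroMode_eq_embP (x : ℝ) : zeroMode m x = embP ((2 * gam m : ℝ) * profile m x) := by
  apply C2_ext
  · simp [zeroMode, embP_zero]; ring
  · simp [zeroMode, embP_one]; ring

lemma integral_profile_sq_pos
    (hu : MemLp (fun x => (profile m x : ℂ)) 2 (volume : Measure ℝ)) :
    0 < ∫ x, profile m x ^ 2 := by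
  have hi : Integrable fun x => profile m x ^ 2 := by
    simpa using hu.integrable_norm_pow (by norm_num)
  rw [integral_pos_iff_support_of_nonneg (fun x => sq_nonneg _) hi]
  have : Function.support (fun x => profile m x ^ 2) = univ := by
    ext x; simp [(profile_pos m x).ne']
  rw [this]; simp

lemma gam_pos
    (hu : MemLp (fun x => (profile m x : ℂ)) 2 (volume : Measure ℝ)) : 0 < gam m := by
  have := Real.sqrt_pos.mpr (integral_profile_sq_pos hu)
  unfold gam; positivity

lemma norm_profile_toLp_sq (hu : MemLp (fun x => (profile m x : ℂ)) 2 (volume : Measure ℝ)) :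
    ‖hu.toLp _‖ ^ 2 = ∫ x, profile m x ^ 2 := by
  rw [norm_toLp_sq_eq_integral]; simp

lemma gam_eq (hu : MemLp (fun x => (profile m x : ℂ)) 2 (volume : Measure ℝ)) :
    gam m = (Real.sqrt 2 * ‖hu.toLp _‖)⁻¹ := by
  rw [gam, ← norm_profile_toLp_sq hu, Real.sqrt_sq (norm_nonneg _), one_div]

lemma memLp_zeroMode (hu : MemLp (fun x => (profile m x : ℂ)) 2 (volume : Measure ℝ)) :
    MemLp (zeroMode m) 2 (volume : Measure ℝ) := by
  have := embP.comp_memLp' (hu.const_mul ((2 * gam m : ℝ) : ℂ))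
  exact this.ae_eq (Eventually.of_forall fun x => (zeroMode_eq_embP x).symm)

lemma zeroMode_toLp_eq_join
    (hu : MemLp (fun x => (profile m x : ℂ)) 2 (volume : Measure ℝ)) :
    (memLp_zeroMode hu).toLp _ = join (((2 * gam m : ℝ) : ℂ) • hu.toLp _) 0 := by
  refine Lp.ext ?_
  filter_upwards [(memLp_zeroMode hu).coeFn_toLp, coeFn_join (((2 * gam m : ℝ) : ℂ) • hu.toLp _) 0,
    Lp.coeFn_smul ((2 * gam m : ℝ) : ℂ) (hu.toLp _), hu.coeFn_toLp,
    Lp.coeFn_zero ℂ 2 (volume : Measure ℝ)] with x h1 h2 h3 h4 h5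
  rw [h1, h2, h3, h5, Pi.smul_apply, h4, Pi.zero_apply, map_zero, add_zero, zeroMode_eq_embP,
    smul_eq_mul]

lemma norm_zeroMode_toLp
    (hu : MemLp (fun x => (profile m x : ℂ)) 2 (volume : Measure ℝ)) :
    ‖(memLp_zeroMode hu).toLp _‖ = 1 := by
  have h2 : Real.sqrt 2 ^ 2 = 2 := Real.sq_sqrt (by norm_num)
  have hn : ‖hu.toLp _‖ ≠ 0 := by
    intro h
    have := norm_profile_toLp_sq hu
    rw [h] at this
    have h' := integral_profile_sq_pos hu
    rw [← this] at h'
    norm_num at h'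
  refine (pow_left_inj₀ (norm_nonneg _) zero_le_one two_ne_zero).mp ?_
  rw [zeroMode_toLp_eq_join hu, norm_sq_join, norm_smul, Complex.norm_real, Real.norm_eq_abs, mul_pow,
    sq_abs, mul_pow, gam_eq hu, inv_pow, mul_pow, h2, norm_zero]
  field_simp
  norm_num

/-- The kernel of the Dirac operator when its zero mode is square integrable. -/
theorem eigenspace_zero {B : ℝ} (hm : Continuous m) (hB : ∀ x, |m x| ≤ B)
    (hu : MemLp (fun x => (profile m x : ℂ)) 2 (volume : Measure ℝ)) :
    eigenspace m 0 = Submodule.span ℂ {(memLp_zeroMode hu).toLp _} := by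
  have hg : ((2 * gam m : ℝ) : ℂ) ≠ 0 := by
    have := gam_pos hu
    exact_mod_cast (by positivity : 2 * gam m ≠ 0)
  apply le_antisymm
  · intro f hf
    obtain ⟨h1, h2⟩ := system_of_mem_eigenspace (hm := hm) (hm' := hm.neg) hf
    simp only [mul_zero, neg_zero, zero_smul] at h1 h2
    have hq := eq_zero_of_mem_opGraph_neg hu h2
    obtain ⟨c, hc⟩ := ae_eq_profile_of_mem_opGraph h1
    have hp : compP f = c • hu.toLp _ := by
      refine Lp.ext ?_
      filter_upwards [hc, Lp.coeFn_smul c (hu.toLp _), hu.coeFn_toLp] with x e1 e2 e3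
      rw [e1, e2, Pi.smul_apply, e3, smul_eq_mul]
    rw [Submodule.mem_span_singleton]
    refine ⟨c * ((2 * gam m : ℝ) : ℂ)⁻¹, ?_⟩
    rw [zeroMode_toLp_eq_join hu, ← join_smul, smul_zero, smul_smul, inv_mul_cancel_right₀ hg, ← hp,
      ← hq, join_compP_compQ]
  · rw [Submodule.span_singleton_le_iff_mem, zeroMode_toLp_eq_join]
    refine join_mem_eigenspace (hm := hm) (hm' := hm.neg) hB ?_ ?_
    · have := (opGraph m hm).smul_mem ((2 * gam m : ℝ) : ℂ) (profile_mem_opGraph hu)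
      simpa using this
    · rw [smul_smul, mul_zero, neg_zero, zero_mul, zero_smul]
      exact (opGraph (fun x => -m x) hm.neg).zero_mem

lemma IsCritical.snd_unique {E : Type*} [NormedAddCommGroup E] [InnerProductSpace ℂ E]
    {Γ : Submodule ℂ (E × E)} {l : ℝ} {x y y' : E} (h : IsCritical Γ l x y)
    (h' : IsCritical Γ l x y') : y' = y := by
  have h0 : (0, y' - y) ∈ Γ := by simpa using Γ.sub_mem h'.1 h.1
  have h1 := h.2 _ h0
  have h2 := h'.2 _ h0
  simp only [inner_zero_right, mul_zero] at h1 h2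
  rw [← sub_eq_zero, ← inner_self_eq_zero (𝕜 := ℂ), inner_sub_left, h1, h2, sub_zero]

/-- One half of the first order system is the graph relation of the critical pair, the other is its
Euler–Lagrange equation divided by `e`. The two signs of `s` account for the symmetric pair of
eigenvalues. -/
lemma eigenvector_mem {B e s : ℝ} (hB : ∀ x, |m x| ≤ B) (he : e ≠ 0) (hs : s ^ 2 = 1)
    {φ ψ : L2C} (h : IsCritical (opGraph (fun x => -m x) hm') (e ^ 2) φ (-((e : ℂ) • ψ))) :
    join ψ ((s * I : ℂ) • φ) ∈ eigenspace m ((s * e : ℝ) : ℂ) := by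
  have he' : (e : ℂ) ≠ 0 := by exact_mod_cast he
  have hs' : (s : ℂ) ^ 2 = 1 := by exact_mod_cast hs
  have hm : Continuous m := hm'.neg.congr fun x => neg_neg _
  refine join_mem_eigenspace (hm := hm) (hm' := hm') hB ?_ ?_
  · have h1 := (opGraph m hm).smul_mem (-(e : ℂ)⁻¹) h.mem_opGraph
    convert h1 using 1
    rw [Prod.smul_mk, smul_neg, neg_smul (e : ℂ)⁻¹ ((e : ℂ) • ψ), neg_neg,
      inv_smul_smul₀ he', smul_smul, smul_smul]
    congr 2
    push_cast
    field_simp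
    linear_combination (-(s : ℂ) ^ 2) * I_sq + hs'
  · have h1 := (opGraph _ hm').smul_mem (s * I : ℂ) h.1
    convert h1 using 1
    rw [Prod.smul_mk, ← neg_smul, smul_smul]
    congr 2
    push_cast
    ring

/-- Eigenvectors below the gap are determined by the critical pair. -/
theorem eigenvector_unique {e k E : ℝ} (he : 0 < e) (hk : 0 < k) (hek : e < k) {g : L2C}
    (hgap : ∀ p ∈ opGraph (fun x => -m x) hm', inner ℂ g p.1 = 0 → k * ‖p.1‖ ≤ ‖p.2‖)
    {φ ψ : L2C} (hφ : φ ≠ 0)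
    (h : IsCritical (opGraph (fun x => -m x) hm') (e ^ 2) φ (-((e : ℂ) • ψ)))
    (hE : E ≠ 0) (hEk : E ^ 2 < k ^ 2) {f : H} (hf : f ∈ eigenspace m (E : ℂ)) (hf0 : f ≠ 0) :
    ∃ s : ℝ, s ^ 2 = 1 ∧ E = s * e ∧ ∃ t : ℂ, t • join ψ ((s * I : ℂ) • φ) = f := by
  have hm : Continuous m := hm'.neg.congr fun x => neg_neg _
  obtain ⟨h1, h2⟩ := system_of_mem_eigenspace (hm := hm) (hm' := hm') hf
  have hc := isCritical_of_system h1 h2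
  have hIE : -(I * (E : ℂ)) ≠ 0 := by simp [hE]
  -- If `q` vanished, the norm identity of the critical pair would force `E p = 0`, hence `f = 0`.
  have hq : compQ f ≠ 0 := by
    intro hq
    have h3 := hc.norm_sq
    rw [hq, norm_zero] at h3
    have h4 : (-(I * (E : ℂ))) • compP f = 0 := by
      rw [← norm_eq_zero]; exact pow_eq_zero_iff two_ne_zero |>.mp (by simpa using h3)
    have h5 : compP f = 0 := (smul_eq_zero.mp h4).resolve_left hIE
    refine hf0 ?_
    rw [← join_compP_compQ f, h5, hq]
    simp [join]
  obtain ⟨hl, t, ht⟩ := h.unique hk hgap (pow_lt_pow_left₀ hek he.le two_ne_zero) hEk hφ hc hq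
  have hs : (E / e) ^ 2 = 1 := by rw [div_pow, hl]; field_simp
  have hes : E = E / e * e := by field_simp
  refine ⟨E / e, hs, hes, -(I * t * (E / e : ℝ)), ?_⟩
  set s := E / e with hsd
  have hs' : (s : ℂ) ^ 2 = 1 := by exact_mod_cast hs
  have he' : (e : ℂ) ≠ 0 := by exact_mod_cast he.ne'
  -- Once `q = t φ`, the second slot is determined as well, and it recovers `p` because `E ≠ 0`.
  have hp : (-(I * (E : ℂ))) • compP f = t • -((e : ℂ) • ψ) :=
    (h.smul t).snd_unique (by rw [← hl, ← ht]; exact hc)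
  have hE' : (E : ℂ) = s * e := by exact_mod_cast hes
  have hp' : compP f = (-(I * t * s)) • ψ := by
    refine smul_right_injective _ hIE ?_
    simp only
    rw [hp, smul_neg, smul_smul, smul_smul, ← neg_smul, hE']
    congr 1
    linear_combination (-(t * e * s ^ 2)) * I_sq + t * e * hs'
  have hq' : compQ f = (-(I * t * s)) • (s * I : ℂ) • φ := by
    rw [ht, smul_smul]
    congr 1
    linear_combination (t * s ^ 2) * I_sq - t * hs'
  rw [← join_smul, ← hp', ← hq', join_compP_compQ]

end Modes

end DomainWallDirac

end

/-! ### Counting eigenvalues and the conclusion -/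

noncomputable section

namespace DomainWallDirac

open Filter Topology Set

section ThreeWall

variable {kinf δ : ℝ} {κ : ℝ → ℝ}

lemma exists_threeWall_bound (hκ : IsDomainWall kinf κ) (δ : ℝ) :
    ∃ B, ∀ x, |threeWall κ δ x| ≤ B := by
  obtain ⟨B, hB⟩ := hκ.exists_bound
  refine ⟨B, fun x => ?_⟩
  unfold threeWall
  split_ifs
  · exact hB _
  · rw [abs_neg]; exact hB _
  · exact hB _

lemma memLp_profile_threeWall (hκ : IsDomainWall kinf κ) (hk : 0 < kinf) (hδ : 1 ≤ δ) :
    MemLp (fun x => (profile (threeWall κ δ) x : ℂ)) 2 (volume : Measure ℝ) := by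
  obtain ⟨b, hb⟩ := exists_profileBound hκ
  have hb0 : 0 < b := lt_of_lt_of_le one_pos hb.1
  have hU := peak_pos κ δ
  have hm := threeWall_continuous hκ hδ
  refine (memLp_of_le_twoBumps hk (a := 2 * δ) (A := b ^ 3 * peak κ δ)
    (continuous_ofReal.comp (profile_continuous hm)).aestronglyMeasurable fun x => ?_).1
  rw [Function.comp_apply, Complex.norm_real, Real.norm_of_nonneg (profile_pos _ _).le,
    ← profile_abs (threeWall_odd hκ hδ) x]
  refine (profile_threeWall_bounds hκ hb hδ (abs_nonneg x)).1.trans ?_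
  rw [← mul_assoc]
  refine mul_le_mul_of_nonneg_left ?_ (by positivity)
  unfold twoBumps
  rcases abs_choice x with h | h
  · rw [h]
    exact le_add_of_nonneg_right (Real.exp_pos _).le
  · rw [h, show -x - 2 * δ = -(x + 2 * δ) by ring, abs_neg]
    exact le_add_of_nonneg_left (Real.exp_pos _).le

/-- Links the stated leading term to the quotient of the quasimode norms, using `γ = 1 / (√2 n)` and
`U = exp (2 ∫₀^δ κ)`. -/
lemma splitting_eq (hκ : IsDomainWall kinf κ) (hk : 0 < kinf) (δ : ℝ) :
    splitting κ δ = Real.sqrt 2 / (‖(memLp_profile hκ hk).toLp _‖ ^ 2 * peak κ δ) := by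
  have h2 : Real.sqrt 2 ^ 2 = 2 := Real.sq_sqrt (by norm_num)
  have e : Real.exp (-2 * ∫ y in (0 : ℝ)..δ, κ y) = profile κ δ ^ 2 := by
    rw [profile, ← Real.exp_nat_mul]; congr 1; push_cast; ring
  rw [splitting, e, gam_eq (memLp_profile hκ hk), peak, inv_pow, mul_pow, h2]
  have := (profile_pos κ δ).ne'
  field_simp

lemma approxMode_ae_eq (hκ : IsDomainWall kinf κ) (hk : 0 < kinf) (δ s : ℝ) :
    approxMode κ δ s =ᵐ[volume]
      join ((((Real.sqrt 2 * ‖(memLp_profile hκ hk).toLp _‖)⁻¹ : ℝ) : ℂ) •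
          (memLp_profile_diff hκ hk δ).toLp _)
        ((s * I : ℂ) • ((‖(memLp_profile hκ hk).toLp _‖⁻¹ : ℝ) : ℂ) •
          (memLp_profile hκ hk).toLp _) := by
  set v := (memLp_profile hκ hk).toLp _ with hv
  set d := (memLp_profile_diff hκ hk δ).toLp _ with hd
  have h2 : Real.sqrt 2 ^ 2 = 2 := Real.sq_sqrt (by norm_num)
  have hs : (Real.sqrt 2 : ℂ) ^ 2 = 2 := by exact_mod_cast h2
  have hs0 : (Real.sqrt 2 : ℂ) ≠ 0 := by
    intro h; rw [h] at hs; norm_num at hs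
  have hγ : gam κ = (Real.sqrt 2 * ‖v‖)⁻¹ := gam_eq _
  have hγ' : ((‖v‖⁻¹ : ℝ) : ℂ) = Real.sqrt 2 * gam κ := by
    rw [hγ]; push_cast; field_simp
  rw [← hγ, hγ', smul_smul]
  filter_upwards [coeFn_join ((gam κ : ℂ) • d) ((s * I * (Real.sqrt 2 * gam κ) : ℂ) • v),
    Lp.coeFn_smul (gam κ : ℂ) d, Lp.coeFn_smul (s * I * (Real.sqrt 2 * gam κ) : ℂ) v,
    (memLp_profile hκ hk).coeFn_toLp, (memLp_profile_diff hκ hk δ).coeFn_toLp]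
    with x h1 h3 h4 h5 h6
  rw [h1, h3, h4, Pi.smul_apply, Pi.smul_apply, hv, hd, h5, h6]
  apply C2_ext
  · simp only [approxMode, alphaR, alphaZero, alphaL, zeroMode, conj2, PiLp.add_apply,
      PiLp.sub_apply, PiLp.smul_apply, embP_zero, embQ_zero, smul_eq_mul]
    simp
    ring
  · simp only [approxMode, alphaR, alphaZero, alphaL, zeroMode, conj2, PiLp.add_apply,
      PiLp.sub_apply, PiLp.smul_apply, embP_one, embQ_one, smul_eq_mul]
    simp
    ring

lemma norm_join_le {p q : L2C} {A : ℝ} (hp : ‖p‖ ≤ A) (hq : ‖q‖ ≤ A) : ‖join p q‖ ≤ A := by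
  have hA : 0 ≤ A := (norm_nonneg _).trans hp
  refine (pow_le_pow_iff_left₀ (norm_nonneg _) hA two_ne_zero).mp ?_
  rw [norm_sq_join]
  have h1 := pow_le_pow_left₀ (norm_nonneg _) hp 2
  have h2 := pow_le_pow_left₀ (norm_nonneg _) hq 2
  linarith

lemma eLpNorm_sub_le_of_ae_eq {f g : H} {h : ℝ → C2} (hh : h =ᵐ[volume] g) {A : ℝ}
    (hA : ‖f - g‖ ≤ A) : eLpNorm (fun x => f x - h x) 2 volume ≤ ENNReal.ofReal A := by
  have e : eLpNorm (fun x => f x - h x) 2 volume = ‖f - g‖ₑ := by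
    rw [Lp.enorm_def]
    refine eLpNorm_congr_ae ?_
    filter_upwards [hh, Lp.coeFn_sub f g] with x h1 h2
    rw [h1, h2, Pi.sub_apply]
  rw [e, ← ofReal_norm]
  exact ENNReal.ofReal_le_ofReal hA

lemma finrank_span_of_norm_eq_one {f : H} (hf : ‖f‖ = 1) :
    Module.finrank ℂ (Submodule.span ℂ {f}) = 1 :=
  finrank_span_singleton (by rintro rfl; simp at hf)

lemma norm_eigenvector {s : ℝ} (hs : s ^ 2 = 1) {φ ψ : L2C} (hφ : ‖φ‖ = 1) (hψ : ‖ψ‖ = 1) :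
    ‖join ψ ((s * I : ℂ) • φ)‖ = 1 := by
  have h : |s| = 1 := by
    rw [← pow_left_inj₀ (abs_nonneg s) zero_le_one two_ne_zero, sq_abs, hs, one_pow]
  refine (pow_left_inj₀ (norm_nonneg _) zero_le_one two_ne_zero).mp ?_
  rw [norm_sq_join, norm_smul, norm_mul, Complex.norm_real, Complex.norm_I, Real.norm_eq_abs, h, hφ,
    hψ]
  norm_num

end ThreeWall

/-- The spectrum of a Dirac operator with a square integrable zero mode and one critical pair
below the gap: three simple eigenvalues. -/
theorem eigenvalues_of_isCritical {m : ℝ → ℝ} {hm' : Continuous fun x => -m x} {B : ℝ}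
    (hB : ∀ x, |m x| ≤ B) (hu : MemLp (fun x => (profile m x : ℂ)) 2 (volume : Measure ℝ))
    {K e k : ℝ} (he : 0 < e) (heK : e ≤ K) (hKk : K < k) {g : L2C}
    (hgap : ∀ p ∈ opGraph (fun x => -m x) hm', inner ℂ g p.1 = 0 → k * ‖p.1‖ ≤ ‖p.2‖)
    {φ ψ : L2C} (hφ : ‖φ‖ = 1) (hψ : ‖ψ‖ = 1)
    (h : IsCritical (opGraph (fun x => -m x) hm') (e ^ 2) φ (-((e : ℂ) • ψ))) :
    {E : ℝ | E ∈ Icc (-K) K ∧ IsEigenvalue m (E : ℂ)} = {-e, 0, e} ∧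
      IsSimpleEigenvalue m 0 ∧ IsSimpleEigenvalue m (e : ℂ) ∧
      IsSimpleEigenvalue m ((-e : ℝ) : ℂ) := by
  have hm : Continuous m := hm'.neg.congr fun x => neg_neg _
  have hK : 0 < K := he.trans_le heK
  have hk : 0 < k := hK.trans hKk
  have hek : e < k := heK.trans_lt hKk
  have hφ0 : φ ≠ 0 := by rintro rfl; simp at hφ
  have h0 := eigenspace_zero hm hB hu
  have key : ∀ s : ℝ, s ^ 2 = 1 →
      eigenspace m ((s * e : ℝ) : ℂ) = Submodule.span ℂ {join ψ ((s * I : ℂ) • φ)} := by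
    intro s hs
    have hs0 : s ≠ 0 := by rintro rfl; norm_num at hs
    apply le_antisymm
    · intro f hf
      by_cases hf0 : f = 0
      · rw [hf0]; exact Submodule.zero_mem _
      obtain ⟨s', hs', hE, t, ht⟩ := eigenvector_unique he hk hek hgap hφ0 h
        (mul_ne_zero hs0 he.ne') (by rw [mul_pow, hs, one_mul]; gcongr) hf hf0
      rw [mul_right_cancel₀ he.ne' hE]
      exact Submodule.mem_span_singleton.mpr ⟨t, ht⟩
    · rw [Submodule.span_singleton_le_iff_mem]
      exact eigenvector_mem hB he.ne' hs h
  have simple : ∀ s : ℝ, s ^ 2 = 1 → IsSimpleEigenvalue m ((s * e : ℝ) : ℂ) := by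
    intro s hs
    rw [IsSimpleEigenvalue, key s hs]
    exact finrank_span_of_norm_eq_one (norm_eigenvector hs hφ hψ)
  have simple0 : IsSimpleEigenvalue m 0 := by
    rw [IsSimpleEigenvalue, h0]
    exact finrank_span_of_norm_eq_one (norm_zeroMode_toLp hu)
  have eig : ∀ E : ℂ, IsSimpleEigenvalue m E → IsEigenvalue m E := by
    intro E hE hbot
    rw [IsSimpleEigenvalue, hbot, finrank_bot] at hE
    exact zero_ne_one hE
  have sp : IsSimpleEigenvalue m (e : ℂ) := by simpa using simple 1 (by norm_num)
  have sm : IsSimpleEigenvalue m ((-e : ℝ) : ℂ) := by simpa using simple (-1) (by norm_num)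
  refine ⟨?_, simple0, sp, sm⟩
  ext E
  simp only [mem_ofPred_eq, mem_insert_iff, mem_singleton_iff]
  constructor
  · rintro ⟨⟨hE1, hE2⟩, hE⟩
    by_cases hE0 : E = 0
    · exact Or.inr (Or.inl hE0)
    obtain ⟨f, hf, hf0⟩ := Submodule.exists_mem_ne_zero_of_ne_bot hE
    have hEk : E ^ 2 < k ^ 2 := by
      rw [sq_lt_sq, abs_of_pos hk]
      exact (abs_le.mpr ⟨hE1, hE2⟩).trans_lt hKk
    obtain ⟨s, hs, hEs, -⟩ := eigenvector_unique he hk hek hgap hφ0 h hE0 hEk hf hf0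
    rcases (sq_eq_sq_iff_eq_or_eq_neg.mp (hs.trans (one_pow 2).symm)) with rfl | rfl
    · right; right; linarith
    · left; linarith
  · rintro (rfl | rfl | rfl)
    · exact ⟨⟨by linarith, by linarith⟩, eig _ sm⟩
    · exact ⟨⟨by linarith, hK.le⟩, eig _ (by simpa using simple0)⟩
    · exact ⟨⟨by linarith, heK⟩, eig _ sp⟩

end DomainWallDirac

end

theorem mainTheorem2 (kinf : ℝ) (hkinf : 0 < kinf) (κ : ℝ → ℝ)
    (hκ : DomainWallDirac.IsDomainWall kinf κ) (hgap : DomainWallDirac.SpectralGap kinf κ)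
    (K : ℝ) (hK : 0 < K) (hKinf : K < kinf) :
    ∃ δ₀ : ℝ, 2 ≤ δ₀ ∧ ∃ C : ℝ, ∀ δ : ℝ, δ₀ < δ →
      -- the exact normalized zero mode, which spans the zero eigenspace
      (∃ h : MemLp (DomainWallDirac.zeroMode (DomainWallDirac.threeWall κ δ)) 2
          (volume : Measure ℝ),
        ‖h.toLp‖ = 1 ∧
        DomainWallDirac.eigenspace (DomainWallDirac.threeWall κ δ) 0 =
          Submodule.span ℂ {h.toLp}) ∧
      ∃ Ep Em : ℝ, Em < 0 ∧ 0 < Ep ∧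
        -- the eigenvalues in `[-K, K]` are exactly `Em`, `0`, `Ep`, and they are simple
        {E : ℝ | E ∈ Set.Icc (-K) K ∧
          DomainWallDirac.IsEigenvalue (DomainWallDirac.threeWall κ δ) (E : ℂ)} = {Em, 0, Ep} ∧
        DomainWallDirac.IsSimpleEigenvalue (DomainWallDirac.threeWall κ δ) 0 ∧
        DomainWallDirac.IsSimpleEigenvalue (DomainWallDirac.threeWall κ δ) (Ep : ℂ) ∧
        DomainWallDirac.IsSimpleEigenvalue (DomainWallDirac.threeWall κ δ) (Em : ℂ) ∧
        |Ep - DomainWallDirac.splitting κ δ| ≤ C * Real.exp (-4 * kinf * δ) ∧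
        |Em - (-DomainWallDirac.splitting κ δ)| ≤ C * Real.exp (-4 * kinf * δ) ∧
        -- normalized eigenfunctions and their expansions in `L²(ℝ; ℂ²)`
        (∃ αp ∈ DomainWallDirac.eigenspace (DomainWallDirac.threeWall κ δ) (Ep : ℂ),
          ‖αp‖ = 1 ∧
          eLpNorm (fun x => αp x - DomainWallDirac.approxMode κ δ 1 x) 2 volume ≤
            ENNReal.ofReal (C * Real.exp (-2 * kinf * δ))) ∧
        (∃ αm ∈ DomainWallDirac.eigenspace (DomainWallDirac.threeWall κ δ) (Em : ℂ),
          ‖αm‖ = 1 ∧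
          eLpNorm (fun x => αm x - DomainWallDirac.approxMode κ δ (-1) x) 2 volume ≤
            ENNReal.ofReal (C * Real.exp (-2 * kinf * δ))) := by
  open DomainWallDirac in
  obtain ⟨b, hb⟩ := exists_profileBound hκ
  have hb1 := hb.1
  set n := ‖(memLp_profile hκ hkinf).toLp _‖ with hn
  have hn0 : 0 < n := by
    have h1 := norm_profile_toLp_sq (memLp_profile hκ hkinf)
    have h2 := integral_profile_sq_pos (memLp_profile hκ hkinf)
    rw [← h1] at h2
    exact (norm_nonneg _).lt_of_ne' (by rintro h; rw [h] at h2; norm_num at h2)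
  -- A threshold strictly between: below `κ∞` because localization loses a little, above `K` so that
  -- eigenvalues at `±K` are still below the gap.
  set k := (K + kinf) / 2 with hk
  have hKk : K < k := by linarith
  have hk0 : 0 < k := by linarith
  obtain ⟨δ₁, hδ₁, hgap'⟩ := exists_gap_threeWall hκ hgap hkinf hk0.le
    (show k < kinf by linarith)
  obtain ⟨Cq, hCq, hquasi⟩ := exists_quasimodes hκ hkinf
  obtain ⟨C, U₀, hC, hU₀, hasym⟩ := exists_critical_asymptotics (E := L2C) hn0 hk0 hCq.le
  -- For `U ≥ U₁` the critical value satisfies `e ≤ K`. The bound on `δ` below ensures `U ≥ U₀ + U₁`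
  -- through `b² U ≥ e^{2κ∞δ} ≥ 2κ∞δ`; the factor `b⁴` in the constant converts `U⁻²` into
  -- `e^{-4κ∞δ}`, and it also covers the `b²` needed for `U⁻¹`.
  set U₁ := (Real.sqrt 2 / n ^ 2 + C) / K with hU₁
  have hU₁0 : 0 ≤ U₁ := by positivity
  refine ⟨max 2 (max δ₁ (b ^ 2 * (U₀ + U₁) / (2 * kinf))), le_max_left _ _, C * b ^ 4,
    fun δ hδ => ?_⟩
  obtain ⟨hδ2, hδ'⟩ := max_lt_iff.mp hδ
  obtain ⟨hδ3, hδ4⟩ := max_lt_iff.mp hδ'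
  have hδ1 : 1 ≤ δ := by linarith
  obtain ⟨-, hpk⟩ := peak_bounds hb hδ1
  have hm := threeWall_continuous hκ hδ1
  obtain ⟨g, hg⟩ := hgap' δ hδ3 hm.neg
  obtain ⟨G, Y, Z, N, hG, hY, hZ, e1, e2, e3, e4⟩ := hquasi δ hδ1 hm hm.neg
  have hu := memLp_profile_threeWall hκ hkinf hδ1
  obtain ⟨B, hB⟩ := exists_threeWall_bound hκ δ
  have hU0 := peak_pos κ δ
  set U := peak κ δ with hU
  have hUU : U₀ + U₁ ≤ U := by
    rw [div_lt_iff₀ (by positivity)] at hδ4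
    have h1 := Real.add_one_le_exp (2 * kinf * δ)
    refine le_of_mul_le_mul_left ?_ (show 0 < b ^ 2 by positivity)
    linarith
  have hU1 : 1 ≤ U := by linarith
  have inv1 : U⁻¹ ≤ b ^ 2 * Real.exp (-2 * kinf * δ) := by
    rw [inv_le_iff_one_le_mul₀ hU0, show -2 * kinf * δ = -(2 * kinf * δ) by ring, Real.exp_neg]
    have := Real.exp_pos (2 * kinf * δ)
    field_simp
    exact hpk
  have inv2 : (U ^ 2)⁻¹ ≤ b ^ 4 * Real.exp (-4 * kinf * δ) := by
    have := pow_le_pow_left₀ (by positivity) inv1 2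
    rw [inv_pow] at this
    refine this.trans (le_of_eq ?_)
    rw [mul_pow, ← Real.exp_nat_mul, ← pow_mul]
    congr 2; push_cast; ring
  obtain ⟨e, φ, ψ, he0, -, hφ, hψ, hcr, a1, a2, a3⟩ := hasym U (by linarith)
    (opGraph (fun x => -threeWall κ δ x) hm.neg) g _ _ G Y Z N isClosed_opGraph hg
    (fun q hq => eq_zero_of_mem_opGraph_neg hu hq) hG
    (fun p hp => inner_eq_neg_inner_of_mem_opGraph hY hp) hn.symm hZ e1 e2 e3 e4
  have heK : e ≤ K := by
    have h1 := (abs_le.mp a1).2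
    have h2 : C / U ^ 2 ≤ C / U := by
      gcongr
      exact le_self_pow₀ hU1 two_ne_zero
    have h3 : Real.sqrt 2 / n ^ 2 + C ≤ U * K := by
      rw [← div_le_iff₀ hK]; linarith
    have h4 : Real.sqrt 2 / (n ^ 2 * U) + C / U = (Real.sqrt 2 / n ^ 2 + C) / U := by
      field_simp
    have h5 : (Real.sqrt 2 / n ^ 2 + C) / U ≤ K := by
      rw [div_le_iff₀ hU0]; linarith
    linarith
  obtain ⟨hset, s0, sp, sm⟩ := eigenvalues_of_isCritical hB hu he0 heK hKk hg hφ hψ hcr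
  have hen : |e - splitting κ δ| ≤ C * b ^ 4 * Real.exp (-4 * kinf * δ) := by
    rw [splitting_eq hκ hkinf]
    refine a1.trans ?_
    rw [div_eq_mul_inv, mul_assoc]
    gcongr
  have hcu : C / U ≤ C * b ^ 4 * Real.exp (-2 * kinf * δ) := by
    rw [div_eq_mul_inv, mul_assoc]
    refine mul_le_mul_of_nonneg_left (inv1.trans ?_) hC.le
    gcongr
    norm_num
  have happ : ∀ s : ℝ, s ^ 2 = 1 →
      eLpNorm (fun x => (join ψ ((s * I : ℂ) • φ)) x - approxMode κ δ s x) 2 volume ≤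
        ENNReal.ofReal (C * b ^ 4 * Real.exp (-2 * kinf * δ)) := by
    intro s hs
    refine eLpNorm_sub_le_of_ae_eq (approxMode_ae_eq hκ hkinf δ s) ?_
    rw [join_sub, ← smul_sub]
    refine (norm_join_le a3 ?_).trans hcu
    have h : |s| = 1 := by
      rw [← pow_left_inj₀ (abs_nonneg s) zero_le_one two_ne_zero, sq_abs, hs, one_pow]
    rw [norm_smul, norm_mul, Complex.norm_real, Complex.norm_I, Real.norm_eq_abs, h, one_mul,
      one_mul]
    exact a2
  refine ⟨⟨memLp_zeroMode hu, norm_zeroMode_toLp hu, eigenspace_zero hm hB hu⟩, e, -e,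
    by linarith, he0, hset, s0, sp, sm, hen, ?_, ?_, ?_⟩
  · rwa [← neg_sub', abs_neg]
  · exact ⟨_, by simpa using eigenvector_mem hB he0.ne' (s := 1) (by norm_num) hcr,
      norm_eigenvector (by norm_num) hφ hψ, happ 1 (by norm_num)⟩
  · exact ⟨_, by simpa using eigenvector_mem hB he0.ne' (s := -1) (by norm_num) hcr,
      norm_eigenvector (by norm_num) hφ hψ, happ (-1) (by norm_num)⟩
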